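/- **Setting.** Let $n\ge 2$, let $M$ be a smooth $n$-dimensional manifold (Hausdorff, second countable, without boundary), and let $N=\mathbb R\times M$ carry the Lorentzian metric $$g=-\beta(t,x)\,dt^2+h(t,x),$$ where $\beta>0$ is a smooth function on $N$ and $h(t,\cdot)$, $t\in\mathbb R$, is a smooth one-parameter family of Riemannian metrics on $M$. Time-orient $N$ by $\partial_t$ and assume that $(N,g)$ is globally hyperbolic, i.e. strongly causal with $J^+(p)\cap J^-(q)$ compact for all $p,q\in N$. Let $T>0$, let $\Omega\subset M$ be a compact $n$-dimensional smooth submanifold with boundary, and let $\Sigma=[0,T]\times\partial\Omega$. Write $p\ll q$ if $p\ne q$ and there is a piecewise smooth future-directed timelike path from $p$ to $q$, and $p\le q$ if $p=q$ or there is a piecewise smooth future-directed causal path from $p$ to $q$. Put $J^+(p)=\{q: p\le q\}$, $J^-(p)=\{q: q\le p\}$, $I^+(\Sigma)=\{q: z\ll q \text{ for some } z\in\Sigma\}$ and $I^-(\Sigma)=\{q: q\ll z\text{ for some } z\in\Sigma\}$. The time separation $\tau(p,q)\in[0,\infty]$ is the supremum of the lengths $\int\sqrt{-g(\dot\alpha,\dot\alpha)}$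 of all piecewise smooth future-directed causal paths $\alpha$ from $p$ to $q$, and $0$ if there are none. **Lemma (Boundary optimal geodesics).** Let $x\in([0,T]\times\Omega)\setminus\Sigma$. 1. If $x\in I^+(\Sigma)$, then there are a point $z\in J^-(x)\cap\Sigma$ with $\tau(z,x)=0$ and a future-directed lightlike geodesic $\gamma$ of $(N,g)$, defined on a maximal open interval containing $[0,1]$, with $\gamma(0)=z$, $\gamma(1)=x$ and $\gamma([0,1])\subset[0,T]\times\Omega$, whose first intersection with $\Sigma$ is transverse. 2. If $x\in I^-(\Sigma)$, then there are a point $z\in J^+(x)\cap\Sigma$ with $\tau(x,z)=0$ and a past-directed lightlike geodesic $\gamma$ of $(N,g)$, defined on a maximal open interval containing $[0,1]$, with $\gamma(0)=z$, $\gamma(1)=x$ and $\gamma([0,1])\subset[0,T]\times\Omega$, whose first intersection with $\Sigma$ is transverse. Here the first intersection is transverse if there is a smallest $s_0\in[0,1]$ with $\gamma(s_0)\in\Sigma$, and for it $\mathbb R\dot\gamma(s_0)+T_{\gamma(s_0)}\Sigma=T_{\gamma(s_0)}N$, where $T_{(t,p)}\Sigma=\mathbb R\,\partial_t\oplus T_p\partial\Omega$.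 -/

import Mathlib

open Set Filter Topology MeasureTheory
open scoped Manifold ContDiff ENNReal

noncomputable section

/-- The model space of an `n`-dimensional manifold. -/
abbrev Model (n : ℕ) : Type := EuclideanSpace ℝ (Fin n)

/-- The tangent space of `ℝ × M` at a point lying over `p : M`: a vector is a pair consisting of its
`∂_t`-component and its component in `T_p M`. -/
abbrev SpacetimeTangent (n : ℕ) {M : Type*} [TopologicalSpace M] [ChartedSpace (Model n) M]
    (p : M) : Type :=
  ℝ × TangentSpace 𝓘(ℝ, Model n) p

/-- A Lorentzian metric `g = -β(t,x) dt² + h(t,x)` on `N = ℝ × M`, where `β > 0` is smooth and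
`h(t, ·)` is a smooth one-parameter family of Riemannian metrics on `M`. Smoothness of the family
means joint smoothness in `(t, x)`. -/
structure SplitMetric (n : ℕ) (M : Type*) [TopologicalSpace M] [ChartedSpace (Model n) M]
    [IsManifold 𝓘(ℝ, Model n) ∞ M] where
  β : ℝ × M → ℝ
  β_pos : ∀ q, 0 < β q
  β_smooth : ContMDiff (𝓘(ℝ, ℝ).prod 𝓘(ℝ, Model n)) 𝓘(ℝ, ℝ) ∞ β
  h : ∀ (_ : ℝ) (p : M),
    TangentSpace 𝓘(ℝ, Model n) p →L[ℝ] TangentSpace 𝓘(ℝ, Model n) p →L[ℝ] ℝ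
  h_symm : ∀ t p v w, h t p v w = h t p w v
  h_pos : ∀ t p v, v ≠ 0 → 0 < h t p v v
  h_smooth : ContMDiff (𝓘(ℝ, ℝ).prod 𝓘(ℝ, Model n))
    (𝓘(ℝ, Model n).prod 𝓘(ℝ, Model n →L[ℝ] Model n →L[ℝ] ℝ)) ∞
    (fun q : ℝ × M => Bundle.TotalSpace.mk' (Model n →L[ℝ] Model n →L[ℝ] ℝ)
      (E := fun p : M =>
        TangentSpace 𝓘(ℝ, Model n) p →L[ℝ] TangentSpace 𝓘(ℝ, Model n) p →L[ℝ] ℝ)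
      q.2 (h q.1 q.2))

/-- Velocity at `s` of a curve in `ℝ × M`, the derivative being taken within `S` (one-sided at an
end point of an interval `S`). -/
def velocityWithin (n : ℕ) {M : Type*} [TopologicalSpace M] [ChartedSpace (Model n) M]
    (γ : ℝ → ℝ × M) (S : Set ℝ) (s : ℝ) : SpacetimeTangent n (γ s).2 :=
  (derivWithin (fun r => (γ r).1) S s,
    mfderivWithin 𝓘(ℝ, ℝ) 𝓘(ℝ, Model n) (fun r => (γ r).2) S s (1 : ℝ))

/-- Velocity at `s` of a curve in `ℝ × M`. -/
def velocity (n : ℕ) {M : Type*} [TopologicalSpace M] [ChartedSpace (Model n) M]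
    (γ : ℝ → ℝ × M) (s : ℝ) : SpacetimeTangent n (γ s).2 :=
  velocityWithin n γ univ s

/-- Smoothness, on a set of parameters, of a curve in `ℝ × M`. -/
def SmoothCurveOn (n : ℕ) {M : Type*} [TopologicalSpace M] [ChartedSpace (Model n) M]
    (γ : ℝ → ℝ × M) (S : Set ℝ) : Prop :=
  ContMDiffOn 𝓘(ℝ, ℝ) (𝓘(ℝ, ℝ).prod 𝓘(ℝ, Model n)) ∞ γ S

/-- `0 = a 0 < a 1 < ⋯ < a k = 1`. -/
def IsPartition (k : ℕ) (a : ℕ → ℝ) : Prop :=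
  a 0 = 0 ∧ a k = 1 ∧ ∀ j < k, a j < a (j + 1)

namespace SplitMetric

variable {n : ℕ} {M : Type*} [TopologicalSpace M] [ChartedSpace (Model n) M]
  [IsManifold 𝓘(ℝ, Model n) ∞ M] (g : SplitMetric n M)

/-- The value `g_q(v, w)` of the metric. -/
def form (q : ℝ × M) (v w : SpacetimeTangent n q.2) : ℝ :=
  -(g.β q * (v.1 * w.1)) + g.h q.1 q.2 v.2 w.2

/-- Future-directed timelike vectors; the time orientation is the one given by `∂_t`. -/
def FutureTimelike (q : ℝ × M) (v : SpacetimeTangent n q.2) : Prop :=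
  g.form q v v < 0 ∧ 0 < v.1

/-- Future-directed causal vectors (these are non-zero, since their `∂_t`-component is). -/
def FutureCausal (q : ℝ × M) (v : SpacetimeTangent n q.2) : Prop :=
  g.form q v v ≤ 0 ∧ 0 < v.1

/-- `α : [0,1] → N` is a piecewise smooth future-directed timelike path from `p` to `q`, smooth on
the pieces `[a j, a (j+1)]`. -/
def IsTimelikePath (p q : ℝ × M) (α : ℝ → ℝ × M) (k : ℕ) (a : ℕ → ℝ) : Prop :=
  IsPartition k a ∧ α 0 = p ∧ α 1 = q ∧
    ∀ j < k, SmoothCurveOn n α (Icc (a j) (a (j + 1))) ∧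
      ∀ s ∈ Icc (a j) (a (j + 1)),
        g.FutureTimelike (α s) (velocityWithin n α (Icc (a j) (a (j + 1))) s)

/-- `α : [0,1] → N` is a piecewise smooth future-directed causal path from `p` to `q`, smooth on
the pieces `[a j, a (j+1)]`. -/
def IsCausalPath (p q : ℝ × M) (α : ℝ → ℝ × M) (k : ℕ) (a : ℕ → ℝ) : Prop :=
  IsPartition k a ∧ α 0 = p ∧ α 1 = q ∧
    ∀ j < k, SmoothCurveOn n α (Icc (a j) (a (j + 1))) ∧
      ∀ s ∈ Icc (a j) (a (j + 1)),
        g.FutureCausal (α s) (velocityWithin n α (Icc (a j) (a (j + 1))) s)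

/-- The relation `p ≪ q`. -/
def Chron (p q : ℝ × M) : Prop :=
  p ≠ q ∧ ∃ α k a, g.IsTimelikePath p q α k a

/-- The relation `p ≤ q`. -/
def Causal (p q : ℝ × M) : Prop :=
  p = q ∨ ∃ α k a, g.IsCausalPath p q α k a

/-- The chronological future `I⁺(A)` of a set. -/
def IPlus (A : Set (ℝ × M)) : Set (ℝ × M) := {q | ∃ p ∈ A, g.Chron p q}

/-- The chronological past `I⁻(A)` of a set. -/
def IMinus (A : Set (ℝ × M)) : Set (ℝ × M) := {q | ∃ p ∈ A, g.Chron q p}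

/-- The causal future `J⁺(p)` of a point. -/
def JPlus (p : ℝ × M) : Set (ℝ × M) := {q | g.Causal p q}

/-- The causal past `J⁻(p)` of a point. -/
def JMinus (p : ℝ × M) : Set (ℝ × M) := {q | g.Causal q p}

/-- The length `∑ⱼ ∫ √(-g(α', α'))` of a path which is smooth on the pieces `[a j, a (j+1)]`. -/
def length (α : ℝ → ℝ × M) (k : ℕ) (a : ℕ → ℝ) : ℝ :=
  ∑ j ∈ Finset.range k, ∫ s in (a j)..(a (j + 1)),
    Real.sqrt (-(g.form (α s) (velocityWithin n α (Icc (a j) (a (j + 1))) s)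
      (velocityWithin n α (Icc (a j) (a (j + 1))) s)))

/-- The time separation `τ(p, q)`: the supremum of the lengths of all piecewise smooth
future-directed causal paths from `p` to `q`, and `0` if there is no such path. -/
def timeSep (p q : ℝ × M) : ℝ≥0∞ :=
  ⨆ (α : ℝ → ℝ × M) (k : ℕ) (a : ℕ → ℝ) (_ : g.IsCausalPath p q α k a),
    ENNReal.ofReal (g.length α k a)

/-- Strong causality: every neighbourhood `U` of a point contains a neighbourhood `V` of that point
such that causal paths with end points in `V` stay in `U`. -/
def StronglyCausal : Prop :=
  ∀ p : ℝ × M, ∀ U ∈ 𝓝 p, ∃ V ∈ 𝓝 p, V ⊆ U ∧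
    ∀ q ∈ V, ∀ r ∈ V, ∀ α k a, g.IsCausalPath q r α k a → ∀ s ∈ Icc (0 : ℝ) 1, α s ∈ U

/-- Global hyperbolicity: strong causality, and compactness of all `J⁺(p) ∩ J⁻(q)`. -/
def GloballyHyperbolic : Prop :=
  g.StronglyCausal ∧ ∀ p q : ℝ × M, IsCompact (g.JPlus p ∩ g.JMinus q)

/-- The metric in the coordinates `(t, y) ∈ ℝ × ℝⁿ` given by the preferred chart of `M` at `p₀`. -/
def coordForm (p₀ : M) (x : ℝ × Model n) (v w : ℝ × Model n) : ℝ :=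
  let ψ : Model n → M := (extChartAt 𝓘(ℝ, Model n) p₀).symm
  let dψ := mfderiv 𝓘(ℝ, Model n) 𝓘(ℝ, Model n) ψ x.2
  g.form (x.1, ψ x.2) (v.1, dψ v.2) (w.1, dψ w.2)

/-- The curve `γ` in the coordinates `(t, y) ∈ ℝ × ℝⁿ` given by the preferred chart of `M`
at `p₀`. -/
def coordCurve (n : ℕ) {M : Type*} [TopologicalSpace M] [ChartedSpace (Model n) M]
    (p₀ : M) (γ : ℝ → ℝ × M) (s : ℝ) : ℝ × Model n :=
  ((γ s).1, extChartAt 𝓘(ℝ, Model n) p₀ (γ s).2)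

/-- The geodesic equation `∇_{γ'} γ' = 0` at the parameter `s`, in the chart around `γ s`. With the
index lowered it reads `g_{al} c''^a + Γ_{l,ab} c'^a c'^b = 0` for all `l`, where
`Γ_{l,ab} = ½ (∂_a g_{lb} + ∂_b g_{al} - ∂_l g_{ab})` are the Christoffel symbols of the Levi-Civita
connection; below this covector is evaluated at an arbitrary vector `w`. -/
def GeodesicEqAt (γ : ℝ → ℝ × M) (s : ℝ) : Prop :=
  let G := g.coordForm (γ s).2
  let c := coordCurve n (γ s).2 γ
  ∀ w : ℝ × Model n,
    G (c s) (deriv (deriv c) s) w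
      + fderiv ℝ (fun x => G x (deriv c s) w) (c s) (deriv c s)
      - 1 / 2 * fderiv ℝ (fun x => G x (deriv c s) (deriv c s)) (c s) w = 0

/-- `γ` restricted to the open interval `D` is a geodesic. -/
def IsGeodesicOn (γ : ℝ → ℝ × M) (D : Set ℝ) : Prop :=
  IsOpen D ∧ D.OrdConnected ∧ SmoothCurveOn n γ D ∧ ∀ s ∈ D, g.GeodesicEqAt γ s

/-- `γ` restricted to the open interval `D` is a geodesic that cannot be extended. -/
def IsMaximalGeodesicOn (γ : ℝ → ℝ × M) (D : Set ℝ) : Prop :=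
  g.IsGeodesicOn γ D ∧
    ∀ (γ' : ℝ → ℝ × M) (D' : Set ℝ), g.IsGeodesicOn γ' D' → D ⊆ D' → EqOn γ' γ D → D' = D

/-- `γ`, with maximal domain `D ⊇ [0,1]`, is a future-directed lightlike geodesic which is optimal
from `A` to `x` and stays in `K` on `[0,1]`. -/
def IsFutureOptimalGeodesic (A K : Set (ℝ × M)) (x : ℝ × M) (γ : ℝ → ℝ × M) (D : Set ℝ) : Prop :=
  g.IsMaximalGeodesicOn γ D ∧ Icc (0 : ℝ) 1 ⊆ D ∧
    (∀ s ∈ Icc (0 : ℝ) 1, γ s ∈ K ∧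
      g.form (γ s) (velocity n γ s) (velocity n γ s) = 0 ∧ 0 < (velocity n γ s).1) ∧
    ∃ z ∈ g.JMinus x ∩ A, γ 0 = z ∧ γ 1 = x ∧ g.timeSep z x = 0

/-- `γ`, with maximal domain `D ⊇ [0,1]`, is a past-directed lightlike geodesic which is optimal
from `A` to `x` and stays in `K` on `[0,1]`. -/
def IsPastOptimalGeodesic (A K : Set (ℝ × M)) (x : ℝ × M) (γ : ℝ → ℝ × M) (D : Set ℝ) : Prop :=
  g.IsMaximalGeodesicOn γ D ∧ Icc (0 : ℝ) 1 ⊆ D ∧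
    (∀ s ∈ Icc (0 : ℝ) 1, γ s ∈ K ∧
      g.form (γ s) (velocity n γ s) (velocity n γ s) = 0 ∧ (velocity n γ s).1 < 0) ∧
    ∃ z ∈ g.JPlus x ∩ A, γ 0 = z ∧ γ 1 = x ∧ g.timeSep x z = 0

end SplitMetric

/-- `Ω ⊆ M` is a compact smooth submanifold with boundary, of the same dimension as `M`: around
each of its points that is not interior there is a smooth chart of `M` in which `Ω` is a half-space
`{yᵢ ≥ 0}`. Its manifold boundary is then its topological frontier. -/
def IsCompactDomain (n : ℕ) {M : Type*} [TopologicalSpace M] [ChartedSpace (Model n) M]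
    (Ω : Set M) : Prop :=
  IsCompact Ω ∧ ∀ p ∈ frontier Ω, ∃ φ ∈ IsManifold.maximalAtlas 𝓘(ℝ, Model n) ∞ M,
    p ∈ φ.source ∧ ∃ i : Fin n, ∀ q ∈ φ.source, q ∈ Ω ↔ 0 ≤ (φ q) i

/-- The lateral boundary `Σ = [0,T] × ∂Ω`. -/
def lateralBoundary {M : Type*} [TopologicalSpace M] (T : ℝ) (Ω : Set M) : Set (ℝ × M) := Icc 0 T ×ˢ frontier Ω

/-- The tangent space at `p` of a submanifold `S` of `M` (without boundary): the span of the
velocities at `0` of the smooth curves through `p` lying in `S`. -/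
def submanifoldTangent (n : ℕ) {M : Type*} [TopologicalSpace M] [ChartedSpace (Model n) M]
    (S : Set M) (p : M) : Submodule ℝ (TangentSpace 𝓘(ℝ, Model n) p) :=
  Submodule.span ℝ {v | ∃ (c : ℝ → M) (ε : ℝ), c 0 = p ∧ 0 < ε ∧
    ContMDiffOn 𝓘(ℝ, ℝ) 𝓘(ℝ, Model n) ∞ c (Ioo (-ε) ε) ∧ (∀ r ∈ Ioo (-ε) ε, c r ∈ S) ∧
    v = (mfderiv 𝓘(ℝ, ℝ) 𝓘(ℝ, Model n) c 0 (1 : ℝ) : Model n)}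

/-- The tangent space `ℝ ∂_t ⊕ T_p ∂Ω` of the lateral boundary at a point over `p`. -/
def lateralTangent (n : ℕ) {M : Type*} [TopologicalSpace M] [ChartedSpace (Model n) M]
    (Ω : Set M) (p : M) : Submodule ℝ (SpacetimeTangent n p) :=
  Submodule.prod ⊤ (submanifoldTangent n (frontier Ω) p)

/-- The first intersection of `γ : [0,1] → N` with the lateral boundary exists and is transverse:
at the smallest `s₀ ∈ [0,1]` with `γ s₀ ∈ Σ`, the line spanned by `γ' s₀` and the tangent space
of `Σ` together span the tangent space of `N`. -/
def FirstIntersectionTransverse (n : ℕ) {M : Type*} [TopologicalSpace M]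
    [ChartedSpace (Model n) M] (T : ℝ) (Ω : Set M) (γ : ℝ → ℝ × M) : Prop :=
  ∃ s₀ : ℝ, IsLeast {s ∈ Icc (0 : ℝ) 1 | γ s ∈ lateralBoundary T Ω} s₀ ∧
    Submodule.span ℝ {velocity n γ s₀} ⊔ lateralTangent n Ω (γ s₀).2 = ⊤

end

/-! The geodesic is found by an extremal choice. Let `Σ = [0, T] × ∂Ω` and let `x` be in `I⁺(Σ)`.
Compactness of the causal diamonds makes `J⁻(x)` closed (`SplitMetric.isClosed_JMinus`), so the
compact set `Σ ∩ J⁻(x)` has a latest point `z`. If `z ≪ x` held, then `z` could be moved a little to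
the future along its time line, which stays in `Σ`, and would still precede `x`
(`SplitMetric.Chron.exists_shift_left`), contrary to its choice. So `z ≤ x`, but not `z ≪ x`. From
this everything else follows.

* Every causal path from `z` to `x` consists of lightlike pieces, so `τ(z, x) = 0`
  (`SplitMetric.timeSep_eq_zero`).
* `z` and `x` are joined by a lightlike geodesic (`SplitMetric.Causal.exists_null_geodesic`).
* The geodesic cannot leave `Ω`: to reach `x` it would have to meet `Σ` again, at a point of
  `J⁻(x)` later than `z`.
* It is transverse to `Σ` at `z`. If it were tangent, its points `γ s` would be so close to `∂Ω` that
  some boundary point precedes `γ s` by an amount of time small compared with `s`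
  (`SplitMetric.eventually_chron_of_tangent`). That point would belong to `J⁻(x)` and be later
  than `z`.

The case of `I⁻(Σ)` is the same with the earliest point of `Σ ∩ J⁺(x)`.

The causality theory behind this is derived without exponential maps or normal neighbourhoods, from
variations of curves. A causal curve becomes timelike under a small variation with negative first
variation of `½ g(γ', γ')` (`exists_variation_neg`). For a metric `-β dt² + h` the variations in the
direction `∂_t` are especially simple; with exponential weights they turn causal pieces into timelike
ones that end slightly later (`SplitMetric.Joined₁.chron_shift_pos`), and the push-up properties
`SplitMetric.Causal.trans_chron` and `SplitMetric.Chron.trans_causal` result. By push-up a causal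
piece between points that are not chronologically related is lightlike
(`SplitMetric.bil_eq_zero_of_not_chron`). It is also a pregeodesic: if the Euler–Lagrange covector
were not a multiple of `g(γ', ·)`, a variation with fixed end points and negative first variation
would exist (`exists_firstVariation_neg`, `SplitMetric.eulerLagrange_eq_of_not_chron`). A change of
parameter makes it a geodesic (`SplitMetric.exists_null_geodesic_of_isPiece`), and successive pieces
meet without a corner, since a corner could be cut by a short timelike segment
(`SplitMetric.not_timelike_corner`, `SplitMetric.exists_join`).

Geodesics are treated as solutions of the first-order system of the geodesic spray in charts. They
are first obtained on closed intervals (`SplitMetric.IsGeodesicWithin`) and then extended to maximal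
open intervals by Zorn's lemma (`SplitMetric.IsGeodesicOn.exists_maximal`). Tangent spaces of `M`
are definitionally the model space; the definitions `SplitMetric.bil`, `vel` and `chartInvDeriv`
unfold them, so that calculus in normed spaces applies. -/

noncomputable section

-- for instances on nested spaces of continuous linear maps
set_option maxSynthPendingDepth 3

/-! ### Charts of the spacetime and velocities -/

/-- The inverse of the preferred chart at `p₀`. -/
abbrev chartInv {n : ℕ} {M : Type*} [TopologicalSpace M] [ChartedSpace (Model n) M] (p₀ : M) :
    Model n → M := (extChartAt 𝓘(ℝ, Model n) p₀).symm

/-- The differential of the inverse of the preferred chart at `p₀`, with the tangent spaces of `M`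
unfolded to the model space. -/
def chartInvDeriv {n : ℕ} {M : Type*} [TopologicalSpace M] [ChartedSpace (Model n) M] (p₀ : M)
    (y : Model n) : Model n →L[ℝ] Model n :=
  mfderiv 𝓘(ℝ, Model n) 𝓘(ℝ, Model n) (chartInv (n := n) p₀) y

/-- The domain `ℝ × ψ(U)` of coordinates on `ℝ × M` belonging to the preferred chart `(U, ψ)` of
`M` at `p₀`. -/
def coordDomain (n : ℕ) {M : Type*} [TopologicalSpace M] [ChartedSpace (Model n) M] (p₀ : M) :
    Set (ℝ × Model n) := univ ×ˢ (extChartAt 𝓘(ℝ, Model n) p₀).target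

theorem isOpen_coordDomain {n : ℕ} {M : Type*} [TopologicalSpace M] [ChartedSpace (Model n) M]
    (p₀ : M) : IsOpen (coordDomain n p₀) :=
  isOpen_univ.prod (isOpen_extChartAt_target p₀)

namespace SplitMetric
variable {n : ℕ} {M : Type*} [TopologicalSpace M] [ChartedSpace (Model n) M]
  [IsManifold 𝓘(ℝ, Model n) ∞ M] (g : SplitMetric n M)

/-- The metric at `q`, with the tangent space of `ℝ × M` unfolded to `ℝ × ℝⁿ`. -/
def bil (q : ℝ × M) (v w : ℝ × Model n) : ℝ := g.form q v w

/-- The Riemannian metric `h` at `q`, with the tangent space of `M` unfolded to `ℝⁿ`. -/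
def spatial (q : ℝ × M) : Model n →L[ℝ] Model n →L[ℝ] ℝ := g.h q.1 q.2

theorem bil_def (q : ℝ × M) (v w : ℝ × Model n) :
    g.bil q v w = -(g.β q * (v.1 * w.1)) + g.spatial q v.2 w.2 := rfl

theorem coordForm_eq (p₀ : M) (x v w : ℝ × Model n) :
    g.coordForm p₀ x v w = g.bil (x.1, chartInv p₀ x.2)
      (v.1, chartInvDeriv p₀ x.2 v.2) (w.1, chartInvDeriv p₀ x.2 w.2) := rfl

theorem spatial_symm (q : ℝ × M) (v w : Model n) : g.spatial q v w = g.spatial q w v :=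
  g.h_symm q.1 q.2 v w

theorem spatial_pos (q : ℝ × M) {v : Model n} (hv : v ≠ 0) : 0 < g.spatial q v v :=
  g.h_pos q.1 q.2 v hv

/-- The metric in the preferred chart at `p₀` as a bilinear map. -/
def chartMetric (p₀ : M) (x : ℝ × Model n) : (ℝ × Model n) →L[ℝ] (ℝ × Model n) →L[ℝ] ℝ :=
  LinearMap.toContinuousBilinearMap (LinearMap.mk₂ ℝ (g.coordForm p₀ x)
    (by intro v v' w; simp only [coordForm_eq, bil_def, Prod.fst_add, Prod.snd_add, map_add,
          add_apply]; ring)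
    (by intro a v w; simp only [coordForm_eq, bil_def, Prod.smul_fst, Prod.smul_snd, map_smul,
          smul_apply, smul_eq_mul]; ring)
    (by intro v v' w; simp only [coordForm_eq, bil_def, Prod.fst_add, Prod.snd_add, map_add]; ring)
    (by intro a v w; simp only [coordForm_eq, bil_def, Prod.smul_fst, Prod.smul_snd, map_smul,
          smul_eq_mul]; ring))

theorem chartMetric_apply (p₀ : M) (x v w : ℝ × Model n) :
    g.chartMetric p₀ x v w = g.coordForm p₀ x v w := rfl

theorem chartMetric_symm (p₀ : M) (x v w : ℝ × Model n) :
    g.chartMetric p₀ x v w = g.chartMetric p₀ x w v := by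
  simp only [chartMetric_apply, coordForm_eq, bil_def, g.spatial_symm _ (chartInvDeriv p₀ x.2 v.2)]
  ring

theorem contMDiffOn_coordInv (p₀ : M) :
    ContMDiffOn 𝓘(ℝ, ℝ × Model n) (𝓘(ℝ, ℝ).prod 𝓘(ℝ, Model n)) ∞
      (fun x : ℝ × Model n => (x.1, chartInv p₀ x.2)) (coordDomain n p₀) := by
  refine (contDiff_fst.contMDiff.contMDiffOn).prodMk ?_
  exact (contMDiffOn_extChartAt_symm p₀).comp contDiff_snd.contMDiff.contMDiffOn
    (fun x hx => hx.2)

/-- The coordinate vector fields of the chart at `p₀`, as sections of the tangent bundle, are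
smooth; pairing them with `h` gives smooth coefficients of the metric. -/
theorem contMDiffOn_chartInvDeriv_section (p₀ : M) (v : Model n) :
    ContMDiffOn 𝓘(ℝ, ℝ × Model n) (𝓘(ℝ, Model n).prod 𝓘(ℝ, Model n)) ∞
      (fun x : ℝ × Model n => Bundle.TotalSpace.mk' (Model n)
        (E := fun p : M => TangentSpace 𝓘(ℝ, Model n) p)
        (chartInv p₀ x.2) (chartInvDeriv p₀ x.2 v)) (coordDomain n p₀) := by
  have hopen := isOpen_extChartAt_target (I := 𝓘(ℝ, Model n)) p₀
  have h1 := (contMDiffOn_extChartAt_symm (I := 𝓘(ℝ, Model n)) (n := ∞)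
    p₀).contMDiffOn_tangentMapWithin (m := ∞) (by simp) hopen.uniqueMDiffOn
  have h2 : ContMDiffOn 𝓘(ℝ, ℝ × Model n) (𝓘(ℝ, Model n).prod 𝓘(ℝ, Model n)) ∞
      (fun x : ℝ × Model n => Bundle.TotalSpace.mk' (Model n)
        (E := fun p : Model n => TangentSpace 𝓘(ℝ, Model n) p) x.2 v) (coordDomain n p₀) := by
    intro x hx
    rw [Bundle.contMDiffWithinAt_totalSpace]
    refine ⟨contDiff_snd.contMDiff.contMDiffOn x hx, ?_⟩
    simpa using contMDiffWithinAt_const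
  refine (h1.comp h2 ?_).congr ?_
  · intro x hx; exact hx.2
  · intro x hx
    simp only [Function.comp, tangentMapWithin]
    rw [mfderivWithin_of_isOpen hopen hx.2]
    rfl

theorem coordForm_contDiffOn (p₀ : M) (v w : ℝ × Model n) :
    ContDiffOn ℝ ∞ (fun x => g.coordForm p₀ x v w) (coordDomain n p₀) := by
  have hq := contMDiffOn_coordInv (n := n) p₀
  have hβ := g.β_smooth.comp_contMDiffOn hq
  have hh := g.h_smooth.comp_contMDiffOn hq
  have key := ContMDiffOn.clm_bundle_apply₂ (E₃ := fun _ => ℝ) (F₃ := ℝ) hh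
    (contMDiffOn_chartInvDeriv_section p₀ v.2)
    (contMDiffOn_chartInvDeriv_section p₀ w.2)
  have key' : ContMDiffOn 𝓘(ℝ, ℝ × Model n) 𝓘(ℝ, ℝ) ∞ (fun x : ℝ × Model n =>
      g.spatial (x.1, chartInv p₀ x.2) (chartInvDeriv p₀ x.2 v.2) (chartInvDeriv p₀ x.2 w.2))
      (coordDomain n p₀) := by
    intro x hx
    have := key x hx
    simp only [Bundle.contMDiffWithinAt_totalSpace] at this
    exact this.2
  rw [contMDiffOn_iff_contDiffOn] at hβ key'
  exact (hβ.mul (contDiffOn_const (c := v.1 * w.1))).neg.add key'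

theorem contDiffOn_chartMetric (p₀ : M) :
    ContDiffOn ℝ ∞ (g.chartMetric p₀) (coordDomain n p₀) := by
  rw [contDiffOn_clm_apply]
  intro v
  rw [contDiffOn_clm_apply]
  intro w
  exact g.coordForm_contDiffOn p₀ v w

theorem bil_eq_chartMetric (p₀ : M) {q : ℝ × M} (hq : q.2 ∈ (extChartAt 𝓘(ℝ, Model n) p₀).source)
    (v w : ℝ × Model n) :
    g.bil q (v.1, chartInvDeriv p₀ (extChartAt 𝓘(ℝ, Model n) p₀ q.2) v.2)
      (w.1, chartInvDeriv p₀ (extChartAt 𝓘(ℝ, Model n) p₀ q.2) w.2) =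
    g.chartMetric p₀ (q.1, extChartAt 𝓘(ℝ, Model n) p₀ q.2) v w := by
  rw [chartMetric_apply, coordForm_eq]
  simp only [chartInv, (extChartAt 𝓘(ℝ, Model n) p₀).left_inv hq]

end SplitMetric

section Curves
variable {n : ℕ} {M : Type*} [TopologicalSpace M] [ChartedSpace (Model n) M]

open SplitMetric (coordCurve)

/-- The point of `ℝ × M` with given coordinates in the preferred chart at `p₀`. -/
def coordInv (p₀ : M) (x : ℝ × Model n) : ℝ × M := (x.1, chartInv p₀ x.2)

theorem coordCurve_mem {p₀ : M} {γ : ℝ → ℝ × M} {s : ℝ}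
    (h : (γ s).2 ∈ (extChartAt 𝓘(ℝ, Model n) p₀).source) :
    coordCurve n p₀ γ s ∈ coordDomain n p₀ :=
  ⟨mem_univ _, (extChartAt 𝓘(ℝ, Model n) p₀).map_source h⟩

theorem coordInv_coordCurve {p₀ : M} {γ : ℝ → ℝ × M} {s : ℝ}
    (h : (γ s).2 ∈ (extChartAt 𝓘(ℝ, Model n) p₀).source) :
    coordInv p₀ (coordCurve n p₀ γ s) = γ s := by
  simp only [coordInv, coordCurve, chartInv, (extChartAt 𝓘(ℝ, Model n) p₀).left_inv h]

theorem coordInv_source {p₀ : M} {x : ℝ × Model n} (hx : x ∈ coordDomain n p₀) :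
    (coordInv p₀ x).2 ∈ (extChartAt 𝓘(ℝ, Model n) p₀).source :=
  (extChartAt 𝓘(ℝ, Model n) p₀).map_target hx.2

theorem coordCurve_coordInv {p₀ : M} {c : ℝ → ℝ × Model n} {s : ℝ}
    (hx : c s ∈ coordDomain n p₀) :
    coordCurve n p₀ (fun r => coordInv p₀ (c r)) s = c s := by
  simp only [coordInv, coordCurve, chartInv, (extChartAt 𝓘(ℝ, Model n) p₀).right_inv hx.2]

theorem SmoothCurveOn.mono {γ : ℝ → ℝ × M} {S S' : Set ℝ} (h : SmoothCurveOn n γ S)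
    (hS : S' ⊆ S) : SmoothCurveOn n γ S' := ContMDiffOn.mono h hS

theorem SmoothCurveOn.congr {γ γ' : ℝ → ℝ × M} {S : Set ℝ} (h : SmoothCurveOn n γ S)
    (hS : EqOn γ' γ S) : SmoothCurveOn n γ' S := ContMDiffOn.congr h hS

theorem SmoothCurveOn.continuousOn {γ : ℝ → ℝ × M} {S : Set ℝ} (h : SmoothCurveOn n γ S) :
    ContinuousOn γ S := ContMDiffOn.continuousOn h

theorem SmoothCurveOn.fst {γ : ℝ → ℝ × M} {S : Set ℝ} (h : SmoothCurveOn n γ S) :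
    ContDiffOn ℝ ∞ (fun s => (γ s).1) S := by
  rw [← contMDiffOn_iff_contDiffOn]
  exact ContMDiff.comp_contMDiffOn contMDiff_fst h

theorem SmoothCurveOn.snd {γ : ℝ → ℝ × M} {S : Set ℝ} (h : SmoothCurveOn n γ S) :
    ContMDiffOn 𝓘(ℝ, ℝ) 𝓘(ℝ, Model n) ∞ (fun s => (γ s).2) S :=
  ContMDiff.comp_contMDiffOn contMDiff_snd h

variable [IsManifold 𝓘(ℝ, Model n) ∞ M]

theorem SmoothCurveOn.contDiffWithinAt_coordCurve {p₀ : M} {γ : ℝ → ℝ × M} {S : Set ℝ} {s : ℝ}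
    (h : SmoothCurveOn n γ S) (hs : s ∈ S)
    (hsrc : (γ s).2 ∈ (extChartAt 𝓘(ℝ, Model n) p₀).source) :
    ContDiffWithinAt ℝ ∞ (coordCurve n p₀ γ) S s := by
  refine (h.fst s hs).prodMk ?_
  rw [← contMDiffWithinAt_iff_contDiffWithinAt]
  have h1 : ContMDiffAt 𝓘(ℝ, Model n) 𝓘(ℝ, Model n) ∞ (extChartAt 𝓘(ℝ, Model n) p₀) (γ s).2 :=
    contMDiffAt_extChartAt' (by simpa using hsrc)
  exact h1.comp_contMDiffWithinAt s (h.snd s hs)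

theorem SmoothCurveOn.contDiffOn_coordCurve {p₀ : M} {γ : ℝ → ℝ × M} {S : Set ℝ}
    (h : SmoothCurveOn n γ S) (hS : ∀ s ∈ S, (γ s).2 ∈ (extChartAt 𝓘(ℝ, Model n) p₀).source) :
    ContDiffOn ℝ ∞ (coordCurve n p₀ γ) S :=
  fun s hs => h.contDiffWithinAt_coordCurve hs (hS s hs)

theorem SmoothCurveOn.hasDerivWithinAt_coordCurve {p₀ : M} {γ : ℝ → ℝ × M} {S : Set ℝ} {s : ℝ}
    (h : SmoothCurveOn n γ S) (hs : s ∈ S)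
    (hsrc : (γ s).2 ∈ (extChartAt 𝓘(ℝ, Model n) p₀).source) :
    HasDerivWithinAt (coordCurve n p₀ γ) (derivWithin (coordCurve n p₀ γ) S s) S s :=
  ((h.contDiffWithinAt_coordCurve hs hsrc).differentiableWithinAt (by simp)).hasDerivWithinAt

theorem smoothCurveOn_coordInv {p₀ : M} {c : ℝ → ℝ × Model n} {S : Set ℝ}
    (h : ContDiffOn ℝ ∞ c S) (hS : ∀ s ∈ S, c s ∈ coordDomain n p₀) :
    SmoothCurveOn n (fun s => coordInv p₀ (c s)) S :=
  (SplitMetric.contMDiffOn_coordInv p₀).comp h.contMDiffOn hS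

theorem smoothCurveOn_of_coordCurve {p₀ : M} {γ : ℝ → ℝ × M} {S : Set ℝ}
    (h : ContDiffOn ℝ ∞ (coordCurve n p₀ γ) S)
    (hS : ∀ s ∈ S, (γ s).2 ∈ (extChartAt 𝓘(ℝ, Model n) p₀).source) : SmoothCurveOn n γ S :=
  (smoothCurveOn_coordInv h fun s hs => coordCurve_mem (hS s hs)).congr
    fun s hs => (coordInv_coordCurve (hS s hs)).symm

/-- The velocity `velocityWithin`, with the tangent space of `ℝ × M` unfolded to `ℝ × ℝⁿ`. -/
def vel (n : ℕ) {M : Type*} [TopologicalSpace M] [ChartedSpace (Model n) M] (γ : ℝ → ℝ × M)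
    (S : Set ℝ) (s : ℝ) : ℝ × Model n := velocityWithin n γ S s

/-- The velocity of a curve in terms of the velocity `v` of its coordinate representation. -/
theorem vel_eq {p₀ : M} {γ : ℝ → ℝ × M} {S : Set ℝ} {s : ℝ} {v : ℝ × Model n}
    (hu : UniqueDiffWithinAt ℝ S s) (hc : ContinuousWithinAt γ S s)
    (hsrc : (γ s).2 ∈ (extChartAt 𝓘(ℝ, Model n) p₀).source)
    (hd : HasDerivWithinAt (coordCurve n p₀ γ) v S s) :
    vel n γ S s =
      (v.1, chartInvDeriv p₀ (extChartAt 𝓘(ℝ, Model n) p₀ (γ s).2) v.2) := by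
  have h1 : HasDerivWithinAt (fun r => (γ r).1) v.1 S s :=
    (ContinuousLinearMap.fst ℝ ℝ (Model n)).hasFDerivAt.comp_hasDerivWithinAt s hd
  have h2 : HasDerivWithinAt (fun r => extChartAt 𝓘(ℝ, Model n) p₀ (γ r).2) v.2 S s :=
    (ContinuousLinearMap.snd ℝ ℝ (Model n)).hasFDerivAt.comp_hasDerivWithinAt s hd
  refine Prod.ext (h1.derivWithin hu) ?_
  have h3 := h2.hasFDerivWithinAt.hasMFDerivWithinAt
  have h4 : MDifferentiableAt 𝓘(ℝ, Model n) 𝓘(ℝ, Model n) (chartInv (n := n) p₀)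
      (extChartAt 𝓘(ℝ, Model n) p₀ (γ s).2) :=
    (((contMDiffOn_extChartAt_symm (I := 𝓘(ℝ, Model n)) (n := ∞) p₀).contMDiffAt
      ((isOpen_extChartAt_target p₀).mem_nhds
        ((extChartAt 𝓘(ℝ, Model n) p₀).map_source hsrc))).mdifferentiableAt (by simp))
  have h5 := h4.hasMFDerivAt.comp_hasMFDerivWithinAt s h3
  have h6 : HasMFDerivWithinAt 𝓘(ℝ, ℝ) 𝓘(ℝ, Model n) (fun r => (γ r).2) S s
      ((mfderiv 𝓘(ℝ, Model n) 𝓘(ℝ, Model n) (chartInv (n := n) p₀)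
        (extChartAt 𝓘(ℝ, Model n) p₀ (γ s).2)).comp
          (ContinuousLinearMap.toSpanSingleton ℝ v.2)) := by
    refine h5.congr_of_eventuallyEq ?_ ?_
    · have : ∀ᶠ r in 𝓝[S] s, (γ r).2 ∈ (extChartAt 𝓘(ℝ, Model n) p₀).source :=
        (continuous_snd.continuousAt.comp_continuousWithinAt hc).eventually
          ((isOpen_extChartAt_source p₀).mem_nhds hsrc)
      filter_upwards [this] with r hr
      exact ((extChartAt 𝓘(ℝ, Model n) p₀).left_inv hr).symm
    · exact ((extChartAt 𝓘(ℝ, Model n) p₀).left_inv hsrc).symm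
  have h7 := h6.mfderivWithin hu.uniqueMDiffWithinAt
  change mfderivWithin 𝓘(ℝ, ℝ) 𝓘(ℝ, Model n) (fun r => (γ r).2) S s (1 : ℝ) = _
  rw [h7]
  change chartInvDeriv p₀ _ (ContinuousLinearMap.toSpanSingleton ℝ v.2 (1 : ℝ)) = _
  rw [ContinuousLinearMap.toSpanSingleton_apply, one_smul]

theorem SplitMetric.bil_vel (g : SplitMetric n M) {p₀ : M} {γ : ℝ → ℝ × M} {S : Set ℝ}
    {s : ℝ} {v : ℝ × Model n}
    (hu : UniqueDiffWithinAt ℝ S s) (hc : ContinuousWithinAt γ S s)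
    (hsrc : (γ s).2 ∈ (extChartAt 𝓘(ℝ, Model n) p₀).source)
    (hd : HasDerivWithinAt (coordCurve n p₀ γ) v S s) :
    g.bil (γ s) (vel n γ S s) (vel n γ S s) =
      g.chartMetric p₀ (coordCurve n p₀ γ s) v v := by
  rw [vel_eq hu hc hsrc hd, g.bil_eq_chartMetric p₀ hsrc]
  rfl

end Curves

/-! ### Piecewise paths and the relations `≪` and `≤` -/

section Pieces
variable {n : ℕ} {M : Type*} [TopologicalSpace M] [ChartedSpace (Model n) M]

open SplitMetric (coordCurve)

/-- `α` is smooth on `[a, b]` and its velocities there lie in the cone field `C`. -/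
def IsPiece (C : ℝ × M → ℝ × Model n → Prop) (α : ℝ → ℝ × M) (a b : ℝ) : Prop :=
  SmoothCurveOn n α (Icc a b) ∧ ∀ s ∈ Icc a b, C (α s) (vel n α (Icc a b) s)

/-- `p` and `q` are joined by a single smooth piece with velocities in the cone field `C`. -/
def Joined₁ (C : ℝ × M → ℝ × Model n → Prop) (p q : ℝ × M) : Prop :=
  ∃ α a b, a < b ∧ α a = p ∧ α b = q ∧ IsPiece C α a b

/-- A piecewise smooth path with velocities in the cone field `C`. -/
def IsConePath (C : ℝ × M → ℝ × Model n → Prop) (p q : ℝ × M) (α : ℝ → ℝ × M) (k : ℕ)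
    (a : ℕ → ℝ) : Prop :=
  IsPartition k a ∧ α 0 = p ∧ α 1 = q ∧ ∀ j < k, IsPiece C α (a j) (a (j + 1))

theorem vel_congr {γ γ' : ℝ → ℝ × M} {S : Set ℝ} {s : ℝ} (h : EqOn γ γ' S)
    (hs : s ∈ S) : vel n γ S s = vel n γ' S s := by
  refine Prod.ext (derivWithin_congr (fun r hr => congrArg Prod.fst (h hr))
    (congrArg Prod.fst (h hs))) ?_
  have := mfderivWithin_congr (I := 𝓘(ℝ, ℝ)) (I' := 𝓘(ℝ, Model n))
    (f := fun r => (γ' r).2) (f₁ := fun r => (γ r).2) (s := S) (x := s)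
    (fun r hr => congrArg Prod.snd (h hr)) (congrArg Prod.snd (h hs))
  exact congrArg (fun L : ℝ →L[ℝ] Model n => L 1) this

theorem IsPiece.congr {C : ℝ × M → ℝ × Model n → Prop} {α α' : ℝ → ℝ × M} {a b : ℝ}
    (h : IsPiece C α a b) (hα : EqOn α' α (Icc a b)) : IsPiece C α' a b := by
  refine ⟨h.1.congr hα, fun s hs => ?_⟩
  have := h.2 s hs
  rw [← vel_congr hα hs] at this
  rwa [hα hs]

theorem IsPiece.imp {C C' : ℝ × M → ℝ × Model n → Prop} {α : ℝ → ℝ × M} {a b : ℝ}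
    (h : IsPiece C α a b) (hC : ∀ q v, C q v → C' q v) : IsPiece C' α a b :=
  ⟨h.1, fun s hs => hC _ _ (h.2 s hs)⟩

/-- Along a piece in a future-directed cone field the coordinate `t` increases strictly, so there
are no closed causal curves. -/
theorem IsPiece.strictMonoOn_fst {C : ℝ × M → ℝ × Model n → Prop} {α : ℝ → ℝ × M} {a b : ℝ}
    (hC : ∀ q v, C q v → 0 < v.1)
    (h : IsPiece C α a b) : StrictMonoOn (fun s => (α s).1) (Icc a b) := by
  refine strictMonoOn_of_hasDerivWithinAt_pos (convex_Icc a b) h.1.fst.continuousOn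
    (f' := fun s => (vel n α (Icc a b) s).1) (fun s hs => ?_) (fun s hs => ?_)
  · exact ((h.1.fst.differentiableOn (by simp)) s (interior_subset hs)).hasDerivWithinAt.mono
      interior_subset
  · exact hC _ _ (h.2 s (interior_subset hs))

theorem IsConePath.transGen {C : ℝ × M → ℝ × Model n → Prop} {p q : ℝ × M} {α : ℝ → ℝ × M} {k : ℕ}
    {a : ℕ → ℝ} (h : IsConePath C p q α k a) : Relation.TransGen (Joined₁ C) p q := by
  obtain ⟨⟨h0, h1, hlt⟩, rfl, rfl, hp⟩ := h
  have hstep : ∀ j < k, Joined₁ C (α (a j)) (α (a (j + 1))) := fun j hj =>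
    ⟨α, a j, a (j + 1), hlt j hj, rfl, rfl, hp j hj⟩
  have hind : ∀ j, j < k → Relation.TransGen (Joined₁ C) (α (a 0)) (α (a (j + 1))) := by
    intro j
    induction j with
    | zero => intro hj; exact .single (hstep 0 hj)
    | succ j ih => intro hj; exact (ih (by omega)).tail (hstep _ hj)
  rcases Nat.eq_zero_or_pos k with rfl | hk
  · rw [h0] at h1; norm_num at h1
  · have := hind (k - 1) (by omega)
    rwa [Nat.sub_add_cancel hk, h0, h1] at this

theorem Joined₁.lt_fst {C : ℝ × M → ℝ × Model n → Prop} (hC : ∀ q v, C q v → 0 < v.1)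
    {p q : ℝ × M} (h : Joined₁ C p q) : p.1 < q.1 := by
  obtain ⟨α, a, b, hab, rfl, rfl, h⟩ := h
  exact h.strictMonoOn_fst hC (left_mem_Icc.2 hab.le) (right_mem_Icc.2 hab.le) hab

theorem transGen_lt_fst {C : ℝ × M → ℝ × Model n → Prop} (hC : ∀ q v, C q v → 0 < v.1)
    {p q : ℝ × M} (h : Relation.TransGen (Joined₁ C) p q) : p.1 < q.1 := by
  induction h with
  | single h => exact Joined₁.lt_fst hC h
  | tail _ h ih => exact ih.trans (Joined₁.lt_fst hC h)

variable [IsManifold 𝓘(ℝ, Model n) ∞ M]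

theorem vel_comp_affine {γ : ℝ → ℝ × M} {S S' : Set ℝ} {s κ d : ℝ}
    (h : SmoothCurveOn n γ S) (hS : MapsTo (fun r => κ * r + d) S' S) (hs : s ∈ S')
    (hu : UniqueDiffWithinAt ℝ S (κ * s + d)) (hu' : UniqueDiffWithinAt ℝ S' s) :
    vel n (fun r => γ (κ * r + d)) S' s =
      κ • vel n γ S (κ * s + d) := by
  have hsrc := mem_extChartAt_source (I := 𝓘(ℝ, Model n)) (γ (κ * s + d)).2
  have hd := h.hasDerivWithinAt_coordCurve (hS hs) hsrc
  have hL : HasDerivWithinAt (fun r => κ * r + d) κ S' s := by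
    simpa using (((hasDerivAt_id s).const_mul κ).add_const d).hasDerivWithinAt
  have hd' : HasDerivWithinAt (coordCurve n (γ (κ * s + d)).2 (fun r => γ (κ * r + d)))
      (κ • derivWithin (coordCurve n (γ (κ * s + d)).2 γ) S (κ * s + d)) S' s :=
    HasDerivWithinAt.scomp (h := fun r => κ * r + d) s hd hL hS
  have hc : ContinuousWithinAt (fun r => γ (κ * r + d)) S' s :=
    ContinuousWithinAt.comp (h.continuousOn _ (hS hs)) hL.continuousWithinAt hS
  rw [vel_eq hu' hc hsrc hd', vel_eq hu (h.continuousOn _ (hS hs)) hsrc hd]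
  exact Prod.ext rfl (map_smul _ _ _)

theorem vel_mono {γ : ℝ → ℝ × M} {S S' : Set ℝ} {s : ℝ}
    (h : SmoothCurveOn n γ S) (hS : S' ⊆ S) (hs : s ∈ S')
    (hu : UniqueDiffWithinAt ℝ S' s) :
    vel n γ S' s = vel n γ S s := by
  have hsrc := mem_extChartAt_source (I := 𝓘(ℝ, Model n)) (γ s).2
  have hd := h.hasDerivWithinAt_coordCurve (hS hs) hsrc
  rw [vel_eq hu ((h.continuousOn _ (hS hs)).mono hS) hsrc (hd.mono hS),
    vel_eq (hu.mono hS) (h.continuousOn _ (hS hs)) hsrc hd]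

theorem IsPiece.mono {C : ℝ × M → ℝ × Model n → Prop} {α : ℝ → ℝ × M} {a b a' b' : ℝ}
    (h : IsPiece C α a b) (hab : a' < b') (hsub : Icc a' b' ⊆ Icc a b) : IsPiece C α a' b' := by
  refine ⟨h.1.mono hsub, fun s hs => ?_⟩
  rw [vel_mono h.1 hsub hs (uniqueDiffOn_Icc hab s hs)]
  exact h.2 s (hsub hs)

theorem IsPiece.comp_affine {C : ℝ × M → ℝ × Model n → Prop} {α : ℝ → ℝ × M} {a b κ d a' b' : ℝ}
    (hC : ∀ q v (κ : ℝ), 0 < κ → C q v → C q (κ • v))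
    (h : IsPiece C α a b) (hκ : 0 < κ) (hab : a' < b') (ha : κ * a' + d = a)
    (hb : κ * b' + d = b) : IsPiece C (fun s => α (κ * s + d)) a' b' := by
  have hm : MapsTo (fun r => κ * r + d) (Icc a' b') (Icc a b) := by
    intro r hr
    constructor
    · rw [← ha]; nlinarith [hr.1]
    · rw [← hb]; nlinarith [hr.2]
  have hab' : a < b := by rw [← ha, ← hb]; nlinarith
  refine ⟨?_, fun s hs => ?_⟩
  · have hL : ContMDiffOn 𝓘(ℝ, ℝ) 𝓘(ℝ, ℝ) ∞ (fun r : ℝ => κ * r + d) (Icc a' b') := by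
      rw [contMDiffOn_iff_contDiffOn]; fun_prop
    exact ContMDiffOn.comp h.1 hL hm
  · rw [vel_comp_affine h.1 hm hs (uniqueDiffOn_Icc hab' _ (hm hs))
      (uniqueDiffOn_Icc hab s hs)]
    exact hC _ _ _ hκ (h.2 _ (hm hs))

theorem Joined₁.exists_isPiece {C : ℝ × M → ℝ × Model n → Prop} {p q : ℝ × M}
    (hC : ∀ q v (κ : ℝ), 0 < κ → C q v → C q (κ • v)) (h : Joined₁ C p q) {a' b' : ℝ}
    (hab' : a' < b') : ∃ α, α a' = p ∧ α b' = q ∧ IsPiece C α a' b' := by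
  obtain ⟨α, a, b, hab, rfl, rfl, h⟩ := h
  have h0 : b' - a' ≠ 0 := by linarith
  have ha : (b - a) / (b' - a') * a' + (a - (b - a) / (b' - a') * a') = a := by ring
  have hb : (b - a) / (b' - a') * b' + (a - (b - a) / (b' - a') * a') = b := by
    field_simp; ring
  exact ⟨fun s => α ((b - a) / (b' - a') * s + (a - (b - a) / (b' - a') * a')),
    by simp only [ha], by simp only [hb],
    h.comp_affine hC (div_pos (by linarith) (by linarith)) hab' ha hb⟩

/-- Successive pieces, each in its own parameter, are concatenated to a path on `[0, 1]`; this
needs the cone field to be invariant under positive scaling. -/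
theorem exists_isConePath_of_transGen {C : ℝ × M → ℝ × Model n → Prop} {p q : ℝ × M}
    (hC : ∀ q v (κ : ℝ), 0 < κ → C q v → C q (κ • v))
    (h : Relation.TransGen (Joined₁ C) p q) : ∃ α k a, IsConePath C p q α k a := by
  induction h with
  | single h =>
    obtain ⟨α, h0, h1, h⟩ := h.exists_isPiece hC (zero_lt_one)
    refine ⟨α, 1, fun j => j, ⟨by simp, by simp, by simp⟩, h0, h1, fun j hj => ?_⟩
    obtain rfl : j = 0 := by omega
    simpa using h
  | @tail q r _ hqr ih =>
    obtain ⟨α, k, a, ⟨ha0, ha1, hlt⟩, h0, h1, hp⟩ := ih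
    obtain ⟨σ, hσ0, hσ1, hσ⟩ := hqr.exists_isPiece hC (show (1 / 2 : ℝ) < 1 by norm_num)
    have hmono : ∀ j ≤ k, a j ≤ 1 := by
      intro j hj
      rw [← ha1]
      induction hj using Nat.decreasingInduction with
      | self => exact le_rfl
      | of_succ j hj ih => exact (hlt j hj).le.trans ih
    refine ⟨fun s => if s ≤ 1 / 2 then α (2 * s + 0) else σ s, k + 1,
      fun j => if j ≤ k then a j / 2 else 1, ⟨by simp [ha0], by simp, fun j hj => ?_⟩,
      by simp [h0], by norm_num [hσ1], fun j hj => ?_⟩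
    · rcases Nat.lt_succ_iff_lt_or_eq.1 hj with hj | rfl
      · simp only [hj.le, Nat.succ_le_of_lt hj, if_true]
        linarith [hlt j hj]
      · simp only [le_refl, if_true, ha1]; norm_num
    · rcases Nat.lt_succ_iff_lt_or_eq.1 hj with hj | rfl
      · simp only [hj.le, Nat.succ_le_of_lt hj, if_true]
        refine ((hp j hj).comp_affine (κ := 2) (d := 0) hC two_pos (by linarith [hlt j hj])
          (by ring) (by ring)).congr fun s hs => ?_
        have : s ≤ 1 / 2 := hs.2.trans (by linarith [hmono (j + 1) hj])
        simp only [this, if_true]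
      · simp only [le_refl, if_true, ha1, show ¬ (j + 1 ≤ j) by omega, if_false]
        refine hσ.congr fun s hs => ?_
        rcases eq_or_lt_of_le hs.1 with rfl | hs'
        · rw [if_pos le_rfl, hσ0]; norm_num [h1]
        · simp only [not_le.2 hs', if_false]

end Pieces

namespace SplitMetric
variable {n : ℕ} {M : Type*} [TopologicalSpace M] [ChartedSpace (Model n) M]
  [IsManifold 𝓘(ℝ, Model n) ∞ M] (g : SplitMetric n M)

/-- The cone field of future-directed timelike vectors. -/
def timelikeCone (q : ℝ × M) (v : ℝ × Model n) : Prop := g.FutureTimelike q v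

/-- The cone field of future-directed causal vectors. -/
def causalCone (q : ℝ × M) (v : ℝ × Model n) : Prop := g.FutureCausal q v

theorem timelikeCone_iff {q : ℝ × M} {v : ℝ × Model n} :
    g.timelikeCone q v ↔ g.bil q v v < 0 ∧ 0 < v.1 := Iff.rfl

theorem causalCone_iff {q : ℝ × M} {v : ℝ × Model n} :
    g.causalCone q v ↔ g.bil q v v ≤ 0 ∧ 0 < v.1 := Iff.rfl

theorem bil_smul_smul (q : ℝ × M) (κ : ℝ) (v : ℝ × Model n) :
    g.bil q (κ • v) (κ • v) = κ ^ 2 * g.bil q v v := by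
  simp only [bil_def, Prod.smul_fst, Prod.smul_snd, map_smul, smul_apply, smul_eq_mul]; ring

theorem timelikeCone_smul (q : ℝ × M) (v : ℝ × Model n) (κ : ℝ) (hκ : 0 < κ)
    (h : g.timelikeCone q v) : g.timelikeCone q (κ • v) := by
  rw [timelikeCone_iff] at *
  rw [bil_smul_smul]
  exact ⟨mul_neg_of_pos_of_neg (by positivity) h.1, mul_pos hκ h.2⟩

theorem causalCone_smul (q : ℝ × M) (v : ℝ × Model n) (κ : ℝ) (hκ : 0 < κ)
    (h : g.causalCone q v) : g.causalCone q (κ • v) := by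
  rw [causalCone_iff] at *
  rw [bil_smul_smul]
  exact ⟨mul_nonpos_of_nonneg_of_nonpos (by positivity) h.1, mul_pos hκ h.2⟩

/-- The relation `≪` is generated by single timelike pieces. -/
theorem chron_iff {p q : ℝ × M} : g.Chron p q ↔ Relation.TransGen (Joined₁ g.timelikeCone) p q := by
  constructor
  · rintro ⟨-, α, k, a, h⟩
    exact IsConePath.transGen (C := g.timelikeCone) h
  · intro h
    refine ⟨fun hpq => ?_, exists_isConePath_of_transGen g.timelikeCone_smul h⟩
    exact (transGen_lt_fst (fun _ _ h => h.2) h).ne (congrArg Prod.fst hpq)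

/-- The relation `≤` is generated by single causal pieces. -/
theorem causal_iff {p q : ℝ × M} :
    g.Causal p q ↔ Relation.ReflTransGen (Joined₁ g.causalCone) p q := by
  rw [Relation.reflTransGen_iff_eq_or_transGen, eq_comm]
  refine or_congr Iff.rfl ⟨?_, fun h => exists_isConePath_of_transGen g.causalCone_smul h⟩
  rintro ⟨α, k, a, h⟩
  exact IsConePath.transGen (C := g.causalCone) h

theorem Chron.trans {g : SplitMetric n M} {p q r : ℝ × M} (h : g.Chron p q) (h' : g.Chron q r) :
    g.Chron p r := by
  rw [chron_iff] at *; exact h.trans h'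

theorem Causal.trans {g : SplitMetric n M} {p q r : ℝ × M} (h : g.Causal p q) (h' : g.Causal q r) :
    g.Causal p r := by
  rw [causal_iff] at *; exact h.trans h'

theorem Chron.causal {g : SplitMetric n M} {p q : ℝ × M} (h : g.Chron p q) : g.Causal p q := by
  rw [chron_iff] at h
  rw [causal_iff]
  exact (Relation.TransGen.mono (fun p q ⟨α, a, b, hab, ha, hb, h⟩ => ⟨α, a, b, hab, ha, hb,
    h.imp fun q v hv => ⟨hv.1.le, hv.2⟩⟩) _ _ h).to_reflTransGen

theorem Causal.fst_lt {g : SplitMetric n M} {p q : ℝ × M} (h : g.Causal p q) (hne : p ≠ q) :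
    p.1 < q.1 := by
  rw [causal_iff, Relation.reflTransGen_iff_eq_or_transGen] at h
  rcases h with h | h
  · exact absurd h.symm hne
  · exact transGen_lt_fst (fun _ _ h => h.2) h

theorem chron_of_isPiece {α : ℝ → ℝ × M} {a b : ℝ} (hab : a < b)
    (h : IsPiece g.timelikeCone α a b) : g.Chron (α a) (α b) :=
  g.chron_iff.2 (.single ⟨α, a, b, hab, rfl, rfl, h⟩)

theorem causal_of_isPiece {α : ℝ → ℝ × M} {a b : ℝ} (hab : a ≤ b)
    (h : IsPiece g.causalCone α a b) : g.Causal (α a) (α b) := by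
  rcases hab.eq_or_lt with rfl | hab
  · exact .inl rfl
  · exact g.causal_iff.2 (.single ⟨α, a, b, hab, rfl, rfl, h⟩)

end SplitMetric

/-! ### Variations of curves in coordinates -/

/-- On a compact set, locally uniform positive bounds for a parameter combine to a uniform one. -/
theorem exists_pos_of_local_on_compact {P : ℝ → ℝ → Prop} {K : Set ℝ} (hK : IsCompact K)
    (h : ∀ s₀ ∈ K, ∃ ε₀ > (0 : ℝ), ∀ᶠ s in 𝓝[K] s₀, ∀ ε ∈ Ioo 0 ε₀, P s ε) :
    ∃ ε₀ > (0 : ℝ), ∀ s ∈ K, ∀ ε ∈ Ioo 0 ε₀, P s ε := by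
  refine hK.induction_on (p := fun A => ∃ ε₀ > (0 : ℝ), ∀ s ∈ A, ∀ ε ∈ Ioo 0 ε₀, P s ε)
    ⟨1, one_pos, by simp⟩ ?_ ?_ ?_
  · rintro A B hAB ⟨e, he, h⟩
    exact ⟨e, he, fun s hs => h s (hAB hs)⟩
  · rintro A B ⟨e, he, h⟩ ⟨e', he', h'⟩
    refine ⟨min e e', lt_min he he', ?_⟩
    rintro s (hs | hs) ε hε
    · exact h s hs ε ⟨hε.1, hε.2.trans_le (min_le_left _ _)⟩
    · exact h' s hs ε ⟨hε.1, hε.2.trans_le (min_le_right _ _)⟩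
  · intro s hs
    obtain ⟨e, he, h⟩ := h s hs
    exact ⟨_, h, e, he, fun s hs => hs⟩

/-- If a `C¹` family is nonpositive at parameter `0` and, at one point, either negative or
decreasing in the parameter, then it is negative near that point for small positive parameters. -/
theorem eventually_neg_of_deriv_neg {X : Type*} [NormedAddCommGroup X] [NormedSpace ℝ X]
    {F : ℝ × X → ℝ} {x₀ : X} (hF : ContDiffAt ℝ 1 F (0, x₀))
    (h : F (0, x₀) < 0 ∨ fderiv ℝ F (0, x₀) (1, 0) < 0) :
    ∃ ε₀ > (0 : ℝ), ∀ᶠ x in 𝓝 x₀, ∀ ε ∈ Ioo 0 ε₀, F (0, x) ≤ 0 → F (ε, x) < 0 := by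
  rcases h with h | h
  · have h1 : ∀ᶠ z in 𝓝 ((0 : ℝ), x₀), F z < 0 := hF.continuousAt.eventually (gt_mem_nhds h)
    rw [nhds_prod_eq] at h1
    obtain ⟨pa, ha, pb, hb, hab⟩ := eventually_prod_iff.1 h1
    obtain ⟨e, he, hae⟩ := Metric.eventually_nhds_iff.1 ha
    refine ⟨e, he, hb.mono fun x hx ε hε _ => hab (hae ?_) hx⟩
    rw [Real.dist_eq, sub_zero, abs_of_pos hε.1]; exact hε.2
  · have h0 : ∀ᶠ z in 𝓝 ((0 : ℝ), x₀), ContDiffAt ℝ 1 F z := hF.eventually (by simp)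
    have h1 : ∀ᶠ z in 𝓝 ((0 : ℝ), x₀), fderiv ℝ F z (1, 0) < 0 := by
      have hc : ContinuousAt (fun z => fderiv ℝ F z (1, 0)) (0, x₀) :=
        ((hF.fderiv_right (m := 0) le_rfl).clm_apply contDiffAt_const).continuousAt
      exact hc.eventually (gt_mem_nhds h)
    have h2 := h0.and h1
    rw [nhds_prod_eq] at h2
    obtain ⟨pa, ha, pb, hb, hab⟩ := eventually_prod_iff.1 h2
    obtain ⟨e, he, hae⟩ := Metric.eventually_nhds_iff.1 ha
    refine ⟨e, he, hb.mono fun x hx ε hε hle => lt_of_lt_of_le ?_ hle⟩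
    have hd : ∀ r ∈ Icc 0 ε, HasDerivAt (fun r => F (r, x)) (fderiv ℝ F (r, x) (1, 0)) r := by
      intro r hr
      have hr' : pa r := hae (by
        rw [Real.dist_eq, sub_zero, abs_of_nonneg hr.1]; exact hr.2.trans_lt hε.2)
      have := ((hab hr' hx).1.differentiableAt (by simp)).hasFDerivAt.comp_hasDerivAt r
        ((hasDerivAt_id r).prodMk (hasDerivAt_const r x))
      exact this
    have hanti : StrictAntiOn (fun r => F (r, x)) (Icc 0 ε) := by
      refine strictAntiOn_of_hasDerivWithinAt_neg (convex_Icc 0 ε)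
        (fun r hr => (hd r hr).continuousAt.continuousWithinAt)
        (f' := fun r => fderiv ℝ F (r, x) (1, 0))
        (fun r hr => (hd r (interior_subset hr)).hasDerivWithinAt) (fun r hr => ?_)
      have hr := interior_subset hr
      exact (hab (hae (by
        rw [Real.dist_eq, sub_zero, abs_of_nonneg hr.1]; exact hr.2.trans_lt hε.2)) hx).2
    exact hanti (left_mem_Icc.2 hε.1.le) (right_mem_Icc.2 hε.1.le) hε.1

/-- The first variation of `½ G(c', c')` at a point, for a curve through `x` with velocity `v` and
a variation field with value `y` and derivative `w` there. -/
def firstVariation {E : Type*} [NormedAddCommGroup E] [NormedSpace ℝ E]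
    (G : E → E →L[ℝ] E →L[ℝ] ℝ) (x v y w : E) : ℝ :=
  1 / 2 * fderiv ℝ G x y v v + G x v w

/-- The factor `2` stems from `firstVariation` referring to half of the quadratic form. -/
theorem hasDerivAt_variation {E : Type*} [NormedAddCommGroup E] [NormedSpace ℝ E]
    {G : E → E →L[ℝ] E →L[ℝ] ℝ} {x : E} (hG : DifferentiableAt ℝ G x)
    (hsymm : ∀ v w, G x v w = G x w v) (v y w : E) :
    HasDerivAt (fun ε : ℝ => G (x + ε • y) (v + ε • w) (v + ε • w))
      (2 * firstVariation G x v y w) 0 := by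
  have h1 : ∀ a b : E, HasDerivAt (fun ε : ℝ => a + ε • b) b 0 := fun a b => by
    have := ((hasDerivAt_id (0 : ℝ)).smul_const b).const_add a
    rwa [one_smul] at this
  have hG' : HasFDerivAt G (fderiv ℝ G x) (x + (0 : ℝ) • y) := by
    rw [zero_smul, add_zero]; exact hG.hasFDerivAt
  have h2 : HasDerivAt (fun ε : ℝ => G (x + ε • y)) (fderiv ℝ G x y) 0 :=
    HasFDerivAt.comp_hasDerivAt (𝕜 := ℝ) (l := G) (l' := fderiv ℝ G x)
      (f := fun ε : ℝ => x + ε • y) (0 : ℝ) hG' (h1 x y)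
  have h3 := (h2.clm_apply (h1 v w)).clm_apply (h1 v w)
  simp only [zero_smul, add_zero] at h3
  refine h3.congr_deriv ?_
  simp only [firstVariation, add_apply, hsymm w v]
  ring

/-- A causal curve `c` is made timelike near one parameter by moving it along `V` if it is
timelike there or its first variation is negative. The linear form `τ` selects the
future-directed vectors. -/
theorem exists_variation_neg {E : Type*} [NormedAddCommGroup E] [NormedSpace ℝ E]
    {G : E → E →L[ℝ] E →L[ℝ] ℝ} {U : Set E} (hU : IsOpen U) (hG : ContDiffOn ℝ ∞ G U)
    (hsymm : ∀ x v w, G x v w = G x w v) (τ : E →L[ℝ] ℝ)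
    {c c' V V' : ℝ → E} {S : Set ℝ} {s₀ : ℝ}
    (hx : c s₀ ∈ U) (hc : ContinuousWithinAt c S s₀)
    (hc' : ContinuousWithinAt c' S s₀) (hV : ContinuousWithinAt V S s₀)
    (hV' : ContinuousWithinAt V' S s₀) (hpos : 0 < τ (c' s₀))
    (h : G (c s₀) (c' s₀) (c' s₀) < 0 ∨ firstVariation G (c s₀) (c' s₀) (V s₀) (V' s₀) < 0) :
    ∃ ε₀ > (0 : ℝ), ∀ᶠ s in 𝓝[S] s₀, ∀ ε ∈ Ioo 0 ε₀,
      G (c s) (c' s) (c' s) ≤ 0 →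
      c s + ε • V s ∈ U ∧
      G (c s + ε • V s) (c' s + ε • V' s) (c' s + ε • V' s) < 0 ∧
      0 < τ (c' s + ε • V' s) := by
  let F : ℝ × (E × E × E × E) → ℝ := fun z =>
    G (z.2.1 + z.1 • z.2.2.2.1) (z.2.2.1 + z.1 • z.2.2.2.2) (z.2.2.1 + z.1 • z.2.2.2.2)
  let D : ℝ → E × E × E × E := fun s => (c s, c' s, V s, V' s)
  have hD : Tendsto D (𝓝[S] s₀) (𝓝 (D s₀)) := hc.prodMk (hc'.prodMk (hV.prodMk hV'))
  have hGx : ContDiffAt ℝ ∞ G (c s₀) := hG.contDiffAt (hU.mem_nhds hx)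
  have hF : ContDiffAt ℝ ∞ F (0, D s₀) := by
    have hG' : ContDiffAt ℝ ∞ G
        ((fun z : ℝ × (E × E × E × E) => z.2.1 + z.1 • z.2.2.2.1) (0, D s₀)) := by
      simpa [D] using hGx
    have h1 := hG'.comp (0, D s₀) (f := fun z : ℝ × (E × E × E × E) => z.2.1 + z.1 • z.2.2.2.1)
      (by fun_prop)
    exact (h1.clm_apply (by fun_prop)).clm_apply (by fun_prop)
  have hderiv : fderiv ℝ F (0, D s₀) (1, 0) =
      2 * firstVariation G (c s₀) (c' s₀) (V s₀) (V' s₀) := by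
    have h1 : HasDerivAt (fun r : ℝ => F (r, D s₀)) (fderiv ℝ F (0, D s₀) (1, 0)) 0 :=
      HasFDerivAt.comp_hasDerivAt (f := fun r : ℝ => (r, D s₀)) (0 : ℝ)
        (hF.differentiableAt (by simp)).hasFDerivAt
        ((hasDerivAt_id (0 : ℝ)).prodMk (hasDerivAt_const (0 : ℝ) (D s₀)))
    exact h1.unique (hasDerivAt_variation (hGx.differentiableAt (by simp)) (hsymm _) _ _ _)
  obtain ⟨e, he, hev⟩ := eventually_neg_of_deriv_neg (hF.of_le (by simp))
    (h.imp (fun h => by simpa [F, D] using h) (fun h => by rw [hderiv]; linarith))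
  have hopen : ∀ᶠ z in 𝓝 ((0 : ℝ), D s₀), z.2.1 + z.1 • z.2.2.2.1 ∈ U ∧
      0 < τ (z.2.2.1 + z.1 • z.2.2.2.2) := by
    have c1 : Continuous fun z : ℝ × (E × E × E × E) => z.2.1 + z.1 • z.2.2.2.1 := by fun_prop
    have c2 : Continuous fun z : ℝ × (E × E × E × E) => τ (z.2.2.1 + z.1 • z.2.2.2.2) := by
      fun_prop
    exact (c1.continuousAt.eventually (hU.mem_nhds (by simpa [D] using hx))).and
      (c2.continuousAt.eventually (lt_mem_nhds (by simpa [D] using hpos)))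
  rw [nhds_prod_eq] at hopen
  obtain ⟨pa, ha, pb, hb, hab⟩ := eventually_prod_iff.1 hopen
  obtain ⟨e', he', hae⟩ := Metric.eventually_nhds_iff.1 ha
  refine ⟨min e e', lt_min he he', ?_⟩
  filter_upwards [hD.eventually hev, hD.eventually hb] with s hs hs' ε hε hle
  have hpa : pa ε := hae (by
    rw [Real.dist_eq, sub_zero, abs_of_pos hε.1]; exact hε.2.trans_le (min_le_right _ _))
  have h1 := hab hpa hs'
  exact ⟨h1.1, hs ε ⟨hε.1, hε.2.trans_le (min_le_left _ _)⟩ (by simpa [F, D] using hle), h1.2⟩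

/-! ### Variations by time shifts -/

theorem ContDiffWithinAt.derivWithin_infty {E : Type*} [NormedAddCommGroup E] [NormedSpace ℝ E]
    {c : ℝ → E} {S : Set ℝ} {s : ℝ} (h : ContDiffWithinAt ℝ ∞ c S s) (hS : UniqueDiffOn ℝ S)
    (hs : s ∈ S) : ContDiffWithinAt ℝ ∞ (derivWithin c S) S s := by
  have h1 : ContDiffWithinAt ℝ ∞ (fderivWithin ℝ c S) S s :=
    h.fderivWithin_right hS (by simp) hs
  exact h1.clm_apply (contDiffWithinAt_const (c := (1 : ℝ)))

section MultilinearCalculus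
variable {E : Type*} [NormedAddCommGroup E] [NormedSpace ℝ E] {G : E → E →L[ℝ] E →L[ℝ] ℝ}

theorem ContinuousWithinAt.fderiv_bilin {c a b d : ℝ → E} {S : Set ℝ} {s : ℝ}
    (hG : ContDiffAt ℝ ∞ G (c s)) (hc : ContinuousWithinAt c S s) (ha : ContinuousWithinAt a S s)
    (hb : ContinuousWithinAt b S s) (hd : ContinuousWithinAt d S s) :
    ContinuousWithinAt (fun r => fderiv ℝ G (c r) (a r) (b r) (d r)) S s := by
  have h1 : ContinuousAt (fderiv ℝ G) (c s) := (hG.fderiv_right (m := 0) (by simp)).continuousAt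
  exact (((h1.comp_continuousWithinAt hc).clm_apply ha).clm_apply hb).clm_apply hd

theorem ContDiffWithinAt.bilin {c a b : ℝ → E} {S : Set ℝ} {s : ℝ}
    (hG : ContDiffAt ℝ ∞ G (c s)) (hc : ContDiffWithinAt ℝ ∞ c S s)
    (ha : ContDiffWithinAt ℝ ∞ a S s) (hb : ContDiffWithinAt ℝ ∞ b S s) :
    ContDiffWithinAt ℝ ∞ (fun r => G (c r) (a r) (b r)) S s :=
  ((hG.comp_contDiffWithinAt s hc).clm_apply ha).clm_apply hb

end MultilinearCalculus

theorem eventually_source {n : ℕ} {M : Type*} [TopologicalSpace M] [ChartedSpace (Model n) M]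
    {γ : ℝ → ℝ × M} {S : Set ℝ} {s₀ : ℝ} {p₀ : M}
    (hc : ContinuousWithinAt γ S s₀)
    (h : (γ s₀).2 ∈ (extChartAt 𝓘(ℝ, Model n) p₀).source) :
    ∀ᶠ s in 𝓝[S] s₀, (γ s).2 ∈ (extChartAt 𝓘(ℝ, Model n) p₀).source :=
  (continuous_snd.continuousAt.comp_continuousWithinAt hc).eventually
    ((isOpen_extChartAt_source p₀).mem_nhds h)

theorem continuousOn_vel_fst {n : ℕ} {M : Type*} [TopologicalSpace M]
    [ChartedSpace (Model n) M] {γ : ℝ → ℝ × M} {S : Set ℝ} (hS : UniqueDiffOn ℝ S)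
    (h : SmoothCurveOn n γ S) : ContinuousOn (fun s => (vel n γ S s).1) S :=
  h.fst.continuousOn_derivWithin hS (by simp)

namespace SplitMetric
variable {n : ℕ} {M : Type*} [TopologicalSpace M] [ChartedSpace (Model n) M]
  [IsManifold 𝓘(ℝ, Model n) ∞ M] (g : SplitMetric n M)

theorem chartMetric_time (p₀ : M) (x v : ℝ × Model n) (r : ℝ) :
    g.chartMetric p₀ x v (r, 0) = -(g.β (coordInv p₀ x) * v.1 * r) := by
  rw [chartMetric_apply, coordForm_eq, bil_def]
  simp [coordInv, mul_assoc]

theorem timelikeCone_vel_iff {p₀ : M} {γ : ℝ → ℝ × M} {S : Set ℝ} {s : ℝ}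
    {v : ℝ × Model n} (hu : UniqueDiffWithinAt ℝ S s) (hc : ContinuousWithinAt γ S s)
    (hsrc : (γ s).2 ∈ (extChartAt 𝓘(ℝ, Model n) p₀).source)
    (hd : HasDerivWithinAt (coordCurve n p₀ γ) v S s) :
    g.timelikeCone (γ s) (vel n γ S s) ↔
      g.chartMetric p₀ (coordCurve n p₀ γ s) v v < 0 ∧ 0 < v.1 := by
  rw [← g.bil_vel hu hc hsrc hd, timelikeCone_iff,
    show (vel n γ S s).1 = v.1 by rw [vel_eq hu hc hsrc hd]]

theorem causalCone_vel_iff {p₀ : M} {γ : ℝ → ℝ × M} {S : Set ℝ} {s : ℝ}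
    {v : ℝ × Model n} (hu : UniqueDiffWithinAt ℝ S s) (hc : ContinuousWithinAt γ S s)
    (hsrc : (γ s).2 ∈ (extChartAt 𝓘(ℝ, Model n) p₀).source)
    (hd : HasDerivWithinAt (coordCurve n p₀ γ) v S s) :
    g.causalCone (γ s) (vel n γ S s) ↔
      g.chartMetric p₀ (coordCurve n p₀ γ s) v v ≤ 0 ∧ 0 < v.1 := by
  rw [← g.bil_vel hu hc hsrc hd, causalCone_iff,
    show (vel n γ S s).1 = v.1 by rw [vel_eq hu hc hsrc hd]]

/-- The derivative in the time variable of `τ ↦ g_{(τ, p)}(v, v)` at `q = (t, p)`. -/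
def timeDeriv (q : ℝ × M) (v : ℝ × Model n) : ℝ := deriv (fun τ => g.bil (τ, q.2) v v) q.1

theorem contDiffAt_chartMetric {p₀ : M} {x : ℝ × Model n} (hx : x ∈ coordDomain n p₀) :
    ContDiffAt ℝ ∞ (g.chartMetric p₀) x :=
  (g.contDiffOn_chartMetric p₀).contDiffAt ((isOpen_coordDomain p₀).mem_nhds hx)

/-- In every chart `timeDeriv` is a partial derivative of the coefficients of the metric. -/
theorem timeDeriv_eq {p₀ : M} {q : ℝ × M} (hq : q.2 ∈ (extChartAt 𝓘(ℝ, Model n) p₀).source)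
    (v : ℝ × Model n) :
    g.timeDeriv q (v.1, chartInvDeriv p₀ (extChartAt 𝓘(ℝ, Model n) p₀ q.2) v.2) =
      fderiv ℝ (g.chartMetric p₀) (q.1, extChartAt 𝓘(ℝ, Model n) p₀ q.2) (1, 0) v v := by
  have h0 : ∀ τ, g.bil (τ, q.2) (v.1, chartInvDeriv p₀ (extChartAt 𝓘(ℝ, Model n) p₀ q.2) v.2)
      (v.1, chartInvDeriv p₀ (extChartAt 𝓘(ℝ, Model n) p₀ q.2) v.2) =
      g.chartMetric p₀ (τ, extChartAt 𝓘(ℝ, Model n) p₀ q.2) v v := fun τ =>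
    g.bil_eq_chartMetric p₀ (q := (τ, q.2)) hq v v
  have hx : (q.1, extChartAt 𝓘(ℝ, Model n) p₀ q.2) ∈ coordDomain n p₀ :=
    ⟨mem_univ _, (extChartAt 𝓘(ℝ, Model n) p₀).map_source hq⟩
  have h1 : HasDerivAt (fun τ : ℝ => g.chartMetric p₀ (τ, extChartAt 𝓘(ℝ, Model n) p₀ q.2))
      (fderiv ℝ (g.chartMetric p₀) (q.1, extChartAt 𝓘(ℝ, Model n) p₀ q.2) (1, 0)) q.1 :=
    HasFDerivAt.comp_hasDerivAt (𝕜 := ℝ) (l := g.chartMetric p₀)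
      (l' := fderiv ℝ (g.chartMetric p₀) (q.1, extChartAt 𝓘(ℝ, Model n) p₀ q.2))
      (f := fun τ : ℝ => (τ, extChartAt 𝓘(ℝ, Model n) p₀ q.2)) q.1
      ((g.contDiffAt_chartMetric hx).differentiableAt (by simp)).hasFDerivAt
      ((hasDerivAt_id _).prodMk (hasDerivAt_const _ _))
  have h2 := (h1.clm_apply (hasDerivAt_const _ v)).clm_apply (hasDerivAt_const _ v)
  simp only [timeDeriv, h0]
  rw [h2.deriv]
  simp

/-- Since the metric has no mixed terms, the first variation of a time shift involves only
`timeDeriv` and the coefficient `β`. -/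
theorem firstVariation_time {p₀ : M} {q : ℝ × M}
    (hq : q.2 ∈ (extChartAt 𝓘(ℝ, Model n) p₀).source) (v : ℝ × Model n) (a b : ℝ) :
    firstVariation (g.chartMetric p₀) (q.1, extChartAt 𝓘(ℝ, Model n) p₀ q.2) v (a, 0) (b, 0) =
      1 / 2 * a * g.timeDeriv q (v.1, chartInvDeriv p₀ (extChartAt 𝓘(ℝ, Model n) p₀ q.2) v.2) -
        g.β q * v.1 * b := by
  rw [timeDeriv_eq g hq, firstVariation, chartMetric_time,
    show ((a, 0) : ℝ × Model n) = a • (1, 0) by simp, map_smul]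
  simp only [smul_apply, smul_eq_mul, coordInv, chartInv,
    (extChartAt 𝓘(ℝ, Model n) p₀).left_inv hq]
  ring

/-- A curve moved in time by `ε φ`. -/
def timeShift (γ : ℝ → ℝ × M) (φ : ℝ → ℝ) (ε s : ℝ) : ℝ × M := ((γ s).1 + ε * φ s, (γ s).2)

theorem continuousOn_timeDeriv {γ : ℝ → ℝ × M} {S : Set ℝ} (hS : UniqueDiffOn ℝ S)
    (h : SmoothCurveOn n γ S) :
    ContinuousOn (fun s => g.timeDeriv (γ s) (vel n γ S s)) S := by
  intro s₀ hs₀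
  have hsrc := mem_extChartAt_source (I := 𝓘(ℝ, Model n)) (γ s₀).2
  have hc := h.contDiffWithinAt_coordCurve hs₀ hsrc
  have hc' := hc.derivWithin_infty hS hs₀
  have hx := coordCurve_mem hsrc
  refine (ContinuousWithinAt.fderiv_bilin (g.contDiffAt_chartMetric hx) hc.continuousWithinAt
    (continuousWithinAt_const (b := ((1, 0) : ℝ × Model n)))
    hc'.continuousWithinAt hc'.continuousWithinAt).congr_of_eventuallyEq_of_mem ?_ hs₀
  filter_upwards [eventually_source (h.continuousOn _ hs₀) hsrc, self_mem_nhdsWithin] with s hs hsS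
  rw [vel_eq (hS s hsS) (h.continuousOn _ hsS) hs (h.hasDerivWithinAt_coordCurve hsS hs),
    timeDeriv_eq g hs]
  rfl

theorem continuousOn_bil_vel {γ : ℝ → ℝ × M} {S : Set ℝ} (hS : UniqueDiffOn ℝ S)
    (h : SmoothCurveOn n γ S) :
    ContinuousOn (fun s => g.bil (γ s) (vel n γ S s) (vel n γ S s)) S := by
  intro s₀ hs₀
  have hsrc := mem_extChartAt_source (I := 𝓘(ℝ, Model n)) (γ s₀).2
  have hc := h.contDiffWithinAt_coordCurve hs₀ hsrc
  have hc' := hc.derivWithin_infty hS hs₀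
  have hx := coordCurve_mem hsrc
  refine (ContDiffWithinAt.bilin (g.contDiffAt_chartMetric hx) hc hc'
    hc').continuousWithinAt.congr_of_eventuallyEq_of_mem ?_ hs₀
  filter_upwards [eventually_source (h.continuousOn _ hs₀) hsrc, self_mem_nhdsWithin] with s hs hsS
  rw [g.bil_vel (hS s hsS) (h.continuousOn _ hsS) hs (h.hasDerivWithinAt_coordCurve hsS hs)]

/-- A small time shift `ε φ` turns a causal piece into a timelike one if, at each parameter, the
piece is timelike or the first variation of the shift is negative. -/
theorem exists_timeShift_timelike {γ : ℝ → ℝ × M} {a b : ℝ} (hab : a < b)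
    (hγ : IsPiece g.causalCone γ a b) {φ : ℝ → ℝ} (hφ : ContDiff ℝ ∞ φ)
    (h : ∀ s ∈ Icc a b, g.bil (γ s) (vel n γ (Icc a b) s) (vel n γ (Icc a b) s) < 0 ∨
      1 / 2 * φ s * g.timeDeriv (γ s) (vel n γ (Icc a b) s) <
        g.β (γ s) * (vel n γ (Icc a b) s).1 * deriv φ s) :
    ∃ ε₀ > (0 : ℝ), ∀ ε ∈ Ioo 0 ε₀, IsPiece g.timelikeCone (timeShift γ φ ε) a b := by
  have hS := uniqueDiffOn_Icc hab
  have hsm : ∀ ε, SmoothCurveOn n (timeShift γ φ ε) (Icc a b) := fun ε => by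
    refine ContMDiffOn.prodMk ?_ hγ.1.snd
    rw [contMDiffOn_iff_contDiffOn]
    exact hγ.1.fst.add (contDiff_const.mul hφ).contDiffOn
  suffices hloc : ∀ s₀ ∈ Icc a b, ∃ ε₀ > (0 : ℝ), ∀ᶠ s in 𝓝[Icc a b] s₀, ∀ ε ∈ Ioo 0 ε₀,
      g.timelikeCone (timeShift γ φ ε s) (vel n (timeShift γ φ ε) (Icc a b) s) by
    obtain ⟨ε₀, hε₀, h⟩ := exists_pos_of_local_on_compact isCompact_Icc hloc
    exact ⟨ε₀, hε₀, fun ε hε => ⟨hsm ε, fun s hs => h s hs ε hε⟩⟩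
  intro s₀ hs₀
  have hsrc := mem_extChartAt_source (I := 𝓘(ℝ, Model n)) (γ s₀).2
  have hc := hγ.1.contDiffWithinAt_coordCurve hs₀ hsrc
  have hc' := hc.derivWithin_infty hS hs₀
  have hx := coordCurve_mem hsrc
  have hv := vel_eq (hS s₀ hs₀) (hγ.1.continuousOn _ hs₀) hsrc
    (hγ.1.hasDerivWithinAt_coordCurve hs₀ hsrc)
  have hV : ContinuousWithinAt (fun s => ((φ s, 0) : ℝ × Model n)) (Icc a b) s₀ :=
    (hφ.continuous.prodMk continuous_const).continuousWithinAt
  have hV' : ContinuousWithinAt (fun s => ((deriv φ s, 0) : ℝ × Model n)) (Icc a b) s₀ :=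
    ((hφ.continuous_deriv (by simp)).prodMk continuous_const).continuousWithinAt
  obtain ⟨ε₀, hε₀, hev⟩ := exists_variation_neg (isOpen_coordDomain (γ s₀).2)
    (g.contDiffOn_chartMetric (γ s₀).2) (g.chartMetric_symm _)
    (ContinuousLinearMap.fst ℝ ℝ (Model n)) hx hc.continuousWithinAt
    hc'.continuousWithinAt hV hV'
    (((g.causalCone_vel_iff (hS s₀ hs₀) (hγ.1.continuousOn _ hs₀) hsrc
      (hγ.1.hasDerivWithinAt_coordCurve hs₀ hsrc)).1 (hγ.2 s₀ hs₀)).2)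
    ((h s₀ hs₀).imp (fun h => by
      rwa [g.bil_vel (hS s₀ hs₀) (hγ.1.continuousOn _ hs₀) hsrc
        (hγ.1.hasDerivWithinAt_coordCurve hs₀ hsrc)] at h) (fun h => by
      rw [hv] at h
      have := g.firstVariation_time hsrc (derivWithin (coordCurve n (γ s₀).2 γ) (Icc a b) s₀)
        (φ s₀) (deriv φ s₀)
      simp only [coordCurve] at this h ⊢
      rw [this]; linarith))
  refine ⟨ε₀, hε₀, ?_⟩
  filter_upwards [hev, eventually_source (hγ.1.continuousOn _ hs₀) hsrc,
    self_mem_nhdsWithin] with s hs hsrc' hsS ε hε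
  have hd := hγ.1.hasDerivWithinAt_coordCurve hsS hsrc'
  have hle := ((g.causalCone_vel_iff (hS s hsS) (hγ.1.continuousOn _ hsS) hsrc' hd).1
    (hγ.2 s hsS)).1
  have heq : ∀ r, coordCurve n (γ s₀).2 (timeShift γ φ ε) r =
      coordCurve n (γ s₀).2 γ r + ε • ((φ r, 0) : ℝ × Model n) := fun r => by
    simp [coordCurve, timeShift]
  have hd' : HasDerivWithinAt (coordCurve n (γ s₀).2 (timeShift γ φ ε))
      (derivWithin (coordCurve n (γ s₀).2 γ) (Icc a b) s + ε • ((deriv φ s, 0) : ℝ × Model n))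
      (Icc a b) s := by
    have hφs : HasDerivAt φ (deriv φ s) s := (hφ.differentiable (by simp) s).hasDerivAt
    rw [funext heq]
    exact hd.add ((hφs.prodMk (hasDerivAt_const s (0 : Model n))).const_smul ε).hasDerivWithinAt
  rw [g.timelikeCone_vel_iff (hS s hsS) ((hsm ε).continuousOn _ hsS) hsrc' hd', heq]
  exact (hs ε hε hle).2

end SplitMetric

/-! ### Push-up properties -/

/-- The point `q` moved along the time line by `r`. -/
def SplitMetric.shift {M : Type*} (q : ℝ × M) (r : ℝ) : ℝ × M := (q.1 + r, q.2)

theorem SplitMetric.shift_shift {M : Type*} (q : ℝ × M) (r r' : ℝ) :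
    SplitMetric.shift (SplitMetric.shift q r) r' = SplitMetric.shift q (r + r') := by
  simp [SplitMetric.shift, add_assoc]

theorem exists_Icc_mem_nhdsWithin {a b s : ℝ} (hab : a < b) (hs : s ∈ Icc a b)
    {A : Set ℝ} (hA : A ∈ 𝓝[Icc a b] s) : ∃ a' b', a' < b' ∧ s ∈ Icc a' b' ∧
      Icc a' b' ⊆ Icc a b ∧ Icc a' b' ⊆ A ∧ Icc a' b' ∈ 𝓝[Icc a b] s := by
  obtain ⟨δ, hδ, H⟩ := Metric.mem_nhdsWithin_iff.1 hA
  have hsub : Icc (max a (s - δ / 2)) (min b (s + δ / 2)) ⊆ Icc a b :=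
    Icc_subset_Icc (le_max_left _ _) (min_le_left _ _)
  refine ⟨max a (s - δ / 2), min b (s + δ / 2), ?_, ⟨?_, ?_⟩, hsub,
    fun r hr => H ⟨?_, hsub hr⟩, ?_⟩
  · exact max_lt (lt_min hab (by linarith [hs.1])) (lt_min (by linarith [hs.2]) (by linarith))
  · exact max_le hs.1 (by linarith)
  · exact le_min hs.2 (by linarith)
  · rw [Metric.mem_ball, Real.dist_eq, abs_lt]
    have h1 := (le_max_right _ _).trans hr.1
    have h2 := hr.2.trans (min_le_right _ _)
    constructor <;> linarith
  · rw [mem_nhdsWithin_iff_exists_mem_nhds_inter]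
    refine ⟨Icc (s - δ / 2) (s + δ / 2), Icc_mem_nhds (by linarith) (by linarith), ?_⟩
    rintro r ⟨h1, h2⟩
    exact ⟨max_le h2.1 h1.1, le_min h2.2 h1.2⟩

namespace SplitMetric
variable {n : ℕ} {M : Type*} [TopologicalSpace M] [ChartedSpace (Model n) M]
  [IsManifold 𝓘(ℝ, Model n) ∞ M] (g : SplitMetric n M)

/-- A coordinate segment with everywhere timelike direction. -/
theorem chron_of_coord_line {p₀ : M} {x w : ℝ × Model n} (hw : 0 < w.1)
    (hx : ∀ s ∈ Icc (0 : ℝ) 1, x + s • w ∈ coordDomain n p₀)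
    (hneg : ∀ s ∈ Icc (0 : ℝ) 1, g.chartMetric p₀ (x + s • w) w w < 0) :
    g.Chron (coordInv p₀ x) (coordInv p₀ (x + w)) := by
  have hd : ∀ s : ℝ, HasDerivAt (fun s : ℝ => x + s • w) w s := fun s => by
    have := ((hasDerivAt_id s).smul_const w).const_add x
    rwa [one_smul] at this
  have hsm : SmoothCurveOn n (fun s : ℝ => coordInv p₀ (x + s • w)) (Icc 0 1) :=
    smoothCurveOn_coordInv (by fun_prop) hx
  have hp : IsPiece g.timelikeCone (fun s : ℝ => coordInv p₀ (x + s • w)) 0 1 := by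
    refine ⟨hsm, fun s hs => ?_⟩
    have hev : ∀ᶠ r in 𝓝[Icc 0 1] s, coordCurve n p₀ (fun s : ℝ => coordInv p₀ (x + s • w)) r =
        x + r • w := by
      filter_upwards [self_mem_nhdsWithin] with r hr using
        coordCurve_coordInv (c := fun s : ℝ => x + s • w) (hx r hr)
    rw [g.timelikeCone_vel_iff (uniqueDiffOn_Icc one_pos s hs) (hsm.continuousOn s hs)
      (coordInv_source (hx s hs)) ((hd s).hasDerivWithinAt.congr_of_eventuallyEq_of_mem hev hs),
      coordCurve_coordInv (c := fun s : ℝ => x + s • w) (hx s hs)]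
    exact ⟨hneg s hs, hw⟩
  simpa using g.chron_of_isPiece one_pos hp

theorem chron_shift (q : ℝ × M) {ε : ℝ} (hε : 0 < ε) : g.Chron q (shift q ε) := by
  have hsrc := mem_extChartAt_source (I := 𝓘(ℝ, Model n)) q.2
  have hx : ∀ t : ℝ, (t, extChartAt 𝓘(ℝ, Model n) q.2 q.2) ∈ coordDomain n q.2 := fun t =>
    ⟨mem_univ _, (extChartAt 𝓘(ℝ, Model n) q.2).map_source hsrc⟩
  have hinv : ∀ t : ℝ, coordInv q.2 (t, extChartAt 𝓘(ℝ, Model n) q.2 q.2) = (t, q.2) := fun t => by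
    simp only [coordInv, chartInv, (extChartAt 𝓘(ℝ, Model n) q.2).left_inv hsrc]
  have := g.chron_of_coord_line (p₀ := q.2) (x := (q.1, extChartAt 𝓘(ℝ, Model n) q.2 q.2))
    (w := (ε, 0)) hε (fun s _ => by simpa using hx _) (fun s _ => by
      rw [chartMetric_time]
      have := g.β_pos (coordInv q.2 ((q.1, extChartAt 𝓘(ℝ, Model n) q.2 q.2) +
        s • ((ε, 0) : ℝ × Model n)))
      simp only [neg_lt_zero]; positivity)
  rw [Prod.mk_add_mk, add_zero, hinv, hinv] at this
  exact this

theorem chron_shift_shift (q : ℝ × M) {r r' : ℝ} (h : r < r') :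
    g.Chron (shift q r) (shift q r') := by
  have := g.chron_shift (shift q r) (sub_pos.2 h)
  rwa [shift_shift, add_sub_cancel] at this

/-- Time shifts by increasing functions whose logarithmic derivative is large enough make a causal
piece timelike: the term with `φ'` in the first variation dominates the one with `φ`. -/
theorem exists_timeShift_timelike_of_growth {γ : ℝ → ℝ × M} {a b : ℝ} (hab : a < b)
    (hγ : IsPiece g.causalCone γ a b) :
    ∃ K > (0 : ℝ), ∀ φ : ℝ → ℝ, ContDiff ℝ ∞ φ → (∀ s, 0 < deriv φ s) →
      (∀ s, K * |φ s| ≤ deriv φ s) →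
      ∃ ε₀ > (0 : ℝ), ∀ ε ∈ Ioo 0 ε₀, IsPiece g.timelikeCone (timeShift γ φ ε) a b := by
  have hS := uniqueDiffOn_Icc hab
  have hP : ∀ s ∈ Icc a b, 0 < g.β (γ s) * (vel n γ (Icc a b) s).1 := fun s hs =>
    mul_pos (g.β_pos _) (hγ.2 s hs).2
  have hcont : ContinuousOn (fun s => g.timeDeriv (γ s) (vel n γ (Icc a b) s) /
      (g.β (γ s) * (vel n γ (Icc a b) s).1)) (Icc a b) :=
    (g.continuousOn_timeDeriv hS hγ.1).div
      ((g.β_smooth.continuous.comp_continuousOn hγ.1.continuousOn).mul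
        (continuousOn_vel_fst hS hγ.1)) (fun s hs => (hP s hs).ne')
  obtain ⟨C, hC⟩ := isCompact_Icc.exists_bound_of_continuousOn hcont
  -- `C` bounds the ratio of the two coefficients in the first variation
  refine ⟨|C| + 1, by positivity, fun φ hφ hpos hgrow => ?_⟩
  refine g.exists_timeShift_timelike hab hγ hφ fun s hs => .inr ?_
  have h1 := hC s hs
  have h2 := hP s hs
  rw [Real.norm_eq_abs, abs_div, abs_of_pos h2, div_le_iff₀ h2] at h1
  set P := g.β (γ s) * (vel n γ (Icc a b) s).1
  set Q := g.timeDeriv (γ s) (vel n γ (Icc a b) s)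
  have h3 : φ s * Q ≤ |φ s| * (|C| * P) := by
    calc φ s * Q ≤ |φ s * Q| := le_abs_self _
      _ = |φ s| * |Q| := abs_mul _ _
      _ ≤ |φ s| * (|C| * P) := by
        gcongr; exact h1.trans (by gcongr; exact le_abs_self C)
  have h4 : |C| * |φ s| ≤ deriv φ s := by
    have := hgrow s
    nlinarith [abs_nonneg (φ s)]
  have h5 : |φ s| * (|C| * P) ≤ P * deriv φ s := by nlinarith
  have h6 := mul_pos h2 (hpos s)
  nlinarith

theorem hasDerivAt_exp_mul (K s : ℝ) :
    HasDerivAt (fun s : ℝ => Real.exp (K * s)) (K * Real.exp (K * s)) s := by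
  have := ((hasDerivAt_id s).const_mul K).exp
  simpa [mul_comm] using this

/-- The shift is by a multiple of `exp (K s)`, which is positive at both end points. -/
theorem Joined₁.chron_shift_pos {g : SplitMetric n M} {p q : ℝ × M} (h : Joined₁ g.causalCone p q)
    {ε : ℝ} (hε : 0 < ε) : ∃ δ > (0 : ℝ), g.Chron (shift p δ) (shift q ε) := by
  obtain ⟨γ, a, b, hab, rfl, rfl, h⟩ := h
  obtain ⟨K, hK, H⟩ := g.exists_timeShift_timelike_of_growth hab h
  have hder : deriv (fun s : ℝ => Real.exp (K * s)) = fun s => K * Real.exp (K * s) :=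
    funext fun s => (hasDerivAt_exp_mul K s).deriv
  obtain ⟨e, he, H⟩ := H (fun s => Real.exp (K * s)) (by fun_prop)
    (fun s => by rw [hder]; positivity) (fun s => by rw [hder, abs_of_pos (Real.exp_pos _)])
  have hb := Real.exp_pos (K * b)
  obtain ⟨r, hr0, hr⟩ := exists_between (lt_min he (div_pos hε hb))
  have h1 := g.chron_of_isPiece hab (H r ⟨hr0, hr.trans_le (min_le_left _ _)⟩)
  have h2 : r * Real.exp (K * b) < ε := by
    rw [← lt_div_iff₀ hb]; exact hr.trans_le (min_le_right _ _)
  exact ⟨r * Real.exp (K * a), by positivity, h1.trans (g.chron_shift_shift (γ b) h2)⟩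

/-- The shift is by a multiple of `-exp (-K s)`, which is negative at both end points. -/
theorem Joined₁.chron_shift_neg {g : SplitMetric n M} {p q : ℝ × M} (h : Joined₁ g.causalCone p q)
    {ε : ℝ} (hε : 0 < ε) : ∃ δ > (0 : ℝ), g.Chron (shift p (-ε)) (shift q (-δ)) := by
  obtain ⟨γ, a, b, hab, rfl, rfl, h⟩ := h
  obtain ⟨K, hK, H⟩ := g.exists_timeShift_timelike_of_growth hab h
  have hder : deriv (fun s : ℝ => -Real.exp (-K * s)) = fun s => K * Real.exp (-K * s) :=
    funext fun s => by simpa using (hasDerivAt_exp_mul (-K) s).neg.deriv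
  obtain ⟨e, he, H⟩ := H (fun s => -Real.exp (-K * s)) (by fun_prop)
    (fun s => by rw [hder]; positivity)
    (fun s => by rw [hder, abs_neg, abs_of_pos (Real.exp_pos _)])
  have hb := Real.exp_pos (-K * a)
  obtain ⟨r, hr0, hr⟩ := exists_between (lt_min he (div_pos hε hb))
  have h1 := g.chron_of_isPiece hab (H r ⟨hr0, hr.trans_le (min_le_left _ _)⟩)
  have h2 : r * Real.exp (-K * a) < ε := by
    rw [← lt_div_iff₀ hb]; exact hr.trans_le (min_le_right _ _)
  refine ⟨r * Real.exp (-K * b), by positivity,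
    (g.chron_shift_shift (γ a) (r' := r * -Real.exp (-K * a)) (by linarith)).trans ?_⟩
  rw [← mul_neg]
  exact h1

/-- The future end point of a causal path may be delayed by an arbitrarily small amount to obtain a
timelike path. The delay is split over the pieces, working backwards from the last one. -/
theorem Causal.chron_shift {g : SplitMetric n M} {p q : ℝ × M} (h : g.Causal p q) {ε : ℝ}
    (hε : 0 < ε) : g.Chron p (shift q ε) := by
  rw [causal_iff] at h
  induction h generalizing ε with
  | refl => exact g.chron_shift p hε
  | tail _ h ih =>
    obtain ⟨δ, hδ, h⟩ := Joined₁.chron_shift_pos h hε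
    exact (ih hδ).trans h

/-- The time-reversed form of `Causal.chron_shift`. -/
theorem Causal.shift_chron {g : SplitMetric n M} {p q : ℝ × M} (h : g.Causal p q) {ε : ℝ}
    (hε : 0 < ε) : g.Chron (shift p (-ε)) q := by
  rw [causal_iff] at h
  induction h using Relation.ReflTransGen.head_induction_on generalizing ε with
  | refl => simpa [shift] using g.chron_shift_shift q (neg_lt_zero.2 hε)
  | head h _ ih =>
    obtain ⟨δ, hδ, h⟩ := Joined₁.chron_shift_neg h hε
    exact h.trans (ih hδ)

/-- A timelike piece stays timelike when its end points are moved slightly in time, the shift being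
interpolated linearly in between. -/
theorem Joined₁.exists_shift {g : SplitMetric n M} {p q : ℝ × M} (h : Joined₁ g.timelikeCone p q)
    (u v : ℝ) : ∃ ε₀ > (0 : ℝ), ∀ ε ∈ Ioo 0 ε₀, g.Chron (shift p (ε * u)) (shift q (ε * v)) := by
  obtain ⟨γ, a, b, hab, rfl, rfl, h⟩ := h
  obtain ⟨e, he, H⟩ := g.exists_timeShift_timelike hab (h.imp fun q v hv => ⟨hv.1.le, hv.2⟩)
    (φ := fun s => u + (s - a) / (b - a) * (v - u)) (by fun_prop) (fun s hs => .inl (h.2 s hs).1)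
  refine ⟨e, he, fun ε hε => ?_⟩
  have := g.chron_of_isPiece hab (H ε hε)
  have h0 : b - a ≠ 0 := by linarith
  simpa [timeShift, shift, div_self h0] using this

theorem Chron.exists_shift_left {g : SplitMetric n M} {p q : ℝ × M} (h : g.Chron p q) :
    ∃ ε₀ > (0 : ℝ), ∀ ε ∈ Ioo 0 ε₀, g.Chron (shift p ε) q := by
  obtain ⟨r, h1, h2⟩ := Relation.TransGen.head'_iff.1 (g.chron_iff.1 h)
  obtain ⟨e, he, H⟩ := Joined₁.exists_shift h1 1 0
  refine ⟨e, he, fun ε hε => ?_⟩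
  have h3 : g.Chron (shift p ε) r := by simpa [shift] using H ε hε
  exact g.chron_iff.2 ((g.chron_iff.1 h3).trans_left h2)

theorem Chron.exists_shift_right {g : SplitMetric n M} {p q : ℝ × M} (h : g.Chron p q) :
    ∃ ε₀ > (0 : ℝ), ∀ ε ∈ Ioo 0 ε₀, g.Chron p (shift q (-ε)) := by
  obtain ⟨r, h1, h2⟩ := Relation.TransGen.tail'_iff.1 (g.chron_iff.1 h)
  obtain ⟨e, he, H⟩ := Joined₁.exists_shift h2 0 (-1)
  refine ⟨e, he, fun ε hε => ?_⟩
  have h3 : g.Chron r (shift q (-ε)) := by simpa [shift] using H ε hε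
  exact g.chron_iff.2 (Relation.TransGen.trans_right h1 (g.chron_iff.1 h3))

/-- The push-up property: `p ≤ q ≪ r` implies `p ≪ r`. -/
theorem Causal.trans_chron {g : SplitMetric n M} {p q r : ℝ × M} (h : g.Causal p q)
    (h' : g.Chron q r) : g.Chron p r := by
  obtain ⟨e, he, H⟩ := h'.exists_shift_left
  exact (h.chron_shift (half_pos he)).trans (H _ ⟨half_pos he, half_lt_self he⟩)

/-- The push-up property: `p ≪ q ≤ r` implies `p ≪ r`. -/
theorem Chron.trans_causal {g : SplitMetric n M} {p q r : ℝ × M} (h : g.Chron p q)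
    (h' : g.Causal q r) : g.Chron p r := by
  obtain ⟨e, he, H⟩ := h.exists_shift_right
  exact (H _ ⟨half_pos he, half_lt_self he⟩).trans (h'.shift_chron (half_pos he))

/-- A causal piece whose end points are not chronologically related is lightlike. -/
theorem bil_eq_zero_of_not_chron {γ : ℝ → ℝ × M} {a b : ℝ} (hab : a < b)
    (hγ : IsPiece g.causalCone γ a b) (hn : ¬ g.Chron (γ a) (γ b)) {s : ℝ} (hs : s ∈ Icc a b) :
    g.bil (γ s) (vel n γ (Icc a b) s) (vel n γ (Icc a b) s) = 0 := by
  by_contra hne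
  have hlt := lt_of_le_of_ne (hγ.2 s hs).1 hne
  have hev := (g.continuousOn_bil_vel (uniqueDiffOn_Icc hab) hγ.1 s hs).eventually (gt_mem_nhds hlt)
  obtain ⟨a', b', hab', -, hsub, hsub', -⟩ := exists_Icc_mem_nhdsWithin hab hs hev
  have hp : IsPiece g.timelikeCone γ a' b' := by
    refine ⟨hγ.1.mono hsub, fun r hr => ?_⟩
    rw [vel_mono hγ.1 hsub hr (uniqueDiffOn_Icc hab' r hr)]
    exact ⟨hsub' hr, (hγ.2 r (hsub hr)).2⟩
  have ha' := hsub (left_mem_Icc.2 hab'.le)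
  have hb' := hsub (right_mem_Icc.2 hab'.le)
  refine hn ?_
  have hc1 : g.Causal (γ a) (γ a') := by
    rcases ha'.1.lt_or_eq with h | h
    · exact g.causal_of_isPiece h.le (hγ.mono h (Icc_subset_Icc le_rfl ha'.2))
    · rw [← h]; exact .inl rfl
  have hc2 : g.Causal (γ b') (γ b) := by
    rcases hb'.2.lt_or_eq with h | h
    · exact g.causal_of_isPiece h.le (hγ.mono h (Icc_subset_Icc hb'.1 le_rfl))
    · rw [h]; exact .inl rfl
  exact (hc1.trans_chron (g.chron_of_isPiece hab' hp)).trans_causal hc2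

end SplitMetric

/-! ### Short chronological curves, corners, and closedness of causal pasts -/

namespace SplitMetric
variable {n : ℕ} {M : Type*} [TopologicalSpace M] [ChartedSpace (Model n) M]
  [IsManifold 𝓘(ℝ, Model n) ∞ M] (g : SplitMetric n M)

/-- Near a point of a chart, points whose difference has direction close to a given timelike vector
are chronologically related. -/
theorem exists_ball_chron {p₀ : M} {x₀ u₀ : ℝ × Model n} (hx₀ : x₀ ∈ coordDomain n p₀)
    (hneg : g.chartMetric p₀ x₀ u₀ u₀ < 0) (hpos : 0 < u₀.1) :
    ∃ r > (0 : ℝ), ∀ x ∈ Metric.ball x₀ r, ∀ u ∈ Metric.ball u₀ r, ∀ δ > (0 : ℝ),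
      x + δ • u ∈ Metric.ball x₀ r → g.Chron (coordInv p₀ x) (coordInv p₀ (x + δ • u)) := by
  have hG := (g.contDiffAt_chartMetric hx₀).continuousAt
  have h1 : ContinuousAt (fun z : (ℝ × Model n) × (ℝ × Model n) =>
      g.chartMetric p₀ z.1 z.2 z.2) (x₀, u₀) := by
    have : ContinuousAt (fun z : (ℝ × Model n) × (ℝ × Model n) => g.chartMetric p₀ z.1) (x₀, u₀) :=
      ContinuousAt.comp (g := g.chartMetric p₀) hG continuousAt_fst
    exact (this.clm_apply continuousAt_snd).clm_apply continuousAt_snd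
  have h2 : ∀ᶠ z in 𝓝 (x₀, u₀), g.chartMetric p₀ z.1 z.2 z.2 < 0 ∧ z.1 ∈ coordDomain n p₀ ∧
      0 < z.2.1 :=
    (h1.eventually (gt_mem_nhds hneg)).and
      ((continuousAt_fst.eventually ((isOpen_coordDomain p₀).mem_nhds hx₀)).and
        ((continuous_fst.comp continuous_snd).continuousAt.eventually (lt_mem_nhds hpos)))
  obtain ⟨r, hr, H⟩ := Metric.eventually_nhds_iff_ball.1 h2
  refine ⟨r, hr, fun x hx u hu δ hδ hxδ => ?_⟩
  have hseg : ∀ s ∈ Icc (0 : ℝ) 1, x + s • (δ • u) ∈ Metric.ball x₀ r := fun s hs => by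
    have := (convex_ball x₀ r).add_smul_sub_mem hx hxδ hs
    simpa using this
  have hH : ∀ s ∈ Icc (0 : ℝ) 1, (x + s • (δ • u), u) ∈ Metric.ball (x₀, u₀) r := fun s hs => by
    rw [← ball_prod_same]; exact ⟨hseg s hs, hu⟩
  refine g.chron_of_coord_line ?_ (fun s hs => (H _ (hH s hs)).2.1) (fun s hs => ?_)
  · exact mul_pos hδ (H _ (hH 0 (by simp))).2.2
  · have := (H _ (hH s hs)).1
    simp only [map_smul, smul_apply, smul_eq_mul] at this ⊢
    have := mul_pos hδ hδ
    nlinarith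

theorem bil_add_add (q : ℝ × M) (v w : ℝ × Model n) :
    g.bil q (v + w) (v + w) = g.bil q v v + 2 * g.bil q v w + g.bil q w w := by
  simp only [bil_def, Prod.fst_add, Prod.snd_add, map_add, add_apply, g.spatial_symm q w.2 v.2]
  ring

/-- The equality case of the reversed Cauchy–Schwarz inequality: future-directed lightlike vectors
whose sum is not timelike are proportional. -/
theorem smul_eq_smul_of_null {q : ℝ × M} {v w : ℝ × Model n} (hv : g.bil q v v = 0)
    (hw : g.bil q w w = 0) (hv0 : 0 < v.1) (hw0 : 0 < w.1) (h : 0 ≤ g.bil q (v + w) (v + w)) :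
    w.1 • v = v.1 • w := by
  rw [bil_add_add, hv, hw] at h
  have hz : w.1 • v.2 - v.1 • w.2 = 0 := by
    by_contra hne
    have hpos := g.spatial_pos q hne
    simp only [map_sub, map_smul, sub_apply, smul_apply, smul_eq_mul,
      g.spatial_symm q w.2 v.2] at hpos
    rw [bil_def] at hv hw h
    have := mul_pos hv0 hw0
    have e1 : g.spatial q v.2 v.2 = g.β q * (v.1 * v.1) := by linarith
    have e2 : g.spatial q w.2 w.2 = g.β q * (w.1 * w.1) := by linarith
    rw [e1, e2] at hpos
    nlinarith
  refine Prod.ext ?_ (sub_eq_zero.1 hz)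
  simp [mul_comm]

/-- The sum of the velocities at a corner of a causal path without chronological shortcut is not
timelike: otherwise a short timelike segment from before the corner to after it would cut the
corner. -/
theorem not_timelike_corner {γ₁ γ₂ : ℝ → ℝ × M} {a b a' b' : ℝ} (hab : a < b) (hab' : a' < b')
    (h₁ : IsPiece g.causalCone γ₁ a b) (h₂ : IsPiece g.causalCone γ₂ a' b')
    (hq : γ₁ b = γ₂ a') (hn : ¬ g.Chron (γ₁ a) (γ₂ b')) :
    0 ≤ g.bil (γ₁ b) (vel n γ₁ (Icc a b) b + vel n γ₂ (Icc a' b') a')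
      (vel n γ₁ (Icc a b) b + vel n γ₂ (Icc a' b') a') := by
  by_contra hlt
  rw [not_le] at hlt
  refine hn ?_
  have hb := right_mem_Icc.2 hab.le
  have ha' := left_mem_Icc.2 hab'.le
  have hsrc := mem_extChartAt_source (I := 𝓘(ℝ, Model n)) (γ₁ b).2
  have hsrc' : (γ₂ a').2 ∈ (extChartAt 𝓘(ℝ, Model n) (γ₁ b).2).source := by rw [← hq]; exact hsrc
  have hd₁ := h₁.1.hasDerivWithinAt_coordCurve hb hsrc
  have hd₂ := h₂.1.hasDerivWithinAt_coordCurve ha' hsrc'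
  set p₀ := (γ₁ b).2 with hp₀
  set c₁ := coordCurve n p₀ γ₁
  set c₂ := coordCurve n p₀ γ₂
  set v₁ := derivWithin c₁ (Icc a b) b
  set v₂ := derivWithin c₂ (Icc a' b') a'
  have hvel₁ := vel_eq (uniqueDiffOn_Icc hab b hb) (h₁.1.continuousOn b hb) hsrc hd₁
  have hvel₂ := vel_eq (uniqueDiffOn_Icc hab' a' ha') (h₂.1.continuousOn a' ha') hsrc' hd₂
  have hx : c₁ b = c₂ a' := by simp only [c₁, c₂, coordCurve, hq]
  have hneg : g.chartMetric p₀ (c₁ b) (v₁ + v₂) (v₁ + v₂) < 0 := by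
    rw [hvel₁, hvel₂, ← hq] at hlt
    have := g.bil_eq_chartMetric p₀ hsrc (v₁ + v₂) (v₁ + v₂)
    rw [Prod.fst_add, Prod.snd_add, map_add] at this
    exact lt_of_eq_of_lt this.symm hlt
  have hpos : 0 < (v₁ + v₂).1 := by
    have h1 := (h₁.2 b hb).2
    have h2 := (h₂.2 a' ha').2
    rw [hvel₁] at h1; rw [hvel₂] at h2
    exact add_pos h1 h2
  obtain ⟨r, hr, H⟩ := g.exists_ball_chron (coordCurve_mem hsrc) hneg hpos
  have t1 : Tendsto (fun δ : ℝ => b - δ) (𝓝[>] 0) (𝓝[Icc a b] b) := by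
    refine tendsto_nhdsWithin_iff.2 ⟨?_, ?_⟩
    · have : Tendsto (fun δ : ℝ => b - δ) (𝓝 0) (𝓝 (b - 0)) := tendsto_const_nhds.sub tendsto_id
      rw [sub_zero] at this; exact this.mono_left nhdsWithin_le_nhds
    · filter_upwards [Ioo_mem_nhdsGT (sub_pos.2 hab)] with δ hδ
      exact ⟨by linarith [hδ.2], by linarith [hδ.1]⟩
  have t2 : Tendsto (fun δ : ℝ => a' + δ) (𝓝[>] 0) (𝓝[Icc a' b'] a') := by
    refine tendsto_nhdsWithin_iff.2 ⟨?_, ?_⟩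
    · have : Tendsto (fun δ : ℝ => a' + δ) (𝓝 0) (𝓝 (a' + 0)) := tendsto_const_nhds.add tendsto_id
      rw [add_zero] at this; exact this.mono_left nhdsWithin_le_nhds
    · filter_upwards [Ioo_mem_nhdsGT (sub_pos.2 hab')] with δ hδ
      exact ⟨by linarith [hδ.1], by linarith [hδ.2]⟩
  have l1 : Tendsto (fun δ : ℝ => c₁ (b - δ)) (𝓝[>] 0) (𝓝 (c₁ b)) :=
    hd₁.continuousWithinAt.tendsto.comp t1
  have l2 : Tendsto (fun δ : ℝ => c₂ (a' + δ)) (𝓝[>] 0) (𝓝 (c₁ b)) := by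
    rw [hx]; exact hd₂.continuousWithinAt.tendsto.comp t2
  -- the chord across the corner is, to first order, `δ` times the sum of the velocities
  have l3 : Tendsto (fun δ : ℝ => δ⁻¹ • (c₂ (a' + δ) - c₁ (b - δ))) (𝓝[>] 0) (𝓝 (v₁ + v₂)) := by
    have hne1 : Tendsto (fun δ : ℝ => b - δ) (𝓝[>] 0) (𝓝[Icc a b \ {b}] b) := by
      refine tendsto_nhdsWithin_iff.2 ⟨t1.mono_right nhdsWithin_le_nhds, ?_⟩
      filter_upwards [tendsto_nhdsWithin_iff.1 t1 |>.2, self_mem_nhdsWithin] with δ h1 h2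
      exact ⟨h1, by simpa using (ne_of_gt h2)⟩
    have hne2 : Tendsto (fun δ : ℝ => a' + δ) (𝓝[>] 0) (𝓝[Icc a' b' \ {a'}] a') := by
      refine tendsto_nhdsWithin_iff.2 ⟨t2.mono_right nhdsWithin_le_nhds, ?_⟩
      filter_upwards [tendsto_nhdsWithin_iff.1 t2 |>.2, self_mem_nhdsWithin] with δ h1 h2
      exact ⟨h1, by simpa using (ne_of_gt h2)⟩
    have s1 := (hasDerivWithinAt_iff_tendsto_slope.1 hd₁).comp hne1
    have s2 := (hasDerivWithinAt_iff_tendsto_slope.1 hd₂).comp hne2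
    refine (s1.add s2).congr' ?_
    filter_upwards [self_mem_nhdsWithin] with δ hδ
    simp only [Function.comp, slope_def_module, hx]
    rw [show b - δ - b = -δ by ring, show a' + δ - a' = δ by ring, inv_neg, neg_smul, ← smul_neg,
      ← smul_add]
    congr 1
    abel
  have hev := (l1.eventually (Metric.ball_mem_nhds _ hr)).and
    ((l2.eventually (Metric.ball_mem_nhds _ hr)).and
    ((l3.eventually (Metric.ball_mem_nhds _ hr)).and
    (((tendsto_nhdsWithin_iff.1 t1).2.and (tendsto_nhdsWithin_iff.1 t2).2).and
    ((t1.eventually (eventually_source (h₁.1.continuousOn b hb) hsrc)).and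
    ((t2.eventually (eventually_source (h₂.1.continuousOn a' ha') hsrc')).and
    (self_mem_nhdsWithin))))))
  obtain ⟨δ, e1, e2, e3, ⟨m1, m2⟩, s1, s2, hδ⟩ := hev.exists
  have hδ : 0 < δ := hδ
  have hw : c₁ (b - δ) + δ • (δ⁻¹ • (c₂ (a' + δ) - c₁ (b - δ))) = c₂ (a' + δ) := by
    rw [smul_inv_smul₀ hδ.ne', add_sub_cancel]
  have hch := H _ e1 _ e3 δ hδ (by rw [hw]; exact e2)
  rw [hw, coordInv_coordCurve s1, coordInv_coordCurve s2] at hch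
  have k1 : g.Causal (γ₁ a) (γ₁ (b - δ)) := by
    rcases m1.1.lt_or_eq with h | h
    · exact g.causal_of_isPiece h.le (h₁.mono h (Icc_subset_Icc le_rfl m1.2))
    · rw [← h]; exact .inl rfl
  have k2 : g.Causal (γ₂ (a' + δ)) (γ₂ b') := by
    rcases m2.2.lt_or_eq with h | h
    · exact g.causal_of_isPiece h.le (h₂.mono h (Icc_subset_Icc m2.1 le_rfl))
    · rw [h]; exact .inl rfl
  exact (k1.trans_chron hch).trans_causal k2

/-- The points `q₀ ∓ ε` on the time line through `q₀` bound a chronological neighbourhood of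
`q₀`. -/
theorem eventually_chron_shift (q₀ : ℝ × M) {ε : ℝ} (hε : 0 < ε) :
    ∀ᶠ q in 𝓝 q₀, g.Chron (shift q₀ (-ε)) q ∧ g.Chron q (shift q₀ ε) := by
  have hsrc := mem_extChartAt_source (I := 𝓘(ℝ, Model n)) q₀.2
  set e := extChartAt 𝓘(ℝ, Model n) q₀.2
  set x : ℝ × M → ℝ × Model n := fun q => (q.1, e q.2)
  have hxc : ContinuousAt x q₀ :=
    continuousAt_fst.prodMk (ContinuousAt.comp (g := e) (continuousAt_extChartAt q₀.2)
      continuousAt_snd)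
  have hx₀ : x q₀ ∈ coordDomain n q₀.2 := ⟨mem_univ _, e.map_source hsrc⟩
  have hneg : g.chartMetric q₀.2 (x q₀) (1, 0) (1, 0) < 0 := by
    rw [chartMetric_time]
    have := g.β_pos (coordInv q₀.2 (x q₀))
    simpa using this
  obtain ⟨r, hr, H⟩ := g.exists_ball_chron hx₀ hneg (by simp)
  -- as `q → q₀`, the direction from `q₀ - δ` to `q`, and from `q` to `q₀ + δ`, tends to `∂_t`
  obtain ⟨δ, hδ0, hδ⟩ := exists_between (lt_min hε hr)
  have hδε := hδ.trans_le (min_le_left _ _)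
  have hδr := hδ.trans_le (min_le_right _ _)
  have hinv : ∀ q : ℝ × M, q.2 ∈ e.source → coordInv q₀.2 (x q) = q := fun q hq => by
    simp only [coordInv, chartInv, x]
    rw [e.left_inv hq]
  have hxs : ∀ t, x (shift q₀ t) = x q₀ + (t, 0) := fun t => by simp [x, shift]
  have hball : ∀ t, |t| < r → x (shift q₀ t) ∈ Metric.ball (x q₀) r := fun t ht => by
    rw [hxs, mem_ball_iff_norm]
    simpa using ht
  have hlim : ∀ σ : ℝ, Tendsto (fun q => δ⁻¹ • (σ • (x q - x q₀) + (δ, 0))) (𝓝 q₀)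
      (𝓝 ((1, 0) : ℝ × Model n)) := fun σ => by
    have : Tendsto (fun q => δ⁻¹ • (σ • (x q - x q₀) + ((δ, 0) : ℝ × Model n))) (𝓝 q₀)
        (𝓝 (δ⁻¹ • (σ • (x q₀ - x q₀) + ((δ, 0) : ℝ × Model n)))) :=
      (((hxc.tendsto.sub tendsto_const_nhds).const_smul σ).add tendsto_const_nhds).const_smul _
    simpa [hδ0.ne'] using this
  filter_upwards [hxc.eventually (Metric.ball_mem_nhds _ hr),
    (hlim 1).eventually (Metric.ball_mem_nhds _ hr),
    (hlim (-1)).eventually (Metric.ball_mem_nhds _ hr),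
    continuous_snd.continuousAt.eventually ((isOpen_extChartAt_source q₀.2).mem_nhds hsrc)]
    with q h1 h2 h3 h4
  have e1 : x (shift q₀ (-δ)) + δ • (δ⁻¹ • ((1 : ℝ) • (x q - x q₀) + (δ, 0))) = x q := by
    rw [smul_inv_smul₀ hδ0.ne', hxs, one_smul,
      show ((-δ, 0) : ℝ × Model n) = -(δ, 0) by simp]
    abel
  have e2 : x q + δ • (δ⁻¹ • ((-1 : ℝ) • (x q - x q₀) + (δ, 0))) = x (shift q₀ δ) := by
    rw [smul_inv_smul₀ hδ0.ne', hxs, neg_one_smul]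
    abel
  have c1 := H (x (shift q₀ (-δ))) (hball _ (by rwa [abs_neg, abs_of_pos hδ0])) _ h2 δ hδ0
    (by rw [e1]; exact h1)
  have c2 := H (x q) h1 _ h3 δ hδ0 (by rw [e2]; exact hball _ (by rwa [abs_of_pos hδ0]))
  rw [e1, hinv q h4, hinv (shift q₀ (-δ)) hsrc] at c1
  rw [e2, hinv q h4, hinv (shift q₀ δ) hsrc] at c2
  exact ⟨(g.chron_shift_shift q₀ (neg_lt_neg hδε)).trans c1, c2.trans (g.chron_shift_shift q₀ hδε)⟩

/-- A point in the closure of `J⁻(x)` is a limit of points of `J⁻(x)` that lie in the future of a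
slightly earlier point, hence in a compact causal diamond. -/
theorem isClosed_JMinus [T2Space M] (hg : ∀ p q, IsCompact (g.JPlus p ∩ g.JMinus q)) (x : ℝ × M) :
    IsClosed (g.JMinus x) := by
  refine isClosed_of_closure_subset fun q hq => ?_
  have hfr := (mem_closure_iff_frequently.1 hq).and_eventually (g.eventually_chron_shift q one_pos)
  have : q ∈ closure (g.JPlus (shift q (-1)) ∩ g.JMinus x) :=
    mem_closure_iff_frequently.2 (hfr.mono fun r hr => ⟨hr.2.1.causal, hr.1⟩)
  rw [(hg _ _).isClosed.closure_eq] at this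
  exact this.2

/-- The time-reversed form of `isClosed_JMinus`. -/
theorem isClosed_JPlus [T2Space M] (hg : ∀ p q, IsCompact (g.JPlus p ∩ g.JMinus q)) (x : ℝ × M) :
    IsClosed (g.JPlus x) := by
  refine isClosed_of_closure_subset fun q hq => ?_
  have hfr := (mem_closure_iff_frequently.1 hq).and_eventually (g.eventually_chron_shift q one_pos)
  have : q ∈ closure (g.JPlus x ∩ g.JMinus (shift q 1)) :=
    mem_closure_iff_frequently.2 (hfr.mono fun r hr => ⟨hr.1, hr.2.2.causal⟩)
  rw [(hg _ _).isClosed.closure_eq] at this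
  exact this.1

end SplitMetric

/-! ### Causal pieces without chronological shortcut are pregeodesics -/

section EulerLagrange
variable {E : Type*} [NormedAddCommGroup E] [NormedSpace ℝ E] {G : E → E →L[ℝ] E →L[ℝ] ℝ}

/-- The Euler–Lagrange covector of the energy `½ G(c', c')`, evaluated at `w`, for a curve with
position `x`, velocity `v` and acceleration `a`. Geodesics are the curves on which it vanishes. -/
def eulerLagrange (G : E → E →L[ℝ] E →L[ℝ] ℝ) (x v a w : E) : ℝ :=
  G x a w + fderiv ℝ G x v v w - 1 / 2 * fderiv ℝ G x w v v

theorem eulerLagrange_add (x v a w w' : E) :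
    eulerLagrange G x v a (w + w') = eulerLagrange G x v a w + eulerLagrange G x v a w' := by
  simp only [eulerLagrange, map_add, add_apply]; ring

theorem eulerLagrange_smul (x v a : E) (r : ℝ) (w : E) :
    eulerLagrange G x v a (r • w) = r * eulerLagrange G x v a w := by
  simp only [eulerLagrange, map_smul, smul_apply, smul_eq_mul]; ring

theorem eulerLagrange_neg (x v a w : E) :
    eulerLagrange G x v a (-w) = -eulerLagrange G x v a w := by
  simp only [eulerLagrange, map_neg, neg_apply]; ring

theorem ContinuousWithinAt.eulerLagrange {c v a : ℝ → E} {S : Set ℝ} {s : ℝ}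
    (hG : ContDiffAt ℝ ∞ G (c s)) (hc : ContinuousWithinAt c S s) (hv : ContinuousWithinAt v S s)
    (ha : ContinuousWithinAt a S s) (w : E) :
    ContinuousWithinAt (fun r => eulerLagrange G (c r) (v r) (a r) w) S s := by
  have hG' : ContinuousWithinAt (fun r => G (c r)) S s :=
    ContinuousAt.comp_continuousWithinAt (g := G) hG.continuousAt hc
  exact (((hG'.clm_apply ha).clm_apply continuousWithinAt_const).add
    (ContinuousWithinAt.fderiv_bilin hG hc hv hv continuousWithinAt_const)).sub
    (continuousWithinAt_const.mul
      (ContinuousWithinAt.fderiv_bilin hG hc continuousWithinAt_const hv hv))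

/-- Integration by parts in the first variation. -/
theorem hasDerivWithinAt_momentum {c v V : ℝ → E} {a V' : E} {S : Set ℝ} {s : ℝ}
    (hG : DifferentiableAt ℝ G (c s)) (hc : HasDerivWithinAt c (v s) S s)
    (hv : HasDerivWithinAt v a S s) (hV : HasDerivWithinAt V V' S s) :
    HasDerivWithinAt (fun r => G (c r) (v r) (V r))
      (firstVariation G (c s) (v s) (V s) V' + eulerLagrange G (c s) (v s) a (V s)) S s := by
  have h1 : HasDerivWithinAt (fun r => G (c r)) (fderiv ℝ G (c s) (v s)) S s :=
    HasFDerivAt.comp_hasDerivWithinAt (𝕜 := ℝ) (l := G) (l' := fderiv ℝ G (c s)) s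
      hG.hasFDerivAt hc
  refine ((h1.clm_apply hv).clm_apply hV).congr_deriv ?_
  simp only [firstVariation, eulerLagrange, add_apply]
  ring

/-- If the Euler–Lagrange covector along `c` is nowhere proportional to the momentum covector
`G(c', ·)`, then some variation field vanishing at the end points has negative first variation
throughout. Here `e` is a field on which the momentum does not vanish, and `w` detects the failure
of proportionality. -/
theorem exists_firstVariation_neg {U : Set E} (hU : IsOpen U) (hG : ContDiffOn ℝ ∞ G U)
    {c v a : ℝ → E} {l r : ℝ} (hlr : l < r) (hcU : ∀ s ∈ Icc l r, c s ∈ U)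
    (hc : ContDiffOn ℝ ∞ c (Icc l r)) (hv : ContDiffOn ℝ ∞ v (Icc l r))
    (ha : ContinuousOn a (Icc l r))
    (hcv : ∀ s ∈ Icc l r, HasDerivWithinAt c (v s) (Icc l r) s)
    (hva : ∀ s ∈ Icc l r, HasDerivWithinAt v (a s) (Icc l r) s) {e w : E}
    (he : ∀ s ∈ Icc l r, G (c s) (v s) e ≠ 0)
    (hw : ∀ s ∈ Icc l r, 0 < eulerLagrange G (c s) (v s) (a s) w -
      eulerLagrange G (c s) (v s) (a s) e / G (c s) (v s) e * G (c s) (v s) w) :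
    ∃ V V' : ℝ → E, ContDiffOn ℝ ∞ V (Icc l r) ∧ ContinuousOn V' (Icc l r) ∧
      (∀ s ∈ Icc l r, HasDerivWithinAt V (V' s) (Icc l r) s) ∧ V l = 0 ∧ V r = 0 ∧
      ∀ s ∈ Icc l r, firstVariation G (c s) (v s) (V s) (V' s) < 0 := by
  have hS := uniqueDiffOn_Icc hlr
  have hGat : ∀ s ∈ Icc l r, ContDiffAt ℝ ∞ G (c s) := fun s hs =>
    hG.contDiffAt (hU.mem_nhds (hcU s hs))
  have hp : ∀ y : E, ContDiffOn ℝ ∞ (fun s => G (c s) (v s) y) (Icc l r) := fun y s hs =>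
    ContDiffWithinAt.bilin (hGat s hs) (hc s hs) (hv s hs) contDiffWithinAt_const
  have hEL : ∀ y : E, ContinuousOn (fun s => eulerLagrange G (c s) (v s) (a s) y) (Icc l r) :=
    fun y s hs => ContinuousWithinAt.eulerLagrange (hGat s hs) (hc s hs).continuousWithinAt
      (hv s hs).continuousWithinAt (ha s hs) y
  have hlam : ContinuousOn (fun s => eulerLagrange G (c s) (v s) (a s) e / G (c s) (v s) e)
      (Icc l r) := (hEL e).div (hp e).continuousOn he
  obtain ⟨Λ, hΛ⟩ := isCompact_Icc.exists_bound_of_continuousOn hlam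
  have hD : ContinuousOn (fun s => eulerLagrange G (c s) (v s) (a s) w -
      eulerLagrange G (c s) (v s) (a s) e / G (c s) (v s) e * G (c s) (v s) w) (Icc l r) :=
    (hEL w).sub (hlam.mul (hp w).continuousOn)
  obtain ⟨s₁, hs₁, hmin⟩ := isCompact_Icc.exists_isMinOn (nonempty_Icc.2 hlr.le) hD
  set κ := eulerLagrange G (c s₁) (v s₁) (a s₁) w -
      eulerLagrange G (c s₁) (v s₁) (a s₁) e / G (c s₁) (v s₁) e * G (c s₁) (v s₁) w with hκ
  have hκ0 : 0 < κ := hw s₁ hs₁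
  set m := (l + r) / 2 with hm
  set δ := (r - l) / 2 with hδ
  have hδ0 : 0 < δ := by rw [hδ]; linarith
  have hΛ0 : 0 ≤ Λ := (norm_nonneg _).trans (hΛ s₁ hs₁)
  set K := (2 + Λ * δ) / κ with hK
  have hK0 : 0 < K := by positivity
  have hKκ : K * κ = 2 + Λ * δ := by rw [hK]; field_simp
  -- `u` is the prescribed value of the momentum on the field; it decreases at both end points, and
  -- where it increases the term with `bump` in the direction `w` compensates.
  let u : ℝ → ℝ := fun s => (s - m) * (δ ^ 2 - (s - m) ^ 2)
  let bump : ℝ → ℝ := fun s => K * (δ ^ 2 - (s - m) ^ 2)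
  let V : ℝ → E := fun s => bump s • w + ((u s - bump s * G (c s) (v s) w) / G (c s) (v s) e) • e
  have hu : ContDiff ℝ ∞ u := by fun_prop
  have hω : ContDiff ℝ ∞ bump := by fun_prop
  have hV : ContDiffOn ℝ ∞ V (Icc l r) :=
    (hω.contDiffOn.smul contDiffOn_const).add
      (((hu.contDiffOn.sub (hω.contDiffOn.mul (hp w))).div (hp e) he).smul contDiffOn_const)
  have hVd : ∀ s ∈ Icc l r, HasDerivWithinAt V (derivWithin V (Icc l r) s) (Icc l r) s :=
    fun s hs => (hV.differentiableOn (by simp) s hs).hasDerivWithinAt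
  refine ⟨V, derivWithin V (Icc l r), hV, hV.continuousOn_derivWithin hS (by simp), hVd, ?_, ?_, ?_⟩
  · have h1 : δ ^ 2 - (l - m) ^ 2 = 0 := by rw [hδ, hm]; ring
    simp only [V, u, bump, h1]; simp
  · have h1 : δ ^ 2 - (r - m) ^ 2 = 0 := by rw [hδ, hm]; ring
    simp only [V, u, bump, h1]; simp
  intro s hs
  have hpV : ∀ x ∈ Icc l r, G (c x) (v x) (V x) = u x := fun x hx => by
    simp only [V, map_add, map_smul, smul_eq_mul]
    field_simp [he x hx]
    ring
  have hd1 := hasDerivWithinAt_momentum ((hGat s hs).differentiableAt (by simp)) (hcv s hs)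
    (hva s hs) (hVd s hs)
  have hd2 : HasDerivWithinAt u (δ ^ 2 - 3 * (s - m) ^ 2) (Icc l r) s := by
    have h1 : HasDerivAt (fun s => s - m) 1 s := (hasDerivAt_id s).sub_const m
    have h2 := (h1.mul ((h1.pow 2).const_sub (δ ^ 2)))
    refine (h2.congr_deriv ?_).hasDerivWithinAt
    simp; ring
  have hd3 := hd1.congr (fun x hx => (hpV x hx).symm) (hpV s hs).symm
  have heq := (hS s hs).eq_deriv _ hd3 hd2
  have hEV : eulerLagrange G (c s) (v s) (a s) (V s) =
      u s * (eulerLagrange G (c s) (v s) (a s) e / G (c s) (v s) e) +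
      bump s * (eulerLagrange G (c s) (v s) (a s) w -
        eulerLagrange G (c s) (v s) (a s) e / G (c s) (v s) e * G (c s) (v s) w) := by
    simp only [V, eulerLagrange_add, eulerLagrange_smul]
    ring
  have hκs : κ ≤ eulerLagrange G (c s) (v s) (a s) w -
      eulerLagrange G (c s) (v s) (a s) e / G (c s) (v s) e * G (c s) (v s) w := hmin hs
  have hΛs := hΛ s hs
  rw [Real.norm_eq_abs] at hΛs
  set lam := eulerLagrange G (c s) (v s) (a s) e / G (c s) (v s) e
  set D := eulerLagrange G (c s) (v s) (a s) w - lam * G (c s) (v s) w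
  have hx : |s - m| ≤ δ := by
    rw [abs_le, hδ, hm]; constructor <;> linarith [hs.1, hs.2]
  have hb : 0 ≤ δ ^ 2 - (s - m) ^ 2 := by
    have := sq_abs (s - m)
    nlinarith [abs_nonneg (s - m)]
  have h1 : -((s - m) * lam) ≤ δ * Λ := by
    calc -((s - m) * lam) ≤ |(s - m) * lam| := neg_le_abs _
      _ = |s - m| * |lam| := abs_mul _ _
      _ ≤ δ * Λ := by gcongr
  have h2 : K * κ ≤ K * D := by gcongr
  have h3 : 2 ≤ (s - m) * lam + K * D := by linarith [mul_comm Λ δ]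
  have h4 := mul_le_mul_of_nonneg_left h3 hb
  have h5 : eulerLagrange G (c s) (v s) (a s) (V s) =
      (δ ^ 2 - (s - m) ^ 2) * ((s - m) * lam + K * D) := by
    rw [hEV]; simp only [u, bump]; ring
  have h6 : 0 < δ ^ 2 := by positivity
  nlinarith [sq_nonneg (s - m)]

end EulerLagrange

namespace SplitMetric
variable {n : ℕ} {M : Type*} [TopologicalSpace M] [ChartedSpace (Model n) M]
  [IsManifold 𝓘(ℝ, Model n) ∞ M] (g : SplitMetric n M)

/-- A causal piece admitting a variation with fixed end points and negative first variation can be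
deformed to a timelike one. -/
theorem chron_of_firstVariation_neg {p₀ : M} {γ : ℝ → ℝ × M} {a b : ℝ} (hab : a < b)
    (hγ : IsPiece g.causalCone γ a b)
    (hsrc : ∀ s ∈ Icc a b, (γ s).2 ∈ (extChartAt 𝓘(ℝ, Model n) p₀).source)
    {c' V V' : ℝ → ℝ × Model n} (hc' : ContinuousOn c' (Icc a b))
    (hcd : ∀ s ∈ Icc a b, HasDerivWithinAt (coordCurve n p₀ γ) (c' s) (Icc a b) s)
    (hV : ContDiffOn ℝ ∞ V (Icc a b)) (hV' : ContinuousOn V' (Icc a b))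
    (hVd : ∀ s ∈ Icc a b, HasDerivWithinAt V (V' s) (Icc a b) s) (hVa : V a = 0) (hVb : V b = 0)
    (hneg : ∀ s ∈ Icc a b, firstVariation (g.chartMetric p₀) (coordCurve n p₀ γ s) (c' s) (V s)
      (V' s) < 0) : g.Chron (γ a) (γ b) := by
  have hS := uniqueDiffOn_Icc hab
  have hcone : ∀ s ∈ Icc a b, g.chartMetric p₀ (coordCurve n p₀ γ s) (c' s) (c' s) ≤ 0 ∧
      0 < (c' s).1 := fun s hs =>
    (g.causalCone_vel_iff (hS s hs) (hγ.1.continuousOn s hs) (hsrc s hs) (hcd s hs)).1 (hγ.2 s hs)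
  obtain ⟨ε₀, hε₀, H⟩ := exists_pos_of_local_on_compact isCompact_Icc (fun s₀ hs₀ =>
    exists_variation_neg (isOpen_coordDomain p₀) (g.contDiffOn_chartMetric p₀)
      (g.chartMetric_symm p₀) (ContinuousLinearMap.fst ℝ ℝ (Model n))
      (coordCurve_mem (hsrc s₀ hs₀)) (hcd s₀ hs₀).continuousWithinAt (hc' s₀ hs₀)
      (hVd s₀ hs₀).continuousWithinAt (hV' s₀ hs₀) (hcone s₀ hs₀).2 (.inr (hneg s₀ hs₀)))
  obtain ⟨ε, hε0, hε⟩ := exists_between hε₀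
  have H' := fun s hs => H s hs ε ⟨hε0, hε⟩ (hcone s hs).1
  set d : ℝ → ℝ × Model n := fun s => coordCurve n p₀ γ s + ε • V s with hd
  have hsm : SmoothCurveOn n (fun s => coordInv p₀ (d s)) (Icc a b) :=
    smoothCurveOn_coordInv ((hγ.1.contDiffOn_coordCurve hsrc).add (hV.const_smul ε))
      fun s hs => (H' s hs).1
  have hp : IsPiece g.timelikeCone (fun s => coordInv p₀ (d s)) a b := by
    refine ⟨hsm, fun s hs => ?_⟩
    have hdd : HasDerivWithinAt d (c' s + ε • V' s) (Icc a b) s :=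
      (hcd s hs).add ((hVd s hs).const_smul ε)
    rw [g.timelikeCone_vel_iff (hS s hs) (hsm.continuousOn s hs)
      (coordInv_source (H' s hs).1) (hdd.congr (fun r hr => coordCurve_coordInv (H' r hr).1)
        (coordCurve_coordInv (H' s hs).1)), coordCurve_coordInv (H' s hs).1]
    exact (H' s hs).2
  have := g.chron_of_isPiece hab hp
  simp only [hd, hVa, hVb, smul_zero, add_zero] at this
  rwa [coordInv_coordCurve (hsrc a (left_mem_Icc.2 hab.le)),
    coordInv_coordCurve (hsrc b (right_mem_Icc.2 hab.le))] at this

/-- Push-up passes the absence of a chronological relation on to subintervals. -/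
theorem not_chron_mono {γ : ℝ → ℝ × M} {a b a' b' : ℝ}
    (hγ : IsPiece g.causalCone γ a b) (hn : ¬ g.Chron (γ a) (γ b)) (ha : a ≤ a') (hab' : a' ≤ b')
    (hb : b' ≤ b) : ¬ g.Chron (γ a') (γ b') := fun h => by
  have hc : ∀ x y, a ≤ x → x ≤ y → y ≤ b → g.Causal (γ x) (γ y) := fun x y hx hxy hy => by
    rcases hxy.lt_or_eq with h | rfl
    · exact g.causal_of_isPiece h.le (hγ.mono h (Icc_subset_Icc hx hy))
    · exact .inl rfl
  exact hn (((hc a a' le_rfl ha (hab'.trans hb)).trans_chron h).trans_causal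
    (hc b' b (ha.trans hab') hb le_rfl))

/-- The momentum `-g(γ', ∂_t)` of a curve. -/
def timeMomentum (γ : ℝ → ℝ × M) (S : Set ℝ) (s : ℝ) : ℝ := g.β (γ s) * (vel n γ S s).1

theorem timeMomentum_eq {p₀ : M} {γ : ℝ → ℝ × M} {S : Set ℝ} {s : ℝ} {v : ℝ × Model n}
    (hu : UniqueDiffWithinAt ℝ S s) (hc : ContinuousWithinAt γ S s)
    (hsrc : (γ s).2 ∈ (extChartAt 𝓘(ℝ, Model n) p₀).source)
    (hd : HasDerivWithinAt (coordCurve n p₀ γ) v S s) :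
    g.timeMomentum γ S s = -g.chartMetric p₀ (coordCurve n p₀ γ s) v (1, 0) := by
  rw [timeMomentum, vel_eq hu hc hsrc hd, chartMetric_time, coordInv_coordCurve hsrc]
  simp

/-- A causal piece whose end points are not chronologically related satisfies the geodesic equation
up to a reparametrization; the factor is expressed by quantities independent of the chart. -/
theorem eulerLagrange_eq_of_not_chron {p₀ : M} {γ : ℝ → ℝ × M} {a b : ℝ} (hab : a < b)
    (hγ : IsPiece g.causalCone γ a b) (hn : ¬ g.Chron (γ a) (γ b)) {s : ℝ} (hs : s ∈ Icc a b)
    (hsrc : (γ s).2 ∈ (extChartAt 𝓘(ℝ, Model n) p₀).source) (w : ℝ × Model n) :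
    eulerLagrange (g.chartMetric p₀) (coordCurve n p₀ γ s)
      (derivWithin (coordCurve n p₀ γ) (Icc a b) s)
      (derivWithin (derivWithin (coordCurve n p₀ γ) (Icc a b)) (Icc a b) s) w =
    (derivWithin (g.timeMomentum γ (Icc a b)) (Icc a b) s +
        1 / 2 * g.timeDeriv (γ s) (vel n γ (Icc a b) s)) / g.timeMomentum γ (Icc a b) s *
      g.chartMetric p₀ (coordCurve n p₀ γ s) (derivWithin (coordCurve n p₀ γ) (Icc a b) s) w := by
  have hS := uniqueDiffOn_Icc hab
  set c := coordCurve n p₀ γ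
  set v := derivWithin c (Icc a b)
  set A := derivWithin v (Icc a b)
  set S := Icc a b
  have hGat : ∀ r, (γ r).2 ∈ (extChartAt 𝓘(ℝ, Model n) p₀).source →
      ContDiffAt ℝ ∞ (g.chartMetric p₀) (c r) := fun r hr =>
    g.contDiffAt_chartMetric (coordCurve_mem hr)
  have hc : ∀ r ∈ S, (γ r).2 ∈ (extChartAt 𝓘(ℝ, Model n) p₀).source →
      ContDiffWithinAt ℝ ∞ c S r := fun r hr h => hγ.1.contDiffWithinAt_coordCurve hr h
  have hv : ∀ r ∈ S, (γ r).2 ∈ (extChartAt 𝓘(ℝ, Model n) p₀).source →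
      ContDiffWithinAt ℝ ∞ v S r := fun r hr h => (hc r hr h).derivWithin_infty hS hr
  have hA : ∀ r ∈ S, (γ r).2 ∈ (extChartAt 𝓘(ℝ, Model n) p₀).source →
      ContDiffWithinAt ℝ ∞ A S r := fun r hr h => (hv r hr h).derivWithin_infty hS hr
  have hcv : ∀ r ∈ S, (γ r).2 ∈ (extChartAt 𝓘(ℝ, Model n) p₀).source →
      HasDerivWithinAt c (v r) S r := fun r hr h =>
    ((hc r hr h).differentiableWithinAt (by simp)).hasDerivWithinAt
  have hvA : ∀ r ∈ S, (γ r).2 ∈ (extChartAt 𝓘(ℝ, Model n) p₀).source →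
      HasDerivWithinAt v (A r) S r := fun r hr h =>
    ((hv r hr h).differentiableWithinAt (by simp)).hasDerivWithinAt
  have hP : ∀ r ∈ S, (γ r).2 ∈ (extChartAt 𝓘(ℝ, Model n) p₀).source →
      g.chartMetric p₀ (c r) (v r) (1, 0) = -g.timeMomentum γ S r := fun r hr h => by
    rw [g.timeMomentum_eq (hS r hr) (hγ.1.continuousOn r hr) h (hcv r hr h), neg_neg]
  have hP0 : ∀ r ∈ S, 0 < g.timeMomentum γ S r := fun r hr =>
    mul_pos (g.β_pos _) (hγ.2 r hr).2
  have hev := eventually_source (n := n) (hγ.1.continuousOn s hs) hsrc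
  -- the value of the Euler-Lagrange covector on `∂_t`
  have hEL0 : eulerLagrange (g.chartMetric p₀) (c s) (v s) (A s) (1, 0) =
      -(derivWithin (g.timeMomentum γ S) S s + 1 / 2 * g.timeDeriv (γ s) (vel n γ S s)) := by
    have h1 := hasDerivWithinAt_momentum ((hGat s hsrc).differentiableAt (by simp))
      (hcv s hs hsrc) (hvA s hs hsrc) (hasDerivWithinAt_const s S ((1, 0) : ℝ × Model n))
    have h2 : HasDerivWithinAt (g.timeMomentum γ S) (-(firstVariation (g.chartMetric p₀) (c s) (v s)
        (1, 0) 0 + eulerLagrange (g.chartMetric p₀) (c s) (v s) (A s) (1, 0))) S s := by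
      refine h1.neg.congr_of_eventuallyEq_of_mem ?_ hs
      filter_upwards [hev, self_mem_nhdsWithin] with r hr hrS
      rw [Pi.neg_apply, hP r hrS hr, neg_neg]
    have h3 := g.firstVariation_time hsrc (v s) 1 0
    rw [h2.derivWithin (hS s hs),
      vel_eq (hS s hs) (hγ.1.continuousOn s hs) hsrc (hcv s hs hsrc)]
    have h4 : firstVariation (g.chartMetric p₀) (c s) (v s) (1, 0) 0 =
      1 / 2 * g.timeDeriv (γ s) ((v s).1,
        chartInvDeriv p₀ (extChartAt 𝓘(ℝ, Model n) p₀ (γ s).2) (v s).2) := by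
      have e : ((0, 0) : ℝ × Model n) = 0 := rfl
      rw [e, mul_zero, sub_zero, mul_one] at h3
      exact h3
    rw [h4]; ring
  by_contra hne
  set X := g.chartMetric p₀
  -- otherwise some direction makes the first variation negative
  obtain ⟨y, hy⟩ : ∃ y, 0 < eulerLagrange X (c s) (v s) (A s) y -
      eulerLagrange X (c s) (v s) (A s) (1, 0) / X (c s) (v s) (1, 0) * X (c s) (v s) y := by
    have h1 : eulerLagrange X (c s) (v s) (A s) (1, 0) / X (c s) (v s) (1, 0) =
        (derivWithin (g.timeMomentum γ S) S s +
          1 / 2 * g.timeDeriv (γ s) (vel n γ S s)) / g.timeMomentum γ S s := by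
      rw [hEL0, hP s hs hsrc, neg_div_neg_eq]
    rw [h1]
    rcases lt_or_gt_of_ne hne with h | h
    · refine ⟨-w, ?_⟩
      rw [eulerLagrange_neg, map_neg]; linarith
    · exact ⟨w, by linarith⟩
  have hXc : ContinuousWithinAt (fun r => X (c r) (v r) (1, 0)) S s :=
    (ContDiffWithinAt.bilin (hGat s hsrc) (hc s hs hsrc) (hv s hs hsrc)
      contDiffWithinAt_const).continuousWithinAt
  have hXy : ContinuousWithinAt (fun r => X (c r) (v r) y) S s :=
    (ContDiffWithinAt.bilin (hGat s hsrc) (hc s hs hsrc) (hv s hs hsrc)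
      contDiffWithinAt_const).continuousWithinAt
  have hELc : ∀ z, ContinuousWithinAt (fun r => eulerLagrange X (c r) (v r) (A r) z) S s :=
    ContinuousWithinAt.eulerLagrange (hGat s hsrc) (hc s hs hsrc).continuousWithinAt
      (hv s hs hsrc).continuousWithinAt (hA s hs hsrc).continuousWithinAt
  have hX0 : X (c s) (v s) (1, 0) ≠ 0 := by
    rw [hP s hs hsrc]; exact (neg_lt_zero.2 (hP0 s hs)).ne
  have hyev := ((hELc y).sub (((hELc (1, 0)).div hXc hX0).mul hXy)).eventually (lt_mem_nhds hy)
  obtain ⟨a', b', hab', -, hsub, hsub', -⟩ :=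
    exists_Icc_mem_nhdsWithin hab hs (hev.and hyev)
  have hs' : ∀ r ∈ Icc a' b', (γ r).2 ∈ (extChartAt 𝓘(ℝ, Model n) p₀).source :=
    fun r hr => (hsub' hr).1
  have hvc : ContinuousOn v (Icc a' b') := fun r hr =>
    (hv r (hsub hr) (hs' r hr)).continuousWithinAt.mono hsub
  obtain ⟨V, V', hV, hV', hVd, hVa, hVb, hneg⟩ := exists_firstVariation_neg
    (isOpen_coordDomain p₀) (g.contDiffOn_chartMetric p₀) hab'
    (fun r hr => coordCurve_mem (hs' r hr))
    (fun r hr => (hc r (hsub hr) (hs' r hr)).mono hsub)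
    (fun r hr => (hv r (hsub hr) (hs' r hr)).mono hsub)
    (fun r hr => (hA r (hsub hr) (hs' r hr)).continuousWithinAt.mono hsub)
    (fun r hr => (hcv r (hsub hr) (hs' r hr)).mono hsub)
    (fun r hr => (hvA r (hsub hr) (hs' r hr)).mono hsub)
    (e := (1, 0)) (w := y)
    (fun r hr => by
      have := hP r (hsub hr) (hs' r hr)
      change X (c r) (v r) (1, 0) ≠ 0
      rw [this]; exact (neg_lt_zero.2 (hP0 r (hsub hr))).ne)
    (fun r hr => (hsub' hr).2)
  refine g.not_chron_mono hγ hn (hsub (left_mem_Icc.2 hab'.le)).1 hab'.le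
    (hsub (right_mem_Icc.2 hab'.le)).2 ?_
  exact g.chron_of_firstVariation_neg hab' (hγ.mono hab' hsub) hs' hvc
    (fun r hr => (hcv r (hsub hr) (hs' r hr)).mono hsub) hV hV' hVd hVa hVb hneg

end SplitMetric

/-! ### The geodesic spray and changes of charts -/

section Spray
variable {E : Type*} [NormedAddCommGroup E] [NormedSpace ℝ E] {G : E → E →L[ℝ] E →L[ℝ] ℝ}

theorem eulerLagrange_smul_smul (x v a w : E) (κ : ℝ) :
    eulerLagrange G x (κ • v) (κ ^ 2 • a) w = κ ^ 2 * eulerLagrange G x v a w := by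
  simp only [eulerLagrange, map_smul, smul_apply, smul_eq_mul]; ring

/-- The quadratic part in the velocity of the Euler–Lagrange covector. -/
def christoffel (G : E → E →L[ℝ] E →L[ℝ] ℝ) (x v : E) : E →L[ℝ] ℝ :=
  fderiv ℝ G x v v -
    (1 / 2 : ℝ) • ContinuousLinearMap.flip (ContinuousLinearMap.flip (fderiv ℝ G x) v) v

theorem eulerLagrange_eq_christoffel (x v a w : E) :
    eulerLagrange G x v a w = (G x a + christoffel G x v) w := by
  simp [eulerLagrange, christoffel]; ring

/-- The geodesic spray: the acceleration of the geodesic through `x` with velocity `v`. -/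
def spray (G : E → E →L[ℝ] E →L[ℝ] ℝ) (x v : E) : E :=
  -(G x).inverse (christoffel G x v)

theorem eulerLagrange_spray {x : E} (h : (G x).IsInvertible) (v a w : E) :
    eulerLagrange G x v a w = G x (a - spray G x v) w := by
  rw [eulerLagrange_eq_christoffel, spray, sub_neg_eq_add, map_add, h.self_apply_inverse]

theorem eulerLagrange_eq_zero_iff {x : E} (h : (G x).IsInvertible) (v a : E) :
    (∀ w, eulerLagrange G x v a w = 0) ↔ a = spray G x v := by
  simp only [eulerLagrange_spray h]
  constructor
  · intro h0
    have h1 : G x (a - spray G x v) = G x 0 := by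
      rw [map_zero]; ext w; simpa using h0 w
    exact sub_eq_zero.1 (h.injective h1)
  · rintro rfl w; simp

theorem contDiffAt_spray [CompleteSpace E] {x : E} (h : (G x).IsInvertible)
    (hG : ContDiffAt ℝ ∞ G x) (v : E) :
    ContDiffAt ℝ ∞ (fun z : E × E => spray G z.1 z.2) (x, v) := by
  have h1 : ContDiffAt ℝ ∞ (fun z : E × E => G z.1) (x, v) :=
    ContDiffAt.comp (x, v) (g := G) hG contDiffAt_fst
  have h2 : ContDiffAt ℝ ∞ (fun z : E × E => fderiv ℝ G z.1) (x, v) :=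
    ContDiffAt.comp (x, v) (g := fderiv ℝ G) (hG.fderiv_right (by simp)) contDiffAt_fst
  have hv : ContDiffAt ℝ ∞ (fun z : E × E => z.2) (x, v) := contDiffAt_snd
  have h3 : ContDiffAt ℝ ∞ (fun z : E × E => ContinuousLinearMap.flip (fderiv ℝ G z.1) z.2)
      (x, v) :=
    (((ContinuousLinearMap.flipₗᵢ ℝ E E (E →L[ℝ] ℝ)).contDiff.contDiffAt).comp (x, v) h2).clm_apply
      hv
  have h4 : ContDiffAt ℝ ∞ (fun z : E × E => ContinuousLinearMap.flip
      (ContinuousLinearMap.flip (fderiv ℝ G z.1) z.2) z.2) (x, v) :=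
    (((ContinuousLinearMap.flipₗᵢ ℝ E E ℝ).contDiff.contDiffAt).comp (x, v) h3).clm_apply hv
  have h5 : ContDiffAt ℝ ∞ (fun z : E × E => christoffel G z.1 z.2) (x, v) :=
    ((h2.clm_apply hv).clm_apply hv).sub (h4.const_smul (1 / 2 : ℝ))
  exact ((ContDiffAt.comp (x, v) (f := fun z : E × E => G z.1)
    (ContinuousLinearMap.IsInvertible.contDiffAt_map_inverse h) h1).clm_apply h5).neg

/-- In finite dimension a nondegenerate bilinear form identifies the space with its dual. -/
theorem isInvertible_of_injective [FiniteDimensional ℝ E] {B : E →L[ℝ] E →L[ℝ] ℝ}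
    (h : Function.Injective B) : B.IsInvertible := by
  have hd : Module.finrank ℝ E = Module.finrank ℝ (E →L[ℝ] ℝ) := by
    rw [← (LinearMap.toContinuousLinearMap (𝕜 := ℝ) (E := E) (F' := ℝ)).finrank_eq]
    exact Subspace.dual_finrank_eq.symm
  refine ⟨(LinearEquiv.ofInjectiveOfFinrankEq B.toLinearMap h hd).toContinuousLinearEquiv, ?_⟩
  ext x w
  rfl

/-- Invariance of the Euler–Lagrange covector under a change of coordinates `φ`. -/
theorem eulerLagrange_pullback {F : Type*} [NormedAddCommGroup F] [NormedSpace ℝ F]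
    {G' : F → F →L[ℝ] F →L[ℝ] ℝ} {φ : E → F} {x : E} (hφ : ContDiffAt ℝ ∞ φ x)
    (hG' : DifferentiableAt ℝ G' (φ x)) (hG : DifferentiableAt ℝ G x)
    (hsymm : ∀ u w, G' (φ x) u w = G' (φ x) w u)
    (h : ∀ᶠ y in 𝓝 x, ∀ u w, G y u w = G' (φ y) (fderiv ℝ φ y u) (fderiv ℝ φ y w)) (v a w : E) :
    eulerLagrange G x v a w = eulerLagrange G' (φ x) (fderiv ℝ φ x v)
      (fderiv ℝ (fderiv ℝ φ) x v v + fderiv ℝ φ x a) (fderiv ℝ φ x w) := by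
  have hφ1 : HasFDerivAt φ (fderiv ℝ φ x) x := (hφ.differentiableAt (by simp)).hasFDerivAt
  have hφ2 : HasFDerivAt (fderiv ℝ φ) (fderiv ℝ (fderiv ℝ φ) x) x :=
    ((hφ.fderiv_right (m := ∞) (by simp)).differentiableAt (by simp)).hasFDerivAt
  have hsym2 : IsSymmSndFDerivAt ℝ φ x := hφ.isSymmSndFDerivAt (by simp [ENat.LEInfty.out])
  have key : ∀ z u y, fderiv ℝ G x z u y =
      fderiv ℝ G' (φ x) (fderiv ℝ φ x z) (fderiv ℝ φ x u) (fderiv ℝ φ x y) +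
      G' (φ x) (fderiv ℝ (fderiv ℝ φ) x z u) (fderiv ℝ φ x y) +
      G' (φ x) (fderiv ℝ φ x u) (fderiv ℝ (fderiv ℝ φ) x z y) := by
    intro z u y
    have h1 : HasFDerivAt (fun y' => G' (φ y')) ((fderiv ℝ G' (φ x)).comp (fderiv ℝ φ x)) x :=
      HasFDerivAt.comp (g := G') (g' := fderiv ℝ G' (φ x)) x hG'.hasFDerivAt hφ1
    have h2 := (h1.clm_apply (hφ2.clm_apply (hasFDerivAt_const u x))).clm_apply
      (hφ2.clm_apply (hasFDerivAt_const y x))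
    have h3 := (hG.hasFDerivAt.clm_apply (hasFDerivAt_const u x)).clm_apply (hasFDerivAt_const y x)
    have h4 := h3.unique (h2.congr_of_eventuallyEq (h.mono fun y' hy' => hy' u y))
    have h5 := congrArg (fun L => L z) h4
    simpa [add_comm, add_left_comm, add_assoc] using h5
  simp only [eulerLagrange, key, h.self_of_nhds a w, map_add, add_apply, hsym2 w v]
  rw [hsymm (fderiv ℝ (fderiv ℝ φ) x v w)]
  ring

end Spray

namespace SplitMetric
variable {n : ℕ} {M : Type*} [TopologicalSpace M] [ChartedSpace (Model n) M]
  [IsManifold 𝓘(ℝ, Model n) ∞ M] (g : SplitMetric n M)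

theorem isInvertible_chartInvDeriv {p₀ : M} {y : Model n}
    (hy : y ∈ (extChartAt 𝓘(ℝ, Model n) p₀).target) : (chartInvDeriv p₀ y).IsInvertible := by
  have : IsManifold 𝓘(ℝ, Model n) 1 M := IsManifold.of_le (n := ∞) (by simp)
  have := isInvertible_mfderivWithin_extChartAt_symm (I := 𝓘(ℝ, Model n)) hy
  rwa [modelWithCornersSelf_coe, range_id, mfderivWithin_univ] at this

/-- Nondegeneracy: the form `g(v, ·)` is tested on the reflection `(-v₁, v₂)` of `v`, where its
value is `β v₁² + h(v₂, v₂)`. -/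
theorem isInvertible_chartMetric {p₀ : M} {x : ℝ × Model n} (hx : x ∈ coordDomain n p₀) :
    (g.chartMetric p₀ x).IsInvertible := by
  refine isInvertible_of_injective ((injective_iff_map_eq_zero _).2 fun v hv => ?_)
  have h : ∀ w, g.chartMetric p₀ x v w = 0 := fun w => by rw [hv]; rfl
  have h1 := h (-v.1, v.2)
  rw [chartMetric_apply, coordForm_eq, bil_def] at h1
  simp only at h1
  have hβ := g.β_pos (x.1, chartInv p₀ x.2)
  have hv2 : v.2 = 0 := by
    by_contra hne
    have hne' : chartInvDeriv p₀ x.2 v.2 ≠ 0 := fun h0 =>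
      hne ((isInvertible_chartInvDeriv hx.2).injective (h0.trans (map_zero _).symm))
    have := g.spatial_pos (x.1, chartInv p₀ x.2) hne'
    nlinarith [mul_nonneg hβ.le (mul_self_nonneg v.1)]
  rw [hv2] at h1
  simp only [map_zero, add_zero] at h1
  have hv1 : v.1 = 0 := by
    have h2 : g.β (x.1, chartInv p₀ x.2) * (v.1 * v.1) = 0 := by linarith
    exact mul_self_eq_zero.1 ((mul_eq_zero.1 h2).resolve_left hβ.ne')
  exact Prod.ext hv1 hv2

end SplitMetric

section ChartChange
variable {n : ℕ} {M : Type*} [TopologicalSpace M] [ChartedSpace (Model n) M]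

/-- The change of coordinates on `ℝ × M` from the preferred chart at `p₀` to the one at `p₁`. -/
def chartChange (p₀ p₁ : M) (x : ℝ × Model n) : ℝ × Model n :=
  (x.1, extChartAt 𝓘(ℝ, Model n) p₁ (chartInv p₀ x.2))

theorem chartChange_coordCurve {p₀ p₁ : M} {γ : ℝ → ℝ × M} {s : ℝ}
    (h : (γ s).2 ∈ (extChartAt 𝓘(ℝ, Model n) p₀).source) :
    chartChange p₀ p₁ (SplitMetric.coordCurve n p₀ γ s) = SplitMetric.coordCurve n p₁ γ s := by
  simp only [chartChange, SplitMetric.coordCurve, chartInv,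
    (extChartAt 𝓘(ℝ, Model n) p₀).left_inv h]

/-- The set of coordinates, in the chart at `p₀`, of points that lie in both charts. -/
def overlapDomain (n : ℕ) {M : Type*} [TopologicalSpace M] [ChartedSpace (Model n) M] (p₀ p₁ : M) :
    Set (ℝ × Model n) :=
  coordDomain n p₀ ∩ {x | chartInv p₀ x.2 ∈ (extChartAt 𝓘(ℝ, Model n) p₁).source}

theorem mem_nhds_overlapDomain {p₀ p₁ : M} {x : ℝ × Model n} (hx : x ∈ overlapDomain n p₀ p₁) :
    overlapDomain n p₀ p₁ ∈ 𝓝 x := by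
  have h1 : ContinuousAt (fun x : ℝ × Model n => chartInv p₀ x.2) x :=
    ((continuousOn_extChartAt_symm p₀).continuousAt
      ((isOpen_extChartAt_target p₀).mem_nhds hx.1.2)).comp continuousAt_snd
  exact inter_mem ((isOpen_coordDomain p₀).mem_nhds hx.1)
    (h1.preimage_mem_nhds ((isOpen_extChartAt_source p₁).mem_nhds hx.2))

variable [IsManifold 𝓘(ℝ, Model n) ∞ M]

theorem contDiffAt_chartChange {p₀ p₁ : M} {x : ℝ × Model n} (hx : x ∈ overlapDomain n p₀ p₁) :
    ContDiffAt ℝ ∞ (chartChange p₀ p₁) x := by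
  refine contDiffAt_fst.prodMk ?_
  have h1 : ContMDiffAt 𝓘(ℝ, Model n) 𝓘(ℝ, Model n) ∞ (extChartAt 𝓘(ℝ, Model n) p₁)
      (chartInv p₀ x.2) := contMDiffAt_extChartAt' (by simpa using hx.2)
  have h2 : ContMDiffAt 𝓘(ℝ, Model n) 𝓘(ℝ, Model n) ∞ (chartInv (n := n) p₀) x.2 :=
    (contMDiffOn_extChartAt_symm (I := 𝓘(ℝ, Model n)) (n := ∞) p₀).contMDiffAt
      ((isOpen_extChartAt_target p₀).mem_nhds hx.1.2)
  exact (h1.comp x.2 h2).contDiffAt.comp x contDiffAt_snd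

/-- The differentials of two inverse charts differ by the differential of the change of charts. -/
theorem chartInvDeriv_eq_comp {p₀ p₁ : M} {x : ℝ × Model n} (hx : x ∈ overlapDomain n p₀ p₁)
    (v : ℝ × Model n) :
    v.1 = (fderiv ℝ (chartChange p₀ p₁) x v).1 ∧ chartInvDeriv p₀ x.2 v.2 =
      chartInvDeriv p₁ (chartChange p₀ p₁ x).2 (fderiv ℝ (chartChange p₀ p₁) x v).2 := by
  -- compare the two expressions for the velocity of the coordinate line in the direction `v`
  let c : ℝ → ℝ × Model n := fun r => x + r • v
  have hc : HasDerivAt c v 0 := by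
    have h := ((hasDerivAt_id (0 : ℝ)).smul_const v).const_add x
    rwa [one_smul] at h
  have hc0 : c 0 = x := by simp [c]
  let γ : ℝ → ℝ × M := fun r => coordInv p₀ (c r)
  have hev : ∀ᶠ r in 𝓝 (0 : ℝ), c r ∈ overlapDomain n p₀ p₁ :=
    hc.continuousAt (by rw [hc0]; exact mem_nhds_overlapDomain hx)
  have hsrc : (γ 0).2 ∈ (extChartAt 𝓘(ℝ, Model n) p₀).source := by
    refine coordInv_source ?_; rw [hc0]; exact hx.1
  have hsrc' : (γ 0).2 ∈ (extChartAt 𝓘(ℝ, Model n) p₁).source := by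
    change (coordInv p₀ (c 0)).2 ∈ _
    rw [hc0]; exact hx.2
  have hd0 : HasDerivAt (SplitMetric.coordCurve n p₀ γ) v 0 :=
    hc.congr_of_eventuallyEq (hev.mono fun r hr => coordCurve_coordInv hr.1)
  have hd1 : HasDerivAt (SplitMetric.coordCurve n p₁ γ) (fderiv ℝ (chartChange p₀ p₁) x v) 0 := by
    have h1 : HasFDerivAt (chartChange p₀ p₁) (fderiv ℝ (chartChange p₀ p₁) x) (c 0) := by
      rw [hc0]
      exact ((contDiffAt_chartChange hx).differentiableAt (by simp)).hasFDerivAt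
    exact HasFDerivAt.comp_hasDerivAt 0 h1 hc
  have hγ : ContinuousWithinAt γ univ 0 := by
    have h1 : ContinuousAt (fun x : ℝ × Model n => chartInv p₀ x.2) (c 0) := by
      rw [hc0]
      exact ((continuousOn_extChartAt_symm p₀).continuousAt
        ((isOpen_extChartAt_target p₀).mem_nhds hx.1.2)).comp continuousAt_snd
    exact ((hc.continuousAt.fst).prodMk (ContinuousAt.comp h1 hc.continuousAt)).continuousWithinAt
  have e0 := vel_eq uniqueDiffWithinAt_univ hγ hsrc hd0.hasDerivWithinAt
  have e1 := vel_eq uniqueDiffWithinAt_univ hγ hsrc' hd1.hasDerivWithinAt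
  rw [e0] at e1
  have hx0 : extChartAt 𝓘(ℝ, Model n) p₀ (γ 0).2 = x.2 := by
    change extChartAt 𝓘(ℝ, Model n) p₀ (chartInv p₀ (c 0).2) = x.2
    rw [hc0]; exact (extChartAt 𝓘(ℝ, Model n) p₀).right_inv hx.1.2
  have hx1 : extChartAt 𝓘(ℝ, Model n) p₁ (γ 0).2 = (chartChange p₀ p₁ x).2 := by
    change extChartAt 𝓘(ℝ, Model n) p₁ (chartInv p₀ (c 0).2) = _
    rw [hc0]; rfl
  rw [hx0, hx1] at e1
  exact Prod.ext_iff.1 e1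

theorem surjective_fderiv_chartChange {p₀ p₁ : M} {x : ℝ × Model n}
    (hx : x ∈ overlapDomain n p₀ p₁) : Function.Surjective (fderiv ℝ (chartChange p₀ p₁) x) := by
  have : Function.Injective (fderiv ℝ (chartChange p₀ p₁) x).toLinearMap := by
    refine (injective_iff_map_eq_zero _).2 fun v hv => ?_
    obtain ⟨h1, h2⟩ := chartInvDeriv_eq_comp hx v
    have hv' : fderiv ℝ (chartChange p₀ p₁) x v = 0 := hv
    rw [hv'] at h1 h2
    refine Prod.ext h1 ((SplitMetric.isInvertible_chartInvDeriv hx.1.2).injective ?_)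
    rw [h2]; simp
  exact LinearMap.surjective_of_injective this

theorem SplitMetric.chartMetric_pullback (g : SplitMetric n M) {p₀ p₁ : M} {x : ℝ × Model n}
    (hx : x ∈ overlapDomain n p₀ p₁) (v w : ℝ × Model n) :
    g.chartMetric p₀ x v w = g.chartMetric p₁ (chartChange p₀ p₁ x)
      (fderiv ℝ (chartChange p₀ p₁) x v) (fderiv ℝ (chartChange p₀ p₁) x w) := by
  rw [chartMetric_apply, chartMetric_apply, coordForm_eq, coordForm_eq,
    ← (chartInvDeriv_eq_comp hx v).1, ← (chartInvDeriv_eq_comp hx v).2,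
    ← (chartInvDeriv_eq_comp hx w).1, ← (chartInvDeriv_eq_comp hx w).2]
  simp only [chartChange, chartInv, (extChartAt 𝓘(ℝ, Model n) p₁).left_inv hx.2]

/-- Whether the Euler–Lagrange covector vanishes along a curve does not depend on the chart. -/
theorem SplitMetric.eulerLagrange_chart_change (g : SplitMetric n M) {p₀ p₁ : M}
    {γ : ℝ → ℝ × M} {S : Set ℝ} {s : ℝ} (hS : UniqueDiffOn ℝ S) (hγ : SmoothCurveOn n γ S)
    (hs : s ∈ S)
    (h₀ : (γ s).2 ∈ (extChartAt 𝓘(ℝ, Model n) p₀).source)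
    (h₁ : (γ s).2 ∈ (extChartAt 𝓘(ℝ, Model n) p₁).source)
    (h : ∀ w, eulerLagrange (g.chartMetric p₀) (coordCurve n p₀ γ s)
      (derivWithin (coordCurve n p₀ γ) S s)
      (derivWithin (derivWithin (coordCurve n p₀ γ) S) S s) w = 0) (w : ℝ × Model n) :
    eulerLagrange (g.chartMetric p₁) (coordCurve n p₁ γ s)
      (derivWithin (coordCurve n p₁ γ) S s)
      (derivWithin (derivWithin (coordCurve n p₁ γ) S) S s) w = 0 := by
  set c₀ := coordCurve n p₀ γ
  set c₁ := coordCurve n p₁ γ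
  set φ := chartChange (n := n) p₀ p₁
  have hmem : ∀ r, (γ r).2 ∈ (extChartAt 𝓘(ℝ, Model n) p₀).source →
      (γ r).2 ∈ (extChartAt 𝓘(ℝ, Model n) p₁).source → c₀ r ∈ overlapDomain n p₀ p₁ :=
    fun r h0 h1 => ⟨coordCurve_mem h0, by
      change chartInv p₀ (c₀ r).2 ∈ (extChartAt 𝓘(ℝ, Model n) p₁).source
      have := congrArg Prod.snd (coordInv_coordCurve (n := n) h0)
      exact mem_of_eq_of_mem this h1⟩
  have hx := hmem s h₀ h₁
  have hv : ∀ r ∈ S, (γ r).2 ∈ (extChartAt 𝓘(ℝ, Model n) p₀).source →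
      (γ r).2 ∈ (extChartAt 𝓘(ℝ, Model n) p₁).source →
      derivWithin c₁ S r = fderiv ℝ φ (c₀ r) (derivWithin c₀ S r) := fun r hr h0 h1 => by
    have hd := HasFDerivAt.comp_hasDerivWithinAt (𝕜 := ℝ) (l := φ) (l' := fderiv ℝ φ (c₀ r)) r
      ((contDiffAt_chartChange (hmem r h0 h1)).differentiableAt (by simp)).hasFDerivAt
      (hγ.hasDerivWithinAt_coordCurve hr h0)
    refine (hd.congr_of_eventuallyEq_of_mem ?_ hr).derivWithin (hS r hr)
    filter_upwards [eventually_source (n := n) (hγ.continuousOn r hr) h0] with t ht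
    exact (chartChange_coordCurve ht).symm
  have hv' : derivWithin c₁ S =ᶠ[𝓝[S] s] fun r => fderiv ℝ φ (c₀ r) (derivWithin c₀ S r) := by
    filter_upwards [eventually_source (n := n) (hγ.continuousOn s hs) h₀,
      eventually_source (n := n) (hγ.continuousOn s hs) h₁, self_mem_nhdsWithin] with r h0 h1 hr
    exact hv r hr h0 h1
  have hc0 := hγ.hasDerivWithinAt_coordCurve hs h₀
  have hv0 : HasDerivWithinAt (derivWithin c₀ S) (derivWithin (derivWithin c₀ S) S s) S s :=
    ((((hγ.contDiffWithinAt_coordCurve hs h₀).derivWithin_infty hS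
      hs)).differentiableWithinAt (by simp)).hasDerivWithinAt
  have hφ := contDiffAt_chartChange hx
  have ha : derivWithin (derivWithin c₁ S) S s =
      fderiv ℝ (fderiv ℝ φ) (c₀ s) (derivWithin c₀ S s) (derivWithin c₀ S s) +
        fderiv ℝ φ (c₀ s) (derivWithin (derivWithin c₀ S) S s) := by
    have h2 : HasDerivWithinAt (fun r => fderiv ℝ φ (c₀ r))
        (fderiv ℝ (fderiv ℝ φ) (c₀ s) (derivWithin c₀ S s)) S s :=
      HasFDerivAt.comp_hasDerivWithinAt (𝕜 := ℝ) (l := fderiv ℝ φ)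
        (l' := fderiv ℝ (fderiv ℝ φ) (c₀ s)) s
        ((hφ.fderiv_right (m := ∞) (by simp)).differentiableAt (by simp)).hasFDerivAt hc0
    exact ((h2.clm_apply hv0).congr_of_eventuallyEq_of_mem hv' hs).derivWithin (hS s hs)
  have hc1 : c₁ s = φ (c₀ s) := (chartChange_coordCurve h₀).symm
  obtain ⟨w, rfl⟩ := surjective_fderiv_chartChange hx w
  rw [ha, hv s hs h₀ h₁, hc1, ← h w]
  refine (eulerLagrange_pullback hφ ?_ ?_ (fun u w => g.chartMetric_symm _ _ u w) ?_ _ _ _).symm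
  · refine (g.contDiffAt_chartMetric ?_).differentiableAt (by simp)
    change φ (c₀ s) ∈ _
    rw [← hc1]; exact coordCurve_mem h₁
  · exact (g.contDiffAt_chartMetric (coordCurve_mem h₀)).differentiableAt (by simp)
  · filter_upwards [mem_nhds_overlapDomain hx] with y hy u w using g.chartMetric_pullback hy u w

end ChartChange

/-! ### Geodesics on closed intervals -/

namespace SplitMetric
variable {n : ℕ} {M : Type*} [TopologicalSpace M] [ChartedSpace (Model n) M]
  [IsManifold 𝓘(ℝ, Model n) ∞ M] (g : SplitMetric n M)

/-- `γ` is smooth on `S` and satisfies the geodesic equation there in every preferred chart, all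
derivatives being taken within `S`; this makes sense for closed intervals `S`. -/
def IsGeodesicWithin (γ : ℝ → ℝ × M) (S : Set ℝ) : Prop :=
  SmoothCurveOn n γ S ∧ ∀ s ∈ S, ∀ p₀ : M, (γ s).2 ∈ (extChartAt 𝓘(ℝ, Model n) p₀).source →
    ∀ w, eulerLagrange (g.chartMetric p₀) (coordCurve n p₀ γ s)
      (derivWithin (coordCurve n p₀ γ) S s)
      (derivWithin (derivWithin (coordCurve n p₀ γ) S) S s) w = 0

variable {g}

/-- It is enough to verify the geodesic equation in one chart around each point. -/
theorem IsGeodesicWithin.of_chart {γ : ℝ → ℝ × M} {S : Set ℝ} (hS : UniqueDiffOn ℝ S)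
    (hγ : SmoothCurveOn n γ S)
    (h : ∀ s ∈ S, ∃ p₀ : M, (γ s).2 ∈ (extChartAt 𝓘(ℝ, Model n) p₀).source ∧
      ∀ w, eulerLagrange (g.chartMetric p₀) (coordCurve n p₀ γ s)
      (derivWithin (coordCurve n p₀ γ) S s)
      (derivWithin (derivWithin (coordCurve n p₀ γ) S) S s) w = 0) : g.IsGeodesicWithin γ S :=
  ⟨hγ, fun s hs _ h₁ => by
    obtain ⟨p₀, h₀, h⟩ := h s hs
    exact g.eulerLagrange_chart_change hS hγ hs h₀ h₁ h⟩

theorem IsGeodesicWithin.congr {γ γ' : ℝ → ℝ × M} {S : Set ℝ} (h : g.IsGeodesicWithin γ S)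
    (hS : EqOn γ' γ S) : g.IsGeodesicWithin γ' S := by
  refine ⟨h.1.congr hS, fun s hs p₀ hsrc w => ?_⟩
  have hc : EqOn (coordCurve n p₀ γ') (coordCurve n p₀ γ) S := fun r hr => by
    simp only [coordCurve, hS hr]
  have hv : EqOn (derivWithin (coordCurve n p₀ γ') S) (derivWithin (coordCurve n p₀ γ) S) S :=
    fun r hr => derivWithin_congr hc (hc hr)
  rw [derivWithin_congr hv (hv hs), hv hs, hc hs]
  exact h.2 s hs p₀ (hS hs ▸ hsrc) w

theorem IsGeodesicWithin.hasDerivWithinAt_spray {γ : ℝ → ℝ × M} {S : Set ℝ} {s : ℝ} {p₀ : M}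
    (h : g.IsGeodesicWithin γ S) (hS : UniqueDiffOn ℝ S) (hs : s ∈ S)
    (hsrc : (γ s).2 ∈ (extChartAt 𝓘(ℝ, Model n) p₀).source) :
    HasDerivWithinAt (derivWithin (coordCurve n p₀ γ) S)
      (spray (g.chartMetric p₀) (coordCurve n p₀ γ s) (derivWithin (coordCurve n p₀ γ) S s))
      S s := by
  have h1 := ((((h.1.contDiffWithinAt_coordCurve hs hsrc).derivWithin_infty hS
    hs)).differentiableWithinAt (by simp)).hasDerivWithinAt
  rwa [(eulerLagrange_eq_zero_iff (g.isInvertible_chartMetric (coordCurve_mem hsrc)) _ _).1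
    (h.2 s hs p₀ hsrc)] at h1

/-- Affine changes of the parameter preserve the geodesic equation. -/
theorem IsGeodesicWithin.comp_affine {γ : ℝ → ℝ × M} {S T : Set ℝ} (κ d : ℝ)
    (h : g.IsGeodesicWithin γ S) (hS : UniqueDiffOn ℝ S) (hT : UniqueDiffOn ℝ T)
    (hm : MapsTo (fun r => κ * r + d) T S) : g.IsGeodesicWithin (fun r => γ (κ * r + d)) T := by
  have hL : ContMDiffOn 𝓘(ℝ, ℝ) 𝓘(ℝ, ℝ) ∞ (fun r : ℝ => κ * r + d) T := by
    rw [contMDiffOn_iff_contDiffOn]; fun_prop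
  refine ⟨ContMDiffOn.comp h.1 hL hm, fun s hs p₀ hsrc w => ?_⟩
  have hd : ∀ r, HasDerivWithinAt (fun r : ℝ => κ * r + d) κ T r := fun r => by
    simpa using (((hasDerivAt_id r).const_mul κ).add_const d).hasDerivWithinAt
  have hc : ∀ r ∈ T, (γ (κ * r + d)).2 ∈ (extChartAt 𝓘(ℝ, Model n) p₀).source →
      derivWithin (coordCurve n p₀ fun r => γ (κ * r + d)) T r =
        κ • derivWithin (coordCurve n p₀ γ) S (κ * r + d) := fun r hr h0 =>
    (HasDerivWithinAt.scomp (g₁ := coordCurve n p₀ γ) r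
      (h.1.hasDerivWithinAt_coordCurve (hm hr) h0) (hd r) hm).derivWithin (hT r hr)
  have hv : derivWithin (coordCurve n p₀ fun r => γ (κ * r + d)) T =ᶠ[𝓝[T] s]
      fun r => κ • derivWithin (coordCurve n p₀ γ) S (κ * r + d) := by
    have hcont : ContinuousWithinAt (fun r => γ (κ * r + d)) T s :=
      ContinuousWithinAt.comp (f := fun r => κ * r + d) (h.1.continuousOn _ (hm hs))
        (hd s).continuousWithinAt hm
    filter_upwards [eventually_source (n := n) hcont hsrc, self_mem_nhdsWithin] with r h0 hr
      using hc r hr h0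
  have ha := (((((h.1.contDiffWithinAt_coordCurve (hm hs) hsrc).derivWithin_infty hS
    (hm hs)).differentiableWithinAt (by simp)).hasDerivWithinAt).scomp s (hd s) hm).const_smul κ
  have ha' := (ha.congr_of_eventuallyEq_of_mem hv hs).derivWithin (hT s hs)
  rw [ha', hc s hs hsrc, smul_smul, ← sq]
  exact (eulerLagrange_smul_smul _ _ _ _ _).trans
    (mul_eq_zero_of_right _ (h.2 _ (hm hs) p₀ hsrc w))

/-- A continuous curve that solves the first-order system of the spray, in suitable charts, is
smooth and a geodesic. -/
theorem isGeodesicWithin_of_spray {γ : ℝ → ℝ × M} {a b : ℝ} (hab : a < b)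
    (hγ : ContinuousOn γ (Icc a b))
    (h : ∀ s₀ ∈ Icc a b, ∃ (p₀ : M) (v : ℝ → ℝ × Model n),
      (γ s₀).2 ∈ (extChartAt 𝓘(ℝ, Model n) p₀).source ∧ ∀ᶠ s in 𝓝[Icc a b] s₀,
        HasDerivWithinAt (coordCurve n p₀ γ) (v s) (Icc a b) s ∧
        HasDerivWithinAt v (spray (g.chartMetric p₀) (coordCurve n p₀ γ s) (v s)) (Icc a b) s) :
    g.IsGeodesicWithin γ (Icc a b) := by
  have hS := uniqueDiffOn_Icc hab
  have hsm : SmoothCurveOn n γ (Icc a b) := by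
    intro s₀ hs₀
    obtain ⟨p₀, v, hsrc, hev⟩ := h s₀ hs₀
    obtain ⟨a', b', hab', hs', hsub, hA, hN⟩ := exists_Icc_mem_nhdsWithin hab hs₀
      (hev.and (eventually_source (n := n) (hγ s₀ hs₀) hsrc))
    let f : ℝ → (ℝ × Model n) × (ℝ × Model n) → (ℝ × Model n) × (ℝ × Model n) :=
      fun _ z => (z.2, spray (g.chartMetric p₀) z.1 z.2)
    have hf : ContDiffOn ℝ ∞ (Function.uncurry f) (Icc a' b' ×ˢ (coordDomain n p₀ ×ˢ univ)) := by
      rintro ⟨t, x, w⟩ ⟨-, hx, -⟩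
      have h1 := contDiffAt_spray (g.isInvertible_chartMetric hx) (g.contDiffAt_chartMetric hx) w
      have h2 : ContDiffAt ℝ ∞ (fun z : (ℝ × Model n) × (ℝ × Model n) =>
          (z.2, spray (g.chartMetric p₀) z.1 z.2)) (x, w) := contDiffAt_snd.prodMk h1
      exact (h2.comp (t, x, w) contDiffAt_snd).contDiffWithinAt
    have hz : ContDiffOn ℝ ∞ (fun s => (coordCurve n p₀ γ s, v s)) (Icc a' b') :=
      ODE.contDiffOn_enat_Icc_of_hasDerivWithinAt (n := ⊤) hf (fun s hs =>
        (((hA hs).1.1.mono hsub).prodMk ((hA hs).1.2.mono hsub)))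
        (fun s hs => ⟨coordCurve_mem (hA hs).2, mem_univ _⟩)
    have := smoothCurveOn_of_coordCurve hz.fst (fun s hs => (hA hs).2)
    exact (this s₀ hs').mono_of_mem_nhdsWithin hN
  refine .of_chart hS hsm fun s₀ hs₀ => ?_
  obtain ⟨p₀, v, hsrc, hev⟩ := h s₀ hs₀
  refine ⟨p₀, hsrc, ?_⟩
  have hv : derivWithin (coordCurve n p₀ γ) (Icc a b) =ᶠ[𝓝[Icc a b] s₀] v := by
    filter_upwards [hev, self_mem_nhdsWithin] with s hs hs' using hs.1.derivWithin (hS s hs')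
  obtain ⟨h1, h2⟩ := hev.self_of_nhdsWithin hs₀
  rw [eulerLagrange_eq_zero_iff (g.isInvertible_chartMetric (coordCurve_mem hsrc)),
    (h2.congr_of_eventuallyEq_of_mem hv hs₀).derivWithin (hS s₀ hs₀), h1.derivWithin (hS s₀ hs₀)]

/-- Geodesics whose velocities fit together at a common end point join to a geodesic. -/
theorem IsGeodesicWithin.union {γ : ℝ → ℝ × M} {a b c : ℝ} (hab : a < b) (hbc : b < c)
    (h₁ : g.IsGeodesicWithin γ (Icc a b)) (h₂ : g.IsGeodesicWithin γ (Icc b c))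
    (hv : derivWithin (coordCurve n (γ b).2 γ) (Icc a b) b =
      derivWithin (coordCurve n (γ b).2 γ) (Icc b c) b) : g.IsGeodesicWithin γ (Icc a c) := by
  have hU : Icc a b ∪ Icc b c = Icc a c := Icc_union_Icc_eq_Icc hab.le hbc.le
  have hS₁ := uniqueDiffOn_Icc hab
  have hS₂ := uniqueDiffOn_Icc hbc
  have hb₁ : b ∈ Icc a b := right_mem_Icc.2 hab.le
  have hb₂ : b ∈ Icc b c := left_mem_Icc.2 hbc.le
  have hL : ∀ s < b, Icc a b ∈ 𝓝[Icc a c] s := fun s hs => by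
    filter_upwards [self_mem_nhdsWithin, mem_nhdsWithin_of_mem_nhds (Iio_mem_nhds hs)]
      with r hr hr' using ⟨hr.1, le_of_lt hr'⟩
  have hR : ∀ s, b < s → Icc b c ∈ 𝓝[Icc a c] s := fun s hs => by
    filter_upwards [self_mem_nhdsWithin, mem_nhdsWithin_of_mem_nhds (Ioi_mem_nhds hs)]
      with r hr hr' using ⟨le_of_lt hr', hr.2⟩
  have hcont : ContinuousOn γ (Icc a c) := by
    rw [← hU]
    exact h₁.1.continuousOn.union_of_isClosed h₂.1.continuousOn isClosed_Icc isClosed_Icc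
  refine isGeodesicWithin_of_spray (hab.trans hbc) hcont fun s₀ hs₀ => ?_
  let p₀ := (γ s₀).2
  have hsrc := mem_extChartAt_source (I := 𝓘(ℝ, Model n)) p₀
  have hsrc' := eventually_source (n := n) (hcont s₀ hs₀) hsrc
  rcases lt_trichotomy s₀ b with hlt | heq | hgt
  · refine ⟨p₀, derivWithin (coordCurve n p₀ γ) (Icc a b), hsrc, ?_⟩
    filter_upwards [hsrc', self_mem_nhdsWithin, mem_nhdsWithin_of_mem_nhds (Iio_mem_nhds hlt)]
      with s hs hs1 hs2
    have hsm : s ∈ Icc a b := ⟨hs1.1, le_of_lt hs2⟩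
    exact ⟨(h₁.1.hasDerivWithinAt_coordCurve hsm hs).mono_of_mem_nhdsWithin (hL s hs2),
      (h₁.hasDerivWithinAt_spray hS₁ hsm hs).mono_of_mem_nhdsWithin (hL s hs2)⟩
  · subst heq
    let v : ℝ → ℝ × Model n := fun s => if s ≤ s₀ then
      derivWithin (coordCurve n p₀ γ) (Icc a s₀) s else derivWithin (coordCurve n p₀ γ) (Icc s₀ c) s
    have e₁ : EqOn v (derivWithin (coordCurve n p₀ γ) (Icc a s₀)) (Icc a s₀) :=
      fun s hs => if_pos hs.2
    have e₂ : EqOn v (derivWithin (coordCurve n p₀ γ) (Icc s₀ c)) (Icc s₀ c) := fun s hs => by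
      rcases hs.1.eq_or_lt with rfl | h
      · exact (if_pos le_rfl).trans hv
      · exact if_neg (not_le.2 h)
    have hd₁ : ∀ s ∈ Icc a s₀, (γ s).2 ∈ (extChartAt 𝓘(ℝ, Model n) p₀).source →
        HasDerivWithinAt (coordCurve n p₀ γ) (v s) (Icc a s₀) s ∧ HasDerivWithinAt v
          (spray (g.chartMetric p₀) (coordCurve n p₀ γ s) (v s)) (Icc a s₀) s := fun s hs h0 => by
      rw [e₁ hs]
      exact ⟨h₁.1.hasDerivWithinAt_coordCurve hs h0,
        (h₁.hasDerivWithinAt_spray hS₁ hs h0).congr e₁ (e₁ hs)⟩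
    have hd₂ : ∀ s ∈ Icc s₀ c, (γ s).2 ∈ (extChartAt 𝓘(ℝ, Model n) p₀).source →
        HasDerivWithinAt (coordCurve n p₀ γ) (v s) (Icc s₀ c) s ∧ HasDerivWithinAt v
          (spray (g.chartMetric p₀) (coordCurve n p₀ γ s) (v s)) (Icc s₀ c) s := fun s hs h0 => by
      rw [e₂ hs]
      exact ⟨h₂.1.hasDerivWithinAt_coordCurve hs h0,
        (h₂.hasDerivWithinAt_spray hS₂ hs h0).congr e₂ (e₂ hs)⟩
    refine ⟨p₀, v, hsrc, ?_⟩
    filter_upwards [hsrc', self_mem_nhdsWithin] with s hs hs1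
    rcases lt_trichotomy s s₀ with hlt | heq | hgt
    · have := hd₁ s ⟨hs1.1, hlt.le⟩ hs
      exact ⟨this.1.mono_of_mem_nhdsWithin (hL s hlt), this.2.mono_of_mem_nhdsWithin (hL s hlt)⟩
    · subst heq
      rw [← hU]
      exact ⟨(hd₁ s hb₁ hs).1.union (hd₂ s hb₂ hs).1, (hd₁ s hb₁ hs).2.union (hd₂ s hb₂ hs).2⟩
    · have := hd₂ s ⟨hgt.le, hs1.2⟩ hs
      exact ⟨this.1.mono_of_mem_nhdsWithin (hR s hgt), this.2.mono_of_mem_nhdsWithin (hR s hgt)⟩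
  · refine ⟨p₀, derivWithin (coordCurve n p₀ γ) (Icc b c), hsrc, ?_⟩
    filter_upwards [hsrc', self_mem_nhdsWithin, mem_nhdsWithin_of_mem_nhds (Ioi_mem_nhds hgt)]
      with s hs hs1 hs2
    have hsm : s ∈ Icc b c := ⟨le_of_lt hs2, hs1.2⟩
    exact ⟨(h₂.1.hasDerivWithinAt_coordCurve hsm hs).mono_of_mem_nhdsWithin (hR s hs2),
      (h₂.hasDerivWithinAt_spray hS₂ hsm hs).mono_of_mem_nhdsWithin (hR s hs2)⟩

variable (g)

/-- Local existence of geodesics with prescribed initial velocity. -/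
theorem exists_isGeodesicWithin (q : ℝ × M) (V : ℝ × Model n) (b : ℝ) :
    ∃ (γ : ℝ → ℝ × M) (c : ℝ), b < c ∧ γ b = q ∧ g.IsGeodesicWithin γ (Icc b c) ∧
      derivWithin (coordCurve n q.2 γ) (Icc b c) b = V := by
  let p₀ := q.2
  let x₀ : ℝ × Model n := (q.1, extChartAt 𝓘(ℝ, Model n) p₀ p₀)
  have hp₀ := mem_extChartAt_source (I := 𝓘(ℝ, Model n)) p₀
  have hx₀ : x₀ ∈ coordDomain n p₀ := ⟨mem_univ _, (extChartAt 𝓘(ℝ, Model n) p₀).map_source hp₀⟩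
  let f : (ℝ × Model n) × (ℝ × Model n) → (ℝ × Model n) × (ℝ × Model n) :=
    fun z => (z.2, spray (g.chartMetric p₀) z.1 z.2)
  have hf : ContDiffAt ℝ 1 f (x₀, V) := by
    have h1 := contDiffAt_spray (g.isInvertible_chartMetric hx₀) (g.contDiffAt_chartMetric hx₀) V
    exact (contDiffAt_snd.prodMk h1).of_le (by simp)
  obtain ⟨z, hz0, ε, hε, hz⟩ :=
    hf.exists_forall_mem_closedBall_exists_eq_forall_mem_Ioo_hasDerivAt₀ b
  have hzb := hz b ⟨by linarith, by linarith⟩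
  have hz1 : ContinuousAt (fun s => (z s).1) b := hzb.continuousAt.fst
  have hev : ∀ᶠ s in 𝓝 b, (z s).1 ∈ coordDomain n p₀ :=
    hz1 (by simp only [hz0]; exact (isOpen_coordDomain p₀).mem_nhds hx₀)
  obtain ⟨δ, hδ, H⟩ := Metric.eventually_nhds_iff.1 hev
  set η := min (δ / 2) (ε / 2)
  have hη : 0 < η := lt_min (by linarith) (by linarith)
  have hηδ : η ≤ δ / 2 := min_le_left _ _
  have hηε : η ≤ ε / 2 := min_le_right _ _
  have hbc : b < b + η := by linarith
  let γ : ℝ → ℝ × M := fun s => coordInv p₀ (z s).1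
  have hd' : ∀ {s : ℝ} {z' : (ℝ × Model n) × (ℝ × Model n)}, HasDerivAt z z' s →
      HasDerivAt (fun s => (z s).1) z'.1 s ∧ HasDerivAt (fun s => (z s).2) z'.2 s := fun h =>
    ⟨(ContinuousLinearMap.fst ℝ (ℝ × Model n) (ℝ × Model n)).hasFDerivAt.comp_hasDerivAt _ h,
      (ContinuousLinearMap.snd ℝ (ℝ × Model n) (ℝ × Model n)).hasFDerivAt.comp_hasDerivAt _ h⟩
  have hdom : ∀ s ∈ Icc b (b + η), (z s).1 ∈ coordDomain n p₀ := fun s hs => H (by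
    rw [Real.dist_eq, abs_lt]; constructor <;> linarith [hs.1, hs.2])
  have hd : ∀ s ∈ Icc b (b + η), HasDerivAt z (f (z s)) s := fun s hs =>
    hz s ⟨by linarith [hs.1], by linarith [hs.2]⟩
  have hcc : EqOn (coordCurve n p₀ γ) (fun s => (z s).1) (Icc b (b + η)) := fun s hs =>
    coordCurve_coordInv (c := fun s => (z s).1) (hdom s hs)
  have hd1 : ∀ s ∈ Icc b (b + η),
      HasDerivWithinAt (coordCurve n p₀ γ) (z s).2 (Icc b (b + η)) s := fun s hs =>
    (HasDerivWithinAt.congr (hd' (hd s hs)).1.hasDerivWithinAt hcc (hcc hs))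
  have hb : b ∈ Icc b (b + η) := left_mem_Icc.2 hbc.le
  have hγb : γ b = q := by
    simp only [γ, hz0, coordInv, chartInv, x₀, (extChartAt 𝓘(ℝ, Model n) p₀).left_inv hp₀]
    rfl
  refine ⟨γ, b + η, hbc, hγb, ?_, ?_⟩
  · refine isGeodesicWithin_of_spray hbc ?_ fun s₀ hs₀ =>
      ⟨p₀, fun s => (z s).2, coordInv_source (hdom s₀ hs₀), ?_⟩
    · intro s hs
      have h1 : ContinuousAt (fun x : ℝ × Model n => chartInv p₀ x.2) (z s).1 :=
        ((continuousOn_extChartAt_symm p₀).continuousAt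
          ((isOpen_extChartAt_target p₀).mem_nhds (hdom s hs).2)).comp continuousAt_snd
      have h2 : ContinuousAt (fun s => (z s).1) s := (hd s hs).continuousAt.fst
      exact (h2.fst.prodMk (ContinuousAt.comp h1 h2)).continuousWithinAt
    · filter_upwards [self_mem_nhdsWithin] with s hs
      refine ⟨hd1 s hs, ?_⟩
      rw [hcc hs]
      exact (hd' (hd s hs)).2.hasDerivWithinAt
  · have := (hd1 b hb).derivWithin (uniqueDiffOn_Icc hbc b hb)
    rw [hz0] at this
    exact this

variable {g}

/-- A geodesic is continued by the geodesic starting with its final velocity. -/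
theorem IsGeodesicWithin.exists_extension_right {γ : ℝ → ℝ × M} {a b : ℝ} (hab : a < b)
    (h : g.IsGeodesicWithin γ (Icc a b)) :
    ∃ (γ' : ℝ → ℝ × M) (c : ℝ), b < c ∧ EqOn γ' γ (Icc a b) ∧ g.IsGeodesicWithin γ' (Icc a c) := by
  obtain ⟨η, c, hbc, hη, hη', hv⟩ := g.exists_isGeodesicWithin (γ b)
    (derivWithin (coordCurve n (γ b).2 γ) (Icc a b) b) b
  let γ' : ℝ → ℝ × M := fun s => if s ≤ b then γ s else η s
  have e₁ : EqOn γ' γ (Icc a b) := fun s hs => if_pos hs.2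
  have e₂ : EqOn γ' η (Icc b c) := fun s hs => by
    rcases hs.1.eq_or_lt with rfl | h
    · exact (if_pos le_rfl).trans hη.symm
    · exact if_neg (not_le.2 h)
  have hb₁ : b ∈ Icc a b := right_mem_Icc.2 hab.le
  have hb₂ : b ∈ Icc b c := left_mem_Icc.2 hbc.le
  refine ⟨γ', c, hbc, e₁, (h.congr e₁).union hab hbc (hη'.congr e₂) ?_⟩
  have c₁ : EqOn (coordCurve n (γ' b).2 γ') (coordCurve n (γ b).2 γ) (Icc a b) := fun r hr => by
    simp only [coordCurve, e₁ hr, e₁ hb₁]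
  have c₂ : EqOn (coordCurve n (γ' b).2 γ') (coordCurve n (γ b).2 η) (Icc b c) := fun r hr => by
    simp only [coordCurve, e₂ hr, e₁ hb₁]
  rw [derivWithin_congr c₁ (c₁ hb₁), derivWithin_congr c₂ (c₂ hb₂), hv]

/-- Beyond the left end point the geodesic is extended by reversing the parameter. -/
theorem IsGeodesicWithin.exists_extension {γ : ℝ → ℝ × M} {a b : ℝ} (hab : a < b)
    (h : g.IsGeodesicWithin γ (Icc a b)) :
    ∃ (γ' : ℝ → ℝ × M) (a' b' : ℝ), a' < a ∧ b < b' ∧ EqOn γ' γ (Icc a b) ∧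
      g.IsGeodesicWithin γ' (Icc a' b') := by
  obtain ⟨γ₁, b', hb, he, h₁⟩ := h.exists_extension_right hab
  have hab' : a < b' := hab.trans hb
  have hm : MapsTo (fun r => (-1 : ℝ) * r + 0) (Icc (-b') (-a)) (Icc a b') := fun r hr =>
    ⟨by linarith [hr.2], by linarith [hr.1]⟩
  obtain ⟨γ₂, c, hc, he₂, h₂⟩ := (h₁.comp_affine (-1) 0 (uniqueDiffOn_Icc hab')
    (uniqueDiffOn_Icc (by linarith)) hm).exists_extension_right (by linarith)
  have hm' : MapsTo (fun r => (-1 : ℝ) * r + 0) (Icc (-c) b') (Icc (-b') c) := fun r hr =>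
    ⟨by linarith [hr.2], by linarith [hr.1]⟩
  refine ⟨fun r => γ₂ ((-1) * r + 0), -c, b', by linarith, hb, fun r hr => ?_,
    h₂.comp_affine (-1) 0 (uniqueDiffOn_Icc (by linarith)) (uniqueDiffOn_Icc (by linarith)) hm'⟩
  change γ₂ ((-1) * r + 0) = γ r
  rw [he₂ ⟨by linarith [hr.2], by linarith [hr.1]⟩, ← he hr]
  simp

theorem IsGeodesicWithin.isGeodesicOn {γ : ℝ → ℝ × M} {D : Set ℝ} (hD : IsOpen D)
    (hD' : D.OrdConnected) (h : g.IsGeodesicWithin γ D) : g.IsGeodesicOn γ D := by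
  refine ⟨hD, hD', h.1, fun s hs => ?_⟩
  have hsrc := mem_extChartAt_source (I := 𝓘(ℝ, Model n)) (γ s).2
  have hev : derivWithin (coordCurve n (γ s).2 γ) D =ᶠ[𝓝 s] deriv (coordCurve n (γ s).2 γ) := by
    filter_upwards [hD.mem_nhds hs] with r hr using derivWithin_of_isOpen hD hr
  intro w
  set c := coordCurve n (γ s).2 γ
  set G := g.coordForm (γ s).2
  have h1 := h.2 s hs (γ s).2 hsrc w
  change eulerLagrange (g.chartMetric (γ s).2) (c s) (derivWithin c D s)
    (derivWithin (derivWithin c D) D s) w = 0 at h1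
  rw [derivWithin_of_isOpen (f := derivWithin c D) hD hs, hev.deriv_eq, hev.self_of_nhds] at h1
  have hG : HasFDerivAt (g.chartMetric (γ s).2) (fderiv ℝ (g.chartMetric (γ s).2) (c s)) (c s) :=
    ((g.contDiffAt_chartMetric (coordCurve_mem hsrc)).differentiableAt (by simp)).hasFDerivAt
  have h2 : ∀ u v, HasFDerivAt (fun x => G x u v) _ (c s) := fun u v =>
    (hG.clm_apply (hasFDerivAt_const u (c s))).clm_apply (hasFDerivAt_const v (c s))
  rw [(h2 _ _).fderiv, (h2 _ _).fderiv]
  refine Eq.trans ?_ h1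
  simp [eulerLagrange]
  rfl

end SplitMetric

/-! ### Lightlike geodesics between points that are not chronologically related -/

/-- The derivative `k` extends `h` by constants outside `[a, b]`, so that bounds for `h` carry
over. -/
theorem exists_forall_hasDerivAt_of_continuousOn {a b : ℝ} (hab : a < b) {h : ℝ → ℝ}
    (hc : ContinuousOn h (Icc a b)) :
    ∃ (k u : ℝ → ℝ), Continuous k ∧ (∀ s, ∃ t ∈ Icc a b, k s = h t) ∧ EqOn k h (Icc a b) ∧
      ∀ s, HasDerivAt u (k s) s := by
  let k := IccExtend hab.le ((Icc a b).domRestrict h)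
  have hk : Continuous k := (continuousOn_iff_continuous_domRestrict.1 hc).Icc_extend'
  refine ⟨k, fun s => ∫ t in a..s, k t, hk, fun s => ⟨projIcc a b hab.le s,
    (projIcc a b hab.le s).2, rfl⟩, fun s hs => IccExtend_of_mem _ _ hs, fun s =>
    hk.integral_hasStrictDerivAt a s |>.hasDerivAt⟩

/-- A positive continuous function is the speed of some change of parameter. -/
theorem exists_reparametrization {a b : ℝ} (hab : a < b) {f : ℝ → ℝ}
    (hc : ContinuousOn f (Icc a b)) (hf : ∀ s ∈ Icc a b, 0 < f s) :
    ∃ (σ : ℝ → ℝ) (a' b' : ℝ), a' < b' ∧ σ a' = a ∧ σ b' = b ∧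
      MapsTo σ (Icc a' b') (Icc a b) ∧ ∀ r ∈ Icc a' b', HasDerivAt σ (f (σ r)) r := by
  obtain ⟨k, u, hk, hk', he, hu⟩ := exists_forall_hasDerivAt_of_continuousOn hab
    (hc.inv₀ fun s hs => (hf s hs).ne')
  obtain ⟨s₁, hs₁, hmax⟩ := isCompact_Icc.exists_isMaxOn (nonempty_Icc.2 hab.le) hc
  set m := (f s₁)⁻¹ with hm
  have hm0 : 0 < m := inv_pos.2 (hf s₁ hs₁)
  have hkm : ∀ s, m ≤ k s := fun s => by
    obtain ⟨t, ht, e⟩ := hk' s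
    rw [e]
    exact inv_anti₀ (hf t ht) (hmax ht)
  have hmono : StrictMono u := strictMono_of_hasDerivAt_pos hu fun s => hm0.trans_le (hkm s)
  have hlin : Monotone fun s => u s - m * s := by
    refine monotone_of_hasDerivAt_nonneg (f' := fun s => k s - m) (fun s => ?_)
      fun s => sub_nonneg.2 (hkm s)
    have := (hu s).sub ((hasDerivAt_id s).const_mul m)
    rwa [mul_one] at this
  have hucont : Continuous u := continuous_iff_continuousAt.2 fun s => (hu s).continuousAt
  have hsurj : Function.Surjective u := by
    refine hucont.surjective ?_ ?_
    · refine tendsto_atTop_mono' atTop (f₁ := fun s => m * s + u 0) ?_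
        (tendsto_atTop_add_const_right _ _ (tendsto_id.const_mul_atTop hm0))
      filter_upwards [eventually_ge_atTop 0] with s hs
      have := hlin hs
      simp only [mul_zero, sub_zero] at this
      linarith
    · refine tendsto_atBot_mono' atBot (f₁ := fun s => m * s + u 0) ?_
        (tendsto_atBot_add_const_right _ _ (tendsto_id.const_mul_atBot hm0))
      filter_upwards [eventually_le_atBot 0] with s hs
      have := hlin hs
      simp only [mul_zero, sub_zero] at this
      linarith
  -- the change of parameter is the inverse of a primitive of `1 / f`
  let e := hmono.orderIsoOfSurjective u hsurj
  have hue : ∀ r, u (e.symm r) = r := fun r => e.apply_symm_apply r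
  have heu : ∀ s, e.symm (u s) = s := fun s => e.symm_apply_apply s
  have hmaps : MapsTo e.symm (Icc (u a) (u b)) (Icc a b) := fun r hr => by
    have h1 := e.symm.monotone hr.1
    have h2 := e.symm.monotone hr.2
    rw [heu] at h1 h2
    exact ⟨h1, h2⟩
  refine ⟨e.symm, u a, u b, hmono hab, heu a, heu b, hmaps, fun r hr => ?_⟩
  have h1 := HasDerivAt.of_local_left_inverse (f := u) (g := e.symm) (a := r)
    e.symm.continuous.continuousAt (hu (e.symm r)) (hm0.trans_le (hkm _)).ne'
    (Eventually.of_forall hue)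
  rwa [he (hmaps hr), Pi.inv_apply, inv_inv] at h1

/-- The speed that turns the parameter of a pregeodesic into an affine one. -/
theorem exists_affine_speed {a b : ℝ} (hab : a < b) {P P' Q : ℝ → ℝ}
    (hP : ∀ s ∈ Icc a b, HasDerivWithinAt P (P' s) (Icc a b) s) (hP0 : ∀ s ∈ Icc a b, 0 < P s)
    (hQ : ContinuousOn Q (Icc a b)) :
    ∃ f : ℝ → ℝ, (∀ s ∈ Icc a b, 0 < f s) ∧
      ∀ s ∈ Icc a b, HasDerivWithinAt f (-((P' s + Q s) / P s * f s)) (Icc a b) s := by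
  have hPc : ContinuousOn P (Icc a b) := fun s hs => (hP s hs).continuousWithinAt
  obtain ⟨k, I, -, -, he, hI⟩ := exists_forall_hasDerivAt_of_continuousOn hab
    (hQ.div hPc fun s hs => (hP0 s hs).ne')
  -- the solution of the linear equation with integrating factor, `I` being a primitive of `Q / P`
  refine ⟨fun s => Real.exp (-I s) / P s, fun s hs => div_pos (Real.exp_pos _) (hP0 s hs),
    fun s hs => ?_⟩
  have h1 : HasDerivWithinAt (fun s => Real.exp (-I s) / P s) _ (Icc a b) s :=
    (hI s).neg.exp.hasDerivWithinAt.div (hP s hs) (hP0 s hs).ne'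
  refine h1.congr_deriv ?_
  have := (hP0 s hs).ne'
  rw [he hs]
  simp only [Pi.div_apply, Pi.neg_apply]
  field_simp
  ring

namespace SplitMetric
variable {n : ℕ} {M : Type*} [TopologicalSpace M] [ChartedSpace (Model n) M]
  [IsManifold 𝓘(ℝ, Model n) ∞ M] (g : SplitMetric n M)

/-- Future-directed lightlike vectors. -/
def nullCone (q : ℝ × M) (v : ℝ × Model n) : Prop := g.bil q v v = 0 ∧ 0 < v.1

theorem nullCone_smul (q : ℝ × M) (v : ℝ × Model n) (κ : ℝ) (hκ : 0 < κ)
    (h : g.nullCone q v) : g.nullCone q (κ • v) :=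
  ⟨by rw [bil_smul_smul, h.1, mul_zero], mul_pos hκ h.2⟩

theorem nullCone_vel_iff {p₀ : M} {γ : ℝ → ℝ × M} {S : Set ℝ} {s : ℝ}
    {v : ℝ × Model n} (hu : UniqueDiffWithinAt ℝ S s) (hc : ContinuousWithinAt γ S s)
    (hsrc : (γ s).2 ∈ (extChartAt 𝓘(ℝ, Model n) p₀).source)
    (hd : HasDerivWithinAt (coordCurve n p₀ γ) v S s) :
    g.nullCone (γ s) (vel n γ S s) ↔
      g.chartMetric p₀ (coordCurve n p₀ γ s) v v = 0 ∧ 0 < v.1 := by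
  rw [← g.bil_vel hu hc hsrc hd, nullCone,
    show (vel n γ S s).1 = v.1 by rw [vel_eq hu hc hsrc hd]]

theorem _root_.IsPiece.causal {g : SplitMetric n M} {γ : ℝ → ℝ × M} {a b : ℝ}
    (h : IsPiece g.nullCone γ a b) : IsPiece g.causalCone γ a b :=
  h.imp fun _ _ h => ⟨h.1.le, h.2⟩

theorem contDiffOn_timeMomentum {γ : ℝ → ℝ × M} {S : Set ℝ} (hS : UniqueDiffOn ℝ S)
    (h : SmoothCurveOn n γ S) : ContDiffOn ℝ ∞ (g.timeMomentum γ S) S := by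
  have h1 : ContDiffOn ℝ ∞ (fun s => g.β (γ s)) S := by
    rw [← contMDiffOn_iff_contDiffOn]
    exact g.β_smooth.comp_contMDiffOn h
  exact h1.mul fun s hs => (h.fst s hs).derivWithin_infty hS hs

/-- A causal piece whose end points are not chronologically related is, up to the choice of the
parameter, a lightlike geodesic. -/
theorem exists_null_geodesic_of_isPiece {α : ℝ → ℝ × M} {a b : ℝ} (hab : a < b)
    (hα : IsPiece g.causalCone α a b) (hn : ¬ g.Chron (α a) (α b)) :
    ∃ (γ : ℝ → ℝ × M) (a' b' : ℝ), a' < b' ∧ γ a' = α a ∧ γ b' = α b ∧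
      g.IsGeodesicWithin γ (Icc a' b') ∧ IsPiece g.nullCone γ a' b' := by
  have hS := uniqueDiffOn_Icc hab
  obtain ⟨f, hf, hfd⟩ := exists_affine_speed hab
    (P := g.timeMomentum α (Icc a b)) (P' := derivWithin (g.timeMomentum α (Icc a b)) (Icc a b))
    (Q := fun s => 1 / 2 * g.timeDeriv (α s) (vel n α (Icc a b) s))
    (fun s hs => ((g.contDiffOn_timeMomentum hS hα.1).differentiableOn
      (by simp) s hs).hasDerivWithinAt)
    (fun s hs => mul_pos (g.β_pos _) (hα.2 s hs).2)
    (continuousOn_const.mul (g.continuousOn_timeDeriv hS hα.1))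
  obtain ⟨σ, a', b', hab', hσa, hσb, hmaps, hσ⟩ := exists_reparametrization hab
    (fun s hs => (hfd s hs).continuousWithinAt) hf
  have hS' := uniqueDiffOn_Icc hab'
  have hcont : ContinuousOn (fun r => α (σ r)) (Icc a' b') := fun r hr =>
    ContinuousWithinAt.comp (f := σ) (hα.1.continuousOn _ (hmaps hr))
      (hσ r hr).continuousAt.continuousWithinAt hmaps
  have hc : ∀ p₀ : M, ∀ r ∈ Icc a' b', (α (σ r)).2 ∈ (extChartAt 𝓘(ℝ, Model n) p₀).source →
      HasDerivWithinAt (coordCurve n p₀ fun r => α (σ r))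
        (f (σ r) • derivWithin (coordCurve n p₀ α) (Icc a b) (σ r)) (Icc a' b') r :=
    fun p₀ r hr h0 => HasDerivWithinAt.scomp (g₁ := coordCurve n p₀ α) r
      (hα.1.hasDerivWithinAt_coordCurve (hmaps hr) h0) (hσ r hr).hasDerivWithinAt hmaps
  have hgeo : g.IsGeodesicWithin (fun r => α (σ r)) (Icc a' b') := by
    refine isGeodesicWithin_of_spray hab' hcont fun r₀ hr₀ => ?_
    let p₀ := (α (σ r₀)).2
    have hsrc := mem_extChartAt_source (I := 𝓘(ℝ, Model n)) p₀
    refine ⟨p₀, fun r => f (σ r) • derivWithin (coordCurve n p₀ α) (Icc a b) (σ r), hsrc, ?_⟩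
    filter_upwards [eventually_source (n := n) (hcont r₀ hr₀) hsrc, self_mem_nhdsWithin]
      with r h0 hr
    refine ⟨hc p₀ r hr h0, ?_⟩
    have hs := hmaps hr
    set c := coordCurve n p₀ α
    set v := derivWithin c (Icc a b)
    set A := derivWithin v (Icc a b)
    set lam := fun s => (derivWithin (g.timeMomentum α (Icc a b)) (Icc a b) s +
        1 / 2 * g.timeDeriv (α s) (vel n α (Icc a b) s)) / g.timeMomentum α (Icc a b) s
    have hv : HasDerivWithinAt v (A (σ r)) (Icc a b) (σ r) :=
      ((((hα.1.contDiffWithinAt_coordCurve hs h0).derivWithin_infty hS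
        hs)).differentiableWithinAt (by simp)).hasDerivWithinAt
    have hinv := g.isInvertible_chartMetric (coordCurve_mem h0)
    have hspray : f (σ r) ^ 2 • (A (σ r) - lam (σ r) • v (σ r)) =
        spray (g.chartMetric p₀) (c (σ r)) (f (σ r) • v (σ r)) := by
      refine (eulerLagrange_eq_zero_iff hinv _ _).1 fun w => ?_
      refine (eulerLagrange_smul_smul _ _ _ _ _).trans (mul_eq_zero_of_right _ ?_)
      have h1 := g.eulerLagrange_eq_of_not_chron hab hα hn hs h0 w
      have h2 : eulerLagrange (g.chartMetric p₀) (c (σ r)) (v (σ r))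
          (A (σ r) - lam (σ r) • v (σ r)) w = eulerLagrange (g.chartMetric p₀) (c (σ r))
            (v (σ r)) (A (σ r)) w - lam (σ r) * g.chartMetric p₀ (c (σ r)) (v (σ r)) w := by
        simp only [eulerLagrange, map_sub, map_smul, sub_apply, smul_apply, smul_eq_mul]
        ring
      exact h2.trans (sub_eq_zero.2 h1)
    have h3 := HasDerivWithinAt.scomp (g₁ := fun s => f s • v s) r
      ((hfd (σ r) hs).smul hv) (hσ r hr).hasDerivWithinAt hmaps
    refine h3.congr_deriv ?_
    refine Eq.trans ?_ hspray
    simp only [lam]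
    module
  refine ⟨fun r => α (σ r), a', b', hab', by simp only [hσa], by simp only [hσb], hgeo, hgeo.1,
    fun r hr => ?_⟩
  have hs := hmaps hr
  have hsrc := mem_extChartAt_source (I := 𝓘(ℝ, Model n)) (α (σ r)).2
  have hd := hα.1.hasDerivWithinAt_coordCurve hs hsrc
  have h0 := (g.nullCone_vel_iff (hS _ hs) (hα.1.continuousOn _ hs) hsrc hd).1
    ⟨g.bil_eq_zero_of_not_chron hab hα hn hs, (hα.2 _ hs).2⟩
  refine (g.nullCone_vel_iff (hS' r hr) (hcont r hr) hsrc (hc _ r hr hsrc)).2 ⟨?_, ?_⟩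
  · have h1 := h0.1
    change g.chartMetric (α (σ r)).2 (coordCurve n (α (σ r)).2 α (σ r)) _ _ = 0
    rw [map_smul, map_smul, smul_apply, h1, smul_zero, smul_zero]
  · exact mul_pos (hf _ hs) h0.2

variable {g}

/-- Two lightlike geodesic segments in succession, whose outer end points are not chronologically
related, join to a single one: they meet without a corner. -/
theorem exists_join {γ₁ γ₂ : ℝ → ℝ × M} {a b a' b' : ℝ} (hab : a < b) (hab' : a' < b')
    (h₁ : g.IsGeodesicWithin γ₁ (Icc a b)) (k₁ : IsPiece g.nullCone γ₁ a b)
    (h₂ : g.IsGeodesicWithin γ₂ (Icc a' b')) (k₂ : IsPiece g.nullCone γ₂ a' b')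
    (hq : γ₁ b = γ₂ a') (hn : ¬ g.Chron (γ₁ a) (γ₂ b')) :
    ∃ (γ : ℝ → ℝ × M) (c : ℝ), a < c ∧ γ a = γ₁ a ∧ γ c = γ₂ b' ∧
      g.IsGeodesicWithin γ (Icc a c) ∧ IsPiece g.nullCone γ a c := by
  have hb := right_mem_Icc.2 hab.le
  have ha' := left_mem_Icc.2 hab'.le
  set v := vel n γ₁ (Icc a b) b
  set w := vel n γ₂ (Icc a' b') a'
  have hv : g.nullCone (γ₁ b) v := k₁.2 b hb
  have hw : g.nullCone (γ₁ b) w := by rw [hq]; exact k₂.2 a' ha'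
  have hvw := g.smul_eq_smul_of_null hv.1 hw.1 hv.2 hw.2
    (g.not_timelike_corner hab hab' k₁.causal k₂.causal hq hn)
  -- rescale the parameter of the second segment so that the velocities agree
  set κ := v.1 / w.1 with hκ
  have hκ0 : 0 < κ := div_pos hv.2 hw.2
  have hκw : κ • w = v := by
    rw [hκ, div_eq_inv_mul, mul_smul, ← hvw, smul_smul, inv_mul_cancel₀ hw.2.ne', one_smul]
  set d := a' - κ * b with hd
  set c := (b' - d) / κ with hc
  have hcb : κ * c + d = b' := by rw [hc]; field_simp; ring
  have hba : κ * b + d = a' := by rw [hd]; ring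
  have hbc : b < c := by
    by_contra hle
    have := mul_le_mul_of_nonneg_left (not_lt.1 hle) hκ0.le
    linarith
  have hm : MapsTo (fun r => κ * r + d) (Icc b c) (Icc a' b') := fun r hr =>
    ⟨by rw [← hba]; nlinarith [hr.1], by rw [← hcb]; nlinarith [hr.2]⟩
  have h₂' := h₂.comp_affine κ d (uniqueDiffOn_Icc hab') (uniqueDiffOn_Icc hbc) hm
  have k₂' := k₂.comp_affine g.nullCone_smul hκ0 hbc hba hcb
  set η : ℝ → ℝ × M := fun r => γ₂ (κ * r + d)
  have hb' := left_mem_Icc.2 hbc.le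
  have hηb : η b = γ₁ b := by simp only [η, hba, hq]
  have hvη : vel n η (Icc b c) b = v := by
    rw [vel_comp_affine h₂.1 hm hb' (uniqueDiffOn_Icc hab' _ (hm hb'))
      (uniqueDiffOn_Icc hbc b hb')]
    simp only [hba]
    exact hκw
  let γ : ℝ → ℝ × M := fun s => if s ≤ b then γ₁ s else η s
  have e₁ : EqOn γ γ₁ (Icc a b) := fun s hs => if_pos hs.2
  have e₂ : EqOn γ η (Icc b c) := fun s hs => by
    rcases hs.1.eq_or_lt with rfl | h
    · exact (if_pos le_rfl).trans hηb.symm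
    · exact if_neg (not_le.2 h)
  have hS₁ := uniqueDiffOn_Icc hab
  have hS₂ := uniqueDiffOn_Icc hbc
  have g₁ := h₁.congr e₁
  have g₂ := h₂'.congr e₂
  have hsrc := mem_extChartAt_source (I := 𝓘(ℝ, Model n)) (γ b).2
  have hvel : derivWithin (coordCurve n (γ b).2 γ) (Icc a b) b =
      derivWithin (coordCurve n (γ b).2 γ) (Icc b c) b := by
    have i₁ := vel_eq (hS₁ b hb) (g₁.1.continuousOn b hb) hsrc
      (g₁.1.hasDerivWithinAt_coordCurve hb hsrc)
    have i₂ := vel_eq (hS₂ b hb') (g₂.1.continuousOn b hb') hsrc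
      (g₂.1.hasDerivWithinAt_coordCurve hb' hsrc)
    rw [vel_congr e₁ hb] at i₁
    rw [vel_congr e₂ hb', hvη] at i₂
    have i₃ := Prod.ext_iff.1 (i₁.symm.trans i₂)
    exact Prod.ext i₃.1 ((isInvertible_chartInvDeriv
      ((extChartAt 𝓘(ℝ, Model n) (γ b).2).map_source hsrc)).injective i₃.2)
  have hgeo := g₁.union hab hbc g₂ hvel
  refine ⟨γ, c, hab.trans hbc, e₁ (left_mem_Icc.2 hab.le), ?_, hgeo, hgeo.1, fun s hs => ?_⟩
  · rw [e₂ (right_mem_Icc.2 hbc.le)]; simp only [η, hcb]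
  · rcases le_total s b with h | h
    · have hs' : s ∈ Icc a b := ⟨hs.1, h⟩
      have := (k₁.congr e₁).2 s hs'
      rwa [vel_mono hgeo.1 (Icc_subset_Icc_right hbc.le) hs' (hS₁ s hs')] at this
    · have hs' : s ∈ Icc b c := ⟨h, hs.2⟩
      have := (k₂'.congr e₂).2 s hs'
      rwa [vel_mono hgeo.1 (Icc_subset_Icc_left hab.le) hs' (hS₂ s hs')] at this

/-- Points that are causally but not chronologically related are joined by a lightlike geodesic. -/
theorem Causal.exists_null_geodesic {p q : ℝ × M} (h : g.Causal p q) (hne : p ≠ q)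
    (hn : ¬ g.Chron p q) : ∃ (γ : ℝ → ℝ × M) (a b : ℝ), a < b ∧ γ a = p ∧ γ b = q ∧
      g.IsGeodesicWithin γ (Icc a b) ∧ IsPiece g.nullCone γ a b := by
  have h' := g.causal_iff.1 h
  clear h
  induction h' with
  | refl => exact absurd rfl hne
  | @tail r q hpr hrq ih =>
    have hrq' : g.Causal r q := g.causal_iff.2 (.single hrq)
    obtain ⟨α, a₂, b₂, hab₂, rfl, rfl, hα⟩ := hrq
    have hpr' : g.Causal p (α a₂) := g.causal_iff.2 hpr
    obtain ⟨γ₂, a', b', hab', e₁, e₂, h₂, k₂⟩ :=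
      g.exists_null_geodesic_of_isPiece hab₂ hα fun hc => hn (hpr'.trans_chron hc)
    rcases eq_or_ne p (α a₂) with rfl | hne'
    · exact ⟨γ₂, a', b', hab', e₁, e₂, h₂, k₂⟩
    · obtain ⟨γ₁, a, b, hab, rfl, f₂, h₁, k₁⟩ := ih hne' fun hc => hn (hc.trans_causal hrq')
      obtain ⟨γ, c, hac, i₁, i₂, hγ, kγ⟩ := exists_join hab hab' h₁ k₁ h₂ k₂ (f₂.trans e₁.symm)
        (by rwa [e₂])
      exact ⟨γ, a, c, hac, i₁, i₂.trans e₂, hγ, kγ⟩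

end SplitMetric

/-! ### Maximal geodesics and vanishing time separation -/

theorem vel_univ_eq {n : ℕ} {M : Type*} [TopologicalSpace M] [ChartedSpace (Model n) M]
    {γ : ℝ → ℝ × M} {S : Set ℝ} {s : ℝ} (hS : S ∈ 𝓝 s) : vel n γ univ s = vel n γ S s := by
  refine Prod.ext ?_ ?_
  · change derivWithin _ univ s = derivWithin _ S s
    rw [derivWithin_univ, derivWithin_of_mem_nhds hS]
  · change mfderivWithin 𝓘(ℝ, ℝ) 𝓘(ℝ, Model n) (fun r => (γ r).2) univ s (1 : ℝ) =
      mfderivWithin 𝓘(ℝ, ℝ) 𝓘(ℝ, Model n) (fun r => (γ r).2) S s (1 : ℝ)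
    rw [mfderivWithin_univ, mfderivWithin_of_mem_nhds hS]

namespace SplitMetric
variable {n : ℕ} {M : Type*} [TopologicalSpace M] [ChartedSpace (Model n) M]
  [IsManifold 𝓘(ℝ, Model n) ∞ M] (g : SplitMetric n M)

variable {g}

theorem GeodesicEqAt.congr {γ γ' : ℝ → ℝ × M} {s : ℝ} (h : g.GeodesicEqAt γ s)
    (he : γ' =ᶠ[𝓝 s] γ) : g.GeodesicEqAt γ' s := by
  have h0 := he.self_of_nhds
  have hc : coordCurve n (γ s).2 γ' =ᶠ[𝓝 s] coordCurve n (γ s).2 γ :=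
    he.mono fun r hr => by simp only [coordCurve, hr]
  intro w
  have := h w
  rw [h0, hc.deriv.deriv_eq, hc.deriv_eq, hc.self_of_nhds]
  exact this

theorem IsGeodesicOn.congr {γ γ' : ℝ → ℝ × M} {D : Set ℝ} (h : g.IsGeodesicOn γ D)
    (he : EqOn γ' γ D) : g.IsGeodesicOn γ' D :=
  ⟨h.1, h.2.1, h.2.2.1.congr he, fun s hs =>
    (h.2.2.2 s hs).congr (he.eventuallyEq_of_mem (h.1.mem_nhds hs))⟩

/-- Every geodesic has a maximal extension. -/
theorem IsGeodesicOn.exists_maximal {γ : ℝ → ℝ × M} {D : Set ℝ} (h : g.IsGeodesicOn γ D) :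
    ∃ (γ' : ℝ → ℝ × M) (D' : Set ℝ), g.IsMaximalGeodesicOn γ' D' ∧ D ⊆ D' ∧ EqOn γ' γ D := by
  let X := {z : (ℝ → ℝ × M) × Set ℝ // g.IsGeodesicOn z.1 z.2 ∧ D ⊆ z.2 ∧ EqOn z.1 γ D}
  let R : X → X → Prop := fun x y => x.1.2 ⊆ y.1.2 ∧ EqOn y.1.1 x.1.1 x.1.2
  have htrans : ∀ {x y z}, R x y → R y z → R x z := fun h₁ h₂ =>
    ⟨h₁.1.trans h₂.1, fun s hs => (h₂.2 (h₁.1 hs)).trans (h₁.2 hs)⟩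
  have hrefl : ∀ x, R x x := fun x => ⟨Subset.rfl, fun _ _ => rfl⟩
  obtain ⟨⟨⟨γ', D'⟩, hγ', hD', he'⟩, hmax⟩ := exists_maximal_of_chains_bounded (r := R) (by
    intro C hC
    rcases C.eq_empty_or_nonempty with rfl | ⟨x₀, hx₀⟩
    · exact ⟨⟨(γ, D), h, Subset.rfl, fun _ _ => rfl⟩, fun a ha => ha.elim⟩
    have hdir : ∀ x ∈ C, ∀ y ∈ C, R x y ∨ R y x := fun x hx y hy => by
      rcases eq_or_ne x y with rfl | hne
      · exact .inl (hrefl x)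
      · exact hC hx hy hne
    let U : Set ℝ := ⋃ x ∈ C, x.1.2
    have hU : ∀ {s}, s ∈ U ↔ ∃ x ∈ C, s ∈ x.1.2 := by simp [U]
    classical
    -- the common extension of all members of the chain
    let η : ℝ → ℝ × M := fun s => if hs : ∃ x ∈ C, s ∈ x.1.2 then hs.choose.1.1 s else γ s
    have hη : ∀ x ∈ C, EqOn η x.1.1 x.1.2 := fun x hx s hs => by
      have hex : ∃ x ∈ C, s ∈ x.1.2 := ⟨x, hx, hs⟩
      simp only [η, dif_pos hex]
      obtain ⟨h1, h2⟩ := hex.choose_spec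
      rcases hdir x hx _ h1 with h | h
      · exact h.2 hs
      · exact (h.2 h2).symm
    have hUo : IsOpen U := isOpen_biUnion fun x _ => x.2.1.1
    have hgeo : g.IsGeodesicOn η U := by
      refine ⟨hUo, ⟨fun s hs t ht => ?_⟩, ?_, ?_⟩
      · obtain ⟨x, hx, hsx⟩ := hU.1 hs
        obtain ⟨y, hy, hty⟩ := hU.1 ht
        rcases hdir x hx y hy with h | h
        · exact (y.2.1.2.1.out (h.1 hsx) hty).trans fun r hr => hU.2 ⟨y, hy, hr⟩
        · exact (x.2.1.2.1.out hsx (h.1 hty)).trans fun r hr => hU.2 ⟨x, hx, hr⟩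
      · intro s hs
        obtain ⟨x, hx, hsx⟩ := hU.1 hs
        exact (((x.2.1.congr (hη x hx)).2.2.1 s hsx).contMDiffAt
          (x.2.1.1.mem_nhds hsx)).contMDiffWithinAt
      · intro s hs
        obtain ⟨x, hx, hsx⟩ := hU.1 hs
        exact (x.2.1.congr (hη x hx)).2.2.2 s hsx
    refine ⟨⟨(η, U), hgeo, fun s hs => hU.2 ⟨x₀, hx₀, x₀.2.2.1 hs⟩, fun s hs => ?_⟩,
      fun x hx => ⟨fun s hs => hU.2 ⟨x, hx, hs⟩, hη x hx⟩⟩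
    exact (hη x₀ hx₀ (x₀.2.2.1 hs)).trans (x₀.2.2.2 hs)) htrans
  refine ⟨γ', D', ⟨hγ', fun γ₂ D₂ h₂ hsub heq => ?_⟩, hD', he'⟩
  exact (hmax ⟨(γ₂, D₂), h₂, hD'.trans hsub, fun s hs => (heq (hD' hs)).trans (he' hs)⟩
    ⟨hsub, heq⟩).1.antisymm hsub

/-- A geodesic segment, in an affine parameter, extends to a maximal geodesic. -/
theorem IsGeodesicWithin.exists_maximal {γ : ℝ → ℝ × M} {a b κ d : ℝ} (hab : a < b)
    (h : g.IsGeodesicWithin γ (Icc a b)) (hm : MapsTo (fun r => κ * r + d) (Icc 0 1) (Icc a b)) :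
    ∃ (γ' : ℝ → ℝ × M) (D : Set ℝ), g.IsMaximalGeodesicOn γ' D ∧ Icc (0 : ℝ) 1 ⊆ D ∧
      ∀ s ∈ Icc (0 : ℝ) 1, γ' s = γ (κ * s + d) ∧
        vel n γ' univ s = κ • vel n γ (Icc a b) (κ * s + d) := by
  obtain ⟨γ₁, a', b', ha, hb, he, h₁⟩ := h.exists_extension hab
  have hab' : a' < b' := ha.trans (hab.trans hb)
  set D₀ : Set ℝ := (fun r => κ * r + d) ⁻¹' Ioo a' b' with hD₀
  have hD₀o : IsOpen D₀ := isOpen_Ioo.preimage (by fun_prop)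
  have hD₀c : D₀.OrdConnected := by
    refine ⟨fun x hx y hy z hz => ?_⟩
    rcases le_total 0 κ with hκ | hκ
    · exact ⟨hx.1.trans_le (by simp only; nlinarith [hz.1]),
        lt_of_le_of_lt (by simp only; nlinarith [hz.2]) hy.2⟩
    · exact ⟨hy.1.trans_le (by simp only; nlinarith [hz.2]),
        lt_of_le_of_lt (by simp only; nlinarith [hz.1]) hx.2⟩
  have hm₀ : MapsTo (fun r => κ * r + d) D₀ (Icc a' b') := fun r hr => Ioo_subset_Icc_self hr
  have hsub : Icc (0 : ℝ) 1 ⊆ D₀ := fun r hr =>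
    ⟨ha.trans_le (hm hr).1, (hm hr).2.trans_lt hb⟩
  have hgeo := (h₁.comp_affine κ d (uniqueDiffOn_Icc hab') hD₀o.uniqueDiffOn hm₀).isGeodesicOn
    hD₀o hD₀c
  obtain ⟨γ', D, hmax, hD, he'⟩ := hgeo.exists_maximal
  refine ⟨γ', D, hmax, hsub.trans hD, fun s hs => ⟨?_, ?_⟩⟩
  · rw [he' (hsub hs)]; exact he (hm hs)
  · have hIcc : Icc a b ⊆ Icc a' b' := Icc_subset_Icc ha.le hb.le
    rw [vel_univ_eq (hD₀o.mem_nhds (hsub hs)), vel_congr he' (hsub hs),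
      vel_comp_affine h₁.1 hm₀ (hsub hs) (uniqueDiffOn_Icc hab' _ (hm₀ (hsub hs)))
        (hD₀o.uniqueDiffOn s (hsub hs)),
      ← vel_mono h₁.1 hIcc (hm hs) (uniqueDiffOn_Icc hab _ (hm hs)), vel_congr he (hm hs)]

theorem IsCausalPath.causal {p q : ℝ × M} {α : ℝ → ℝ × M} {k : ℕ} {a : ℕ → ℝ}
    (h : g.IsCausalPath p q α k a) {i j : ℕ} (hij : i ≤ j) (hj : j ≤ k) :
    g.Causal (α (a i)) (α (a j)) := by
  induction j, hij using Nat.le_induction with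
  | base => exact .inl rfl
  | succ m him ih =>
    exact (ih (by omega)).trans (g.causal_of_isPiece (h.1.2.2 m (by omega)).le
      (h.2.2.2 m (by omega)))

/-- By push-up no piece of a causal path from `p` to `q` has chronologically related end points, so
all pieces are lightlike and have length zero. -/
theorem timeSep_eq_zero {p q : ℝ × M} (hn : ¬ g.Chron p q) : g.timeSep p q = 0 := by
  simp only [timeSep, ENNReal.iSup_eq_zero, ENNReal.ofReal_eq_zero]
  intro α k a h
  refine (Finset.sum_eq_zero fun j hj => ?_).le
  have hj' : j < k := Finset.mem_range.1 hj
  have hlt := h.1.2.2 j hj'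
  have hn' : ¬ g.Chron (α (a j)) (α (a (j + 1))) := fun hc => by
    have h1 := h.causal (Nat.zero_le j) hj'.le
    have h2 := h.causal (i := j + 1) (j := k) hj' le_rfl
    rw [h.1.1, h.2.1] at h1
    rw [h.1.2.1, h.2.2.1] at h2
    exact hn ((h1.trans_chron hc).trans_causal h2)
  rw [intervalIntegral.integral_congr (g := fun _ => (0 : ℝ)), intervalIntegral.integral_zero]
  intro s hs
  rw [uIcc_of_le hlt.le] at hs
  have := g.bil_eq_zero_of_not_chron hlt (h.2.2.2 j hj') hn' hs
  change Real.sqrt (-(g.bil (α s) (vel n α (Icc (a j) (a (j + 1))) s)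
    (vel n α (Icc (a j) (a (j + 1))) s))) = 0
  rw [this, neg_zero, Real.sqrt_zero]

end SplitMetric

/-! ### Tangency to the boundary of a domain -/

/-- The orthogonal projection of `ℝⁿ` to the hyperplane `{uᵢ = 0}`. -/
def hyperplaneProj {n : ℕ} (i : Fin n) : Model n →L[ℝ] Model n :=
  ContinuousLinearMap.id ℝ (Model n) -
    (EuclideanSpace.proj i : Model n →L[ℝ] ℝ).smulRight (EuclideanSpace.single i (1 : ℝ))

theorem hyperplaneProj_apply_self {n : ℕ} (i : Fin n) (u : Model n) : hyperplaneProj i u i = 0 := by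
  simp [hyperplaneProj]

theorem hyperplaneProj_of_eq_zero {n : ℕ} {i : Fin n} {u : Model n} (hu : u i = 0) :
    hyperplaneProj i u = u := by
  simp [hyperplaneProj, hu]

/-- In a boundary chart, in which `Ω` is a half-space, the topological frontier of `Ω` is the
bounding hyperplane. -/
theorem mem_frontier_iff_of_chart {n : ℕ} {M : Type*} [TopologicalSpace M]
    {φ : OpenPartialHomeomorph M (Model n)} {i : Fin n} {Ω : Set M}
    (h : ∀ q ∈ φ.source, q ∈ Ω ↔ 0 ≤ (φ q) i) {q : M} (hq : q ∈ φ.source) :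
    q ∈ frontier Ω ↔ φ q i = 0 := by
  have hi : ∀ u : Model n, Tendsto (fun r : ℝ => u + r • EuclideanSpace.single i (1 : ℝ))
      (𝓝 0) (𝓝 u) := fun u => by
    have : Continuous fun r : ℝ => u + r • EuclideanSpace.single i (1 : ℝ) := by fun_prop
    simpa using this.tendsto 0
  have hc : ContinuousAt (fun m => φ m i) q :=
    ContinuousAt.comp (g := fun u : Model n => u i)
      (EuclideanSpace.proj (𝕜 := ℝ) i).continuous.continuousAt (φ.continuousAt hq)
  constructor
  · intro hf
    rcases lt_trichotomy (φ q i) 0 with hlt | heq | hgt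
    · exfalso
      refine hf.2 ?_ |>.elim
      have h1 : ∀ᶠ m in 𝓝 q, m ∈ Ωᶜ := by
        filter_upwards [hc.eventually (gt_mem_nhds hlt), φ.open_source.mem_nhds hq] with m hm hms
        rw [mem_compl_iff, h m hms, not_le]; exact hm
      exact absurd (closure_eq_compl_interior_compl (s := Ω) ▸ hf.1)
        (fun hx => hx (mem_interior_iff_mem_nhds.2 h1))
    · exact heq
    · exfalso
      refine hf.2 (mem_interior_iff_mem_nhds.2 ?_)
      filter_upwards [hc.eventually (lt_mem_nhds hgt), φ.open_source.mem_nhds hq] with m hm hms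
      exact (h m hms).2 (le_of_lt hm)
  · intro h0
    refine ⟨subset_closure ((h q hq).2 h0.ge), fun hint => ?_⟩
    -- the coordinate line through `q` leaves `Ω`
    have h1 : ContinuousAt φ.symm (φ q) := φ.continuousAt_symm (φ.map_source hq)
    have h2 : ∀ᶠ m in 𝓝 (φ.symm (φ q)), m ∈ Ω ∧ m ∈ φ.source := by
      rw [φ.left_inv hq]
      have h2 : ∀ᶠ m in 𝓝 q, m ∈ Ω := mem_interior_iff_mem_nhds.1 hint
      exact h2.and (φ.open_source.mem_nhds hq)
    have h3 : ∀ᶠ r in 𝓝[<] (0 : ℝ), _ := ((hi (φ q)).eventually ((h1.eventually h2).and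
      (φ.open_target.mem_nhds (φ.map_source hq)))).filter_mono nhdsWithin_le_nhds
    obtain ⟨r, ⟨⟨h4, h5⟩, h6⟩, hr⟩ := (h3.and self_mem_nhdsWithin).exists
    have h7 := (h _ h5).1 h4
    rw [φ.right_inv h6] at h7
    have h8 : (0 : ℝ) ≤ r := by simpa [h0] using h7
    exact absurd (mem_Iio.1 hr) (not_lt.2 h8)

section Boundary
variable {n : ℕ} {M : Type*} [TopologicalSpace M] [ChartedSpace (Model n) M]

/-- The differential of `φ` at `p`, with the tangent space of `M` unfolded to the model space. -/
def chartDeriv (φ : OpenPartialHomeomorph M (Model n)) (p : M) : Model n →L[ℝ] Model n :=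
  mfderiv 𝓘(ℝ, Model n) 𝓘(ℝ, Model n) φ p

variable {φ : OpenPartialHomeomorph M (Model n)} {i : Fin n} {Ω : Set M}

/-- A vector with vanishing normal component in a boundary chart is the velocity of the curve in
`∂Ω` that is a straight line in that chart. -/
theorem mem_submanifoldTangent_of_chart (hφ : φ ∈ IsManifold.maximalAtlas 𝓘(ℝ, Model n) ∞ M)
    (h : ∀ q ∈ φ.source, q ∈ Ω ↔ 0 ≤ (φ q) i) {p : M} (hp : p ∈ φ.source) (hpf : p ∈ frontier Ω)
    {v : Model n} (hv : chartDeriv φ p v i = 0) :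
    (v : TangentSpace 𝓘(ℝ, Model n) p) ∈ submanifoldTangent n (frontier Ω) p := by
  have h0 := (mem_frontier_iff_of_chart h hp).1 hpf
  set u := chartDeriv φ p v with hu
  let l : ℝ → Model n := fun r => φ p + r • u
  have hl : ContDiff ℝ ∞ l := by fun_prop
  have hl0 : l 0 = φ p := by simp [l]
  have hlt : l 0 ∈ φ.target := hl0 ▸ φ.map_source hp
  obtain ⟨ε, hε, hball⟩ := Metric.eventually_nhds_iff.1
    (hl.continuous.continuousAt.eventually (φ.open_target.mem_nhds hlt))
  have hmem : ∀ r ∈ Ioo (-ε) ε, l r ∈ φ.target := fun r hr => hball (by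
    rw [Real.dist_eq, sub_zero, abs_lt]; exact hr)
  refine Submodule.subset_span ⟨fun r => φ.symm (l r), ε, ?_, hε, ?_, fun r hr => ?_, ?_⟩
  · simp only [hl0, φ.left_inv hp]
  · exact (contMDiffOn_symm_of_mem_maximalAtlas hφ).comp hl.contMDiff.contMDiffOn hmem
  · rw [mem_frontier_iff_of_chart h (φ.map_target (hmem r hr)), φ.right_inv (hmem r hr)]
    simp [l, h0, hv]
  · have e1 : HasMFDerivAt 𝓘(ℝ, Model n) 𝓘(ℝ, Model n) φ p
        (mfderiv 𝓘(ℝ, Model n) 𝓘(ℝ, Model n) φ p) :=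
      ((contMDiffAt_of_mem_maximalAtlas hφ hp).mdifferentiableAt (by simp)).hasMFDerivAt
    have e2 : HasMFDerivAt 𝓘(ℝ, Model n) 𝓘(ℝ, Model n) φ.symm (φ p)
        (mfderiv 𝓘(ℝ, Model n) 𝓘(ℝ, Model n) φ.symm (φ p)) :=
      ((contMDiffAt_symm_of_mem_maximalAtlas hφ (φ.map_source hp)).mdifferentiableAt
        (by simp)).hasMFDerivAt
    have e3 := (e2.comp p e1).congr_of_eventuallyEq (f₁ := id) (by
      filter_upwards [φ.open_source.mem_nhds hp] with m hm
      exact (φ.left_inv hm).symm)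
    have e4 := hasMFDerivAt_unique e3 (hasMFDerivAt_id p)
    have e5 : HasMFDerivAt 𝓘(ℝ, ℝ) 𝓘(ℝ, Model n) l 0
        (ContinuousLinearMap.toSpanSingleton ℝ u) := by
      have : HasDerivAt l u 0 := by
        have := ((hasDerivAt_id (0 : ℝ)).smul_const u).const_add (φ p)
        rwa [one_smul] at this
      exact this.hasFDerivAt.hasMFDerivAt
    have e6 := HasMFDerivAt.comp (I' := 𝓘(ℝ, Model n)) (g := φ.symm) (f := l) 0
      (by rw [hl0]; exact e2) e5
    have e7 := e6.mfderiv
    change v = mfderiv 𝓘(ℝ, ℝ) 𝓘(ℝ, Model n) (φ.symm ∘ l) 0 (1 : ℝ)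
    rw [e7]
    have e8 : v = mfderiv 𝓘(ℝ, Model n) 𝓘(ℝ, Model n) φ.symm (φ p) u :=
      (congrArg (fun L : Model n →L[ℝ] Model n => L v) e4).symm
    refine e8.trans ?_
    change _ = mfderiv 𝓘(ℝ, Model n) 𝓘(ℝ, Model n) φ.symm (φ p)
      (ContinuousLinearMap.toSpanSingleton ℝ u (1 : ℝ))
    rw [ContinuousLinearMap.toSpanSingleton_apply, one_smul]

/-- A vector whose spatial component is not tangent to `∂Ω` is transverse to `ℝ × ∂Ω`. -/
theorem span_sup_lateralTangent_eq_top (hφ : φ ∈ IsManifold.maximalAtlas 𝓘(ℝ, Model n) ∞ M)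
    (h : ∀ q ∈ φ.source, q ∈ Ω ↔ 0 ≤ (φ q) i) {p : M} (hp : p ∈ φ.source) (hpf : p ∈ frontier Ω)
    {v : SpacetimeTangent n p} (hv : chartDeriv φ p v.2 i ≠ 0) :
    Submodule.span ℝ {v} ⊔ lateralTangent n Ω p = ⊤ := by
  refine eq_top_iff.2 fun z _ => ?_
  let k : ℝ := chartDeriv φ p z.2 i / chartDeriv φ p v.2 i
  have h1 : z = k • v + (z - k • v) := by abel
  rw [h1]
  refine Submodule.add_mem_sup (Submodule.smul_mem _ _ (Submodule.mem_span_singleton_self v))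
    (Submodule.mem_prod.2 ⟨trivial, ?_⟩)
  have h2 : ∀ a b : Model n, chartDeriv φ p b i ≠ 0 →
      chartDeriv φ p (a - (chartDeriv φ p a i / chartDeriv φ p b i) • b) i = 0 := fun a b hb => by
    rw [map_sub, map_smul, PiLp.sub_apply, PiLp.smul_apply, smul_eq_mul, div_mul_cancel₀ _ hb,
      sub_self]
  exact mem_submanifoldTangent_of_chart hφ h hp hpf (h2 z.2 v.2 hv)

variable [IsManifold 𝓘(ℝ, Model n) ∞ M]

/-- Where a curve touches `∂Ω` tangentially, it is at nearby parameters chronologically related to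
points of `∂Ω` whose time coordinate differs only slightly. -/
theorem SplitMetric.eventually_chron_of_tangent (g : SplitMetric n M)
    (hφ : φ ∈ IsManifold.maximalAtlas 𝓘(ℝ, Model n) ∞ M)
    (h : ∀ q ∈ φ.source, q ∈ Ω ↔ 0 ≤ (φ q) i) {γ : ℝ → ℝ × M} {S : Set ℝ} {s₀ : ℝ}
    (hγ : SmoothCurveOn n γ S) (hs₀ : s₀ ∈ S)
    (hp : (γ s₀).2 ∈ φ.source) (hpf : (γ s₀).2 ∈ frontier Ω)
    (hv : chartDeriv φ (γ s₀).2 (vel n γ S s₀).2 i = 0) {δ : ℝ} (hδ : 0 < δ) :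
    ∀ᶠ s in 𝓝[S] s₀, s ≠ s₀ → ∃ q ∈ frontier Ω,
      g.Chron ((γ s).1 - δ * |s - s₀|, q) (γ s) ∧
      g.Chron (γ s) ((γ s).1 + δ * |s - s₀|, q) := by
  set p₀ := (γ s₀).2 with hp₀
  have hsrc := mem_extChartAt_source (I := 𝓘(ℝ, Model n)) p₀
  have h0 := (mem_frontier_iff_of_chart h hp).1 hpf
  set π := hyperplaneProj i
  set e := extChartAt 𝓘(ℝ, Model n) p₀
  let u : ℝ → Model n := fun s => φ (γ s).2
  let θ : Model n → Model n := fun z => e (φ.symm z)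
  have hcont : ContinuousWithinAt γ S s₀ := hγ.continuousOn s₀ hs₀
  have hcont2 : ContinuousWithinAt (fun s => (γ s).2) S s₀ := hcont.snd
  have hu : HasDerivWithinAt u (chartDeriv φ p₀ (vel n γ S s₀).2) S s₀ := by
    have e1 : HasMFDerivAt 𝓘(ℝ, Model n) 𝓘(ℝ, Model n) φ p₀
        (mfderiv 𝓘(ℝ, Model n) 𝓘(ℝ, Model n) φ p₀) :=
      ((contMDiffAt_of_mem_maximalAtlas hφ hp).mdifferentiableAt (by simp)).hasMFDerivAt
    have e2 := ((hγ.snd s₀ hs₀).mdifferentiableWithinAt (by simp)).hasMFDerivWithinAt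
    have e3 : HasFDerivWithinAt u ((chartDeriv φ p₀).comp
        (mfderivWithin 𝓘(ℝ, ℝ) 𝓘(ℝ, Model n) (fun r => (γ r).2) S s₀ : ℝ →L[ℝ] Model n)) S s₀ :=
      (e1.comp_hasMFDerivWithinAt s₀ e2).hasFDerivWithinAt
    exact e3.hasDerivWithinAt
  have hut : φ p₀ ∈ φ.target := φ.map_source hp
  have hπ0 : π (φ p₀) = φ p₀ := hyperplaneProj_of_eq_zero h0
  have hθ : HasFDerivAt θ (fderiv ℝ θ (φ p₀)) (φ p₀) := by
    have h1 : ContMDiffAt 𝓘(ℝ, Model n) 𝓘(ℝ, Model n) ∞ φ.symm (φ p₀) :=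
      contMDiffAt_symm_of_mem_maximalAtlas hφ hut
    have h2 : ContMDiffAt 𝓘(ℝ, Model n) 𝓘(ℝ, Model n) ∞ e (φ.symm (φ p₀)) := by
      rw [φ.left_inv hp]; exact contMDiffAt_extChartAt
    exact ((h2.comp (φ p₀) h1).contDiffAt.differentiableAt (by simp)).hasFDerivAt
  have hD1 : HasDerivWithinAt (fun s => θ (u s))
      (fderiv ℝ θ (φ p₀) (chartDeriv φ p₀ (vel n γ S s₀).2)) S s₀ :=
    HasFDerivAt.comp_hasDerivWithinAt (l := θ) (f := u) s₀ hθ hu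
  have hπu : HasDerivWithinAt (fun s => π (u s)) (chartDeriv φ p₀ (vel n γ S s₀).2) S s₀ := by
    have := π.hasFDerivAt.comp_hasDerivWithinAt s₀ hu
    rwa [show π (chartDeriv φ p₀ (vel n γ S s₀).2) = _ from hyperplaneProj_of_eq_zero hv] at this
  have hD2 : HasDerivWithinAt (fun s => θ (π (u s)))
      (fderiv ℝ θ (φ p₀) (chartDeriv φ p₀ (vel n γ S s₀).2)) S s₀ :=
    HasFDerivAt.comp_hasDerivWithinAt (l := θ) (f := fun s => π (u s)) s₀
      (by change HasFDerivAt θ _ (π (φ p₀)); rw [hπ0]; exact hθ) hπu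
  -- the coordinate distance to the projection is of smaller order than `s - s₀`, since `π` fixes
  -- the velocity at `s₀`
  have hD : HasDerivWithinAt (fun s => θ (π (u s)) - θ (u s)) 0 S s₀ := by
    have := hD2.sub hD1
    rwa [sub_self] at this
  set x₀ : ℝ × Model n := coordCurve n p₀ γ s₀ with hx₀
  have hx₀m : x₀ ∈ coordDomain n p₀ := coordCurve_mem hsrc
  obtain ⟨r, hr, H⟩ := g.exists_ball_chron (u₀ := (1, 0)) hx₀m (by
    rw [g.chartMetric_time]
    simpa using g.β_pos _) one_pos
  -- hence, compared with a time difference `δ |s - s₀|`, the displacement is almost parallel to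
  -- `∂_t`
  have hlit := (hasDerivWithinAt_iff_isLittleO.1 hD).def (mul_pos (half_pos hr) hδ)
  have hcc : ContinuousWithinAt (coordCurve n p₀ γ) S s₀ :=
    (hγ.contDiffWithinAt_coordCurve hs₀ hsrc).continuousWithinAt
  have hzero : θ (π (u s₀)) - θ (u s₀) = 0 := by
    change θ (π (φ p₀)) - θ (φ p₀) = 0
    rw [hπ0, sub_self]
  have hab : ContinuousWithinAt (fun s => δ * |s - s₀|) S s₀ := by fun_prop
  have hE : ∀ σ : ℝ, ∀ᶠ s in 𝓝[S] s₀, coordCurve n p₀ γ s +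
      (σ * (δ * |s - s₀|), θ (π (u s)) - θ (u s)) ∈ Metric.ball x₀ r := fun σ => by
    have h1 : ContinuousWithinAt (fun s => coordCurve n p₀ γ s +
      (σ * (δ * |s - s₀|), θ (π (u s)) - θ (u s))) S s₀ :=
      hcc.add ((continuousWithinAt_const.mul hab).prodMk hD.continuousWithinAt)
    refine h1 (Metric.isOpen_ball.mem_nhds ?_)
    simp only [hzero, sub_self, abs_zero, mul_zero]
    rw [show ((0, 0) : ℝ × Model n) = 0 from rfl, add_zero]
    exact Metric.mem_ball_self hr
  have hx : ∀ᶠ s in 𝓝[S] s₀, coordCurve n p₀ γ s ∈ Metric.ball x₀ r :=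
    hcc (Metric.isOpen_ball.mem_nhds (Metric.mem_ball_self hr))
  have hφs : ∀ᶠ s in 𝓝[S] s₀, (γ s).2 ∈ φ.source := hcont2 (φ.open_source.mem_nhds hp)
  have hπt : ContinuousWithinAt (fun s => π (u s)) S s₀ := hπu.continuousWithinAt
  have hπs : ∀ᶠ s in 𝓝[S] s₀, π (u s) ∈ φ.target ∧ φ.symm (π (u s)) ∈ e.source := by
    have h1 : φ.target ∩ φ.symm ⁻¹' e.source ∈ 𝓝 (π (u s₀)) := by
      change _ ∈ 𝓝 (π (φ p₀))
      rw [hπ0]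
      refine inter_mem (φ.open_target.mem_nhds hut) ((φ.continuousAt_symm hut) ?_)
      rw [φ.left_inv hp]
      exact (isOpen_extChartAt_source p₀).mem_nhds hsrc
    exact hπt h1
  filter_upwards [hlit, hE 1, hE (-1), hx, hφs, hπs, eventually_source (n := n) hcont hsrc]
    with s h1 h2 h3 h4 h5 h6 h7 hne
  have hτ : 0 < δ * |s - s₀| := mul_pos hδ (abs_pos.2 (sub_ne_zero.2 hne))
  set τ := δ * |s - s₀| with hτdef
  set D := θ (π (u s)) - θ (u s) with hDdef
  have hnorm : ‖D‖ < r * τ := by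
    rw [hzero, sub_zero, smul_zero, sub_zero, Real.norm_eq_abs] at h1
    calc ‖D‖ ≤ r / 2 * δ * |s - s₀| := h1
      _ = r / 2 * τ := by rw [hτdef]; ring
      _ < r * τ := by nlinarith
  have hball : ∀ σ : ℝ, |σ| = 1 → ((1, (σ * τ⁻¹) • D) : ℝ × Model n) ∈ Metric.ball (1, 0) r :=
    fun σ hσ => by
      rw [mem_ball_iff_norm, Prod.mk_sub_mk, sub_self, sub_zero, Prod.norm_mk, norm_zero,
        norm_smul, Real.norm_eq_abs, abs_mul, hσ, one_mul, abs_of_pos (inv_pos.2 hτ)]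
      refine max_lt hr ?_
      rw [inv_mul_lt_iff₀ hτ, mul_comm]
      exact hnorm
  have hus : θ (u s) = e (γ s).2 := by simp only [θ, u, φ.left_inv h5]
  have hq : ∀ σ : ℝ, coordInv p₀ (coordCurve n p₀ γ s + (σ * τ, D)) =
      ((γ s).1 + σ * τ, φ.symm (π (u s))) := fun σ => by
    refine Prod.ext rfl ?_
    change e.symm (e (γ s).2 + D) = φ.symm (π (u s))
    rw [hDdef, hus, add_sub_cancel]
    exact e.left_inv h6.2
  refine ⟨φ.symm (π (u s)), ?_, ?_, ?_⟩
  · rw [mem_frontier_iff_of_chart h (φ.map_target h6.1), φ.right_inv h6.1]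
    exact hyperplaneProj_apply_self i _
  · have e1 : coordCurve n p₀ γ s + (-1 * τ, D) + τ • ((1, (-1 * τ⁻¹) • D) : ℝ × Model n) =
        coordCurve n p₀ γ s := by
      refine Prod.ext (by simp) ?_
      simp only [Prod.snd_add, Prod.smul_snd, smul_smul]
      rw [show τ * (-1 * τ⁻¹) = -1 by field_simp, neg_one_smul, add_neg_cancel_right]
    have := H _ h3 _ (hball (-1) (by simp)) τ hτ (by rw [e1]; exact h4)
    rw [e1, hq, coordInv_coordCurve h7] at this
    rwa [neg_one_mul, ← sub_eq_add_neg] at this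
  · have e1 : coordCurve n p₀ γ s + τ • ((1, (1 * τ⁻¹) • D) : ℝ × Model n) =
        coordCurve n p₀ γ s + (1 * τ, D) := by
      refine Prod.ext (by simp) ?_
      simp only [Prod.snd_add, Prod.smul_snd, smul_smul]
      rw [show τ * (1 * τ⁻¹) = 1 by field_simp, one_smul]
    have := H _ h4 _ (hball 1 (by simp)) τ hτ (by rw [e1]; exact h2)
    rw [e1, hq, coordInv_coordCurve h7] at this
    rwa [one_mul] at this

end Boundary

/-! ### Optimal geodesics from the lateral boundary -/

section LateralBoundary
variable {M : Type*} [TopologicalSpace M]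

theorem isCompact_lateralBoundary [T2Space M] {Ω : Set M} (hΩ : IsCompact Ω) (T : ℝ) :
    IsCompact (lateralBoundary T Ω) :=
  isCompact_Icc.prod (hΩ.of_isClosed_subset isClosed_frontier hΩ.isClosed.frontier_subset)

/-- A connected set that meets a closed set, but not its frontier, is contained in it. -/
theorem IsPreconnected.subset_of_disjoint_frontier {Ω A : Set M} (hΩ : IsClosed Ω)
    (hA : IsPreconnected A) (h : ∀ p ∈ A, p ∉ frontier Ω) (hne : (A ∩ Ω).Nonempty) : A ⊆ Ω := by
  have hint : ∀ p ∈ A, p ∈ Ω → p ∈ interior Ω := fun p hp hpΩ => by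
    by_contra hi
    exact h p hp ⟨subset_closure hpΩ, hi⟩
  obtain ⟨p, hp, hpΩ⟩ := hne
  refine (hA.subset_left_of_subset_union isOpen_interior hΩ.isOpen_compl
    (disjoint_compl_right.mono_left interior_subset) (fun q hq => ?_)
    ⟨p, hp, hint p hp hpΩ⟩).trans interior_subset
  by_cases hqΩ : q ∈ Ω
  · exact .inl (hint q hq hqΩ)
  · exact .inr hqΩ

end LateralBoundary

namespace SplitMetric
variable {n : ℕ} {M : Type*} [TopologicalSpace M] [T2Space M] [ChartedSpace (Model n) M]
  [IsManifold 𝓘(ℝ, Model n) ∞ M] {g : SplitMetric n M}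

/-- The geodesic starts at the latest point of the lateral boundary in the causal past of `x`. -/
theorem exists_future_optimal_geodesic (hg : ∀ p q, IsCompact (g.JPlus p ∩ g.JMinus q))
    {Ω : Set M} (hΩ : IsCompactDomain n Ω) {T : ℝ} {x : ℝ × M}
    (hx : x ∈ Icc (0 : ℝ) T ×ˢ Ω) (hxS : x ∉ lateralBoundary T Ω)
    (hxI : x ∈ g.IPlus (lateralBoundary T Ω)) :
    ∃ (γ : ℝ → ℝ × M) (D : Set ℝ),
      g.IsFutureOptimalGeodesic (lateralBoundary T Ω) (Icc (0 : ℝ) T ×ˢ Ω) x γ D ∧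
      FirstIntersectionTransverse n T Ω γ := by
  -- the latest point of the lateral boundary in the causal past of `x`
  obtain ⟨z, ⟨hzS, hzJ⟩, hmax⟩ : ∃ z ∈ lateralBoundary T Ω ∩ g.JMinus x,
      IsMaxOn Prod.fst (lateralBoundary T Ω ∩ g.JMinus x) z := by
    refine ((isCompact_lateralBoundary hΩ.1 T).inter_right (g.isClosed_JMinus hg x)).exists_isMaxOn
      ?_ continuous_fst.continuousOn
    obtain ⟨y, hy, hyx⟩ := hxI
    exact ⟨y, hy, hyx.causal⟩
  have hmax' : ∀ y ∈ lateralBoundary T Ω, g.Causal y x → y.1 ≤ z.1 :=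
    fun y hy hyx => hmax ⟨hy, hyx⟩
  have hzx : z ≠ x := fun h => hxS (h ▸ hzS)
  have hlt : z.1 < x.1 := Causal.fst_lt hzJ hzx
  -- otherwise `z` could be moved to a later point of the lateral boundary
  have hn : ¬ g.Chron z x := fun hc => by
    obtain ⟨ε₀, hε₀, H⟩ := hc.exists_shift_left
    obtain ⟨ε, hε, hε'⟩ := exists_between (lt_min hε₀ (sub_pos.2 hlt))
    have h1 := hmax' (shift z ε) ⟨⟨add_nonneg hzS.1.1 hε.le, by
      have := hε'.trans_le (min_le_right _ _)
      have := hx.1.2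
      change z.1 + ε ≤ T
      linarith⟩, hzS.2⟩ (H ε ⟨hε, hε'.trans_le (min_le_left _ _)⟩).causal
    change z.1 + ε ≤ z.1 at h1
    linarith
  obtain ⟨γ, a, b, hab, ha, hb, hgeo, hnull⟩ := Causal.exists_null_geodesic hzJ hzx hn
  have haI := left_mem_Icc.2 hab.le
  have hbI := right_mem_Icc.2 hab.le
  have htime : StrictMonoOn (fun s => (γ s).1) (Icc a b) := hnull.strictMonoOn_fst fun _ _ h => h.2
  have hJ : ∀ s ∈ Icc a b, g.Causal (γ s) x := fun s hs => by
    rcases hs.2.eq_or_lt with rfl | h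
    · exact .inl hb
    · rw [← hb]
      exact g.causal_of_isPiece hs.2 (hnull.causal.mono h (Icc_subset_Icc_left hs.1))
  have hT : ∀ s ∈ Icc a b, (γ s).1 ∈ Icc 0 T := fun s hs => by
    have h1 := htime.monotoneOn haI hs hs.1
    have h2 := htime.monotoneOn hs hbI hs.2
    simp only [ha, hb] at h1 h2
    exact ⟨hzS.1.1.trans h1, h2.trans hx.1.2⟩
  -- after `z` the geodesic does not meet the lateral boundary again, so it cannot leave `Ω`
  have hfr : ∀ s ∈ Ioc a b, (γ s).2 ∉ frontier Ω := fun s hs hf => by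
    have hs' : s ∈ Icc a b := Ioc_subset_Icc_self hs
    have h1 := htime haI hs' hs.1
    simp only [ha] at h1
    exact absurd (hmax' (γ s) ⟨hT s hs', hf⟩ (hJ s hs')) (not_le.2 h1)
  have hin : ∀ s ∈ Icc a b, (γ s).2 ∈ Ω := fun s hs => by
    rcases hs.1.eq_or_lt with rfl | h
    · rw [ha]; exact hΩ.1.isClosed.frontier_subset hzS.2
    · have hpre : IsPreconnected ((fun s => (γ s).2) '' Ioc a b) :=
        isPreconnected_Ioc.image _ ((hgeo.1.continuousOn.snd).mono Ioc_subset_Icc_self)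
      refine hpre.subset_of_disjoint_frontier hΩ.1.isClosed ?_ ⟨(γ b).2, ⟨b, ⟨hab, le_rfl⟩, rfl⟩,
        by rw [hb]; exact hx.2⟩ ⟨s, ⟨h, hs.2⟩, rfl⟩
      rintro _ ⟨r, hr, rfl⟩
      exact hfr r hr
  have hpf : (γ a).2 ∈ frontier Ω := by rw [ha]; exact hzS.2
  obtain ⟨φ, hφ, hpφ, i, hi⟩ := hΩ.2 _ hpf
  -- at a tangential point of speed `m` in time, some boundary point in the past of `γ s` is
  -- earlier than `γ s` by `m/2 (s - a)` only; as `z` is earlier by about `m (s - a)`, that point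
  -- is later than `z`
  have htrans : chartDeriv φ (γ a).2 (vel n γ (Icc a b) a).2 i ≠ 0 := fun h0 => by
    set m := (vel n γ (Icc a b) a).1
    have hm : 0 < m := (hnull.2 a haI).2
    have hd : HasDerivWithinAt (fun s => (γ s).1) m (Icc a b) a :=
      ((hgeo.1.fst.differentiableOn (by simp)) a haI).hasDerivWithinAt
    have h1 := (hasDerivWithinAt_iff_isLittleO.1 hd).def (by positivity : 0 < m / 4)
    have h2 := g.eventually_chron_of_tangent hφ hi hgeo.1 haI hpφ hpf h0
      (by positivity : 0 < m / 2)
    have hne : (𝓝[Ioc a b] a).NeBot := by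
      rw [nhdsWithin_Ioc_eq_nhdsGT hab]; infer_instance
    obtain ⟨s, ⟨h3, h4⟩, hs⟩ := (((h1.and h2).filter_mono
      (nhdsWithin_mono a Ioc_subset_Icc_self)).and self_mem_nhdsWithin).exists
    have hs' : s ∈ Icc a b := Ioc_subset_Icc_self hs
    obtain ⟨q, hq, hq', -⟩ := h4 hs.1.ne'
    have hsa : 0 < s - a := sub_pos.2 hs.1
    rw [abs_of_pos hsa] at hq'
    rw [Real.norm_eq_abs, Real.norm_eq_abs, abs_of_pos hsa, abs_le, smul_eq_mul, ha] at h3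
    have h5 : z.1 < (γ s).1 - m / 2 * (s - a) := by nlinarith [h3.1, mul_pos hm hsa]
    have h6 := hmax' _ ⟨⟨hzS.1.1.trans h5.le, by
      have := (hT s hs').2
      have : 0 ≤ m / 2 * (s - a) := by positivity
      change (γ s).1 - m / 2 * (s - a) ≤ T
      linarith⟩, hq⟩ (hq'.causal.trans (hJ s hs'))
    exact absurd h6 (not_le.2 h5)
  have hκ : 0 < b - a := sub_pos.2 hab
  have hm : MapsTo (fun r => (b - a) * r + a) (Icc (0 : ℝ) 1) (Icc a b) := fun r hr =>
    ⟨by nlinarith [hr.1], by nlinarith [hr.2]⟩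
  obtain ⟨γ', D, hD, hsub, hγ'⟩ := hgeo.exists_maximal hab hm
  have h0I : (0 : ℝ) ∈ Icc (0 : ℝ) 1 := ⟨le_rfl, zero_le_one⟩
  have e0 : γ' 0 = γ a := by rw [(hγ' 0 h0I).1, mul_zero, zero_add]
  have e1 : γ' 1 = γ b := by rw [(hγ' 1 ⟨zero_le_one, le_rfl⟩).1, mul_one, sub_add_cancel]
  refine ⟨γ', D, ⟨hD, hsub, fun s hs => ?_, z, ⟨hzJ, hzS⟩, e0.trans ha, e1.trans hb,
    timeSep_eq_zero hn⟩, 0, ⟨⟨h0I, ?_⟩, fun s hs => hs.1.1⟩, ?_⟩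
  · obtain ⟨h1, h2⟩ := hγ' s hs
    have h3 := g.nullCone_smul _ _ _ hκ (hnull.2 _ (hm hs))
    have h4 : g.nullCone (γ' s) (vel n γ' univ s) := by rw [h1, h2]; exact h3
    exact ⟨by rw [h1]; exact ⟨hT _ (hm hs), hin _ (hm hs)⟩, h4⟩
  · rw [e0, ha]; exact hzS
  · refine span_sup_lateralTangent_eq_top hφ hi (by rw [e0]; exact hpφ) (by rw [e0]; exact hpf) ?_
    change chartDeriv φ (γ' 0).2 (vel n γ' univ 0).2 i ≠ 0
    rw [(hγ' 0 h0I).2, e0, mul_zero, zero_add, Prod.smul_snd, map_smul, PiLp.smul_apply,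
      smul_eq_mul]
    exact mul_ne_zero hκ.ne' htrans

/-- The geodesic starts at the earliest point of the lateral boundary in the causal future
of `x`. -/
theorem exists_past_optimal_geodesic (hg : ∀ p q, IsCompact (g.JPlus p ∩ g.JMinus q))
    {Ω : Set M} (hΩ : IsCompactDomain n Ω) {T : ℝ} {x : ℝ × M}
    (hx : x ∈ Icc (0 : ℝ) T ×ˢ Ω) (hxS : x ∉ lateralBoundary T Ω)
    (hxI : x ∈ g.IMinus (lateralBoundary T Ω)) :
    ∃ (γ : ℝ → ℝ × M) (D : Set ℝ),
      g.IsPastOptimalGeodesic (lateralBoundary T Ω) (Icc (0 : ℝ) T ×ˢ Ω) x γ D ∧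
      FirstIntersectionTransverse n T Ω γ := by
  -- the earliest point of the lateral boundary in the causal future of `x`
  obtain ⟨z, ⟨hzS, hzJ⟩, hmin⟩ : ∃ z ∈ lateralBoundary T Ω ∩ g.JPlus x,
      IsMinOn Prod.fst (lateralBoundary T Ω ∩ g.JPlus x) z := by
    refine ((isCompact_lateralBoundary hΩ.1 T).inter_right (g.isClosed_JPlus hg x)).exists_isMinOn
      ?_ continuous_fst.continuousOn
    obtain ⟨y, hy, hxy⟩ := hxI
    exact ⟨y, hy, hxy.causal⟩
  have hmin' : ∀ y ∈ lateralBoundary T Ω, g.Causal x y → z.1 ≤ y.1 :=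
    fun y hy hxy => hmin ⟨hy, hxy⟩
  have hxz : x ≠ z := fun h => hxS (h ▸ hzS)
  have hlt : x.1 < z.1 := Causal.fst_lt hzJ hxz
  -- otherwise `z` could be moved to an earlier point of the lateral boundary
  have hn : ¬ g.Chron x z := fun hc => by
    obtain ⟨ε₀, hε₀, H⟩ := hc.exists_shift_right
    obtain ⟨ε, hε, hε'⟩ := exists_between (lt_min hε₀ (sub_pos.2 hlt))
    have h1 := hmin' (shift z (-ε)) ⟨⟨by
      have := hε'.trans_le (min_le_right _ _)
      have := hx.1.1
      change 0 ≤ z.1 + -ε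
      linarith, by
      have := hzS.1.2
      change z.1 + -ε ≤ T
      linarith⟩, hzS.2⟩ (H ε ⟨hε, hε'.trans_le (min_le_left _ _)⟩).causal
    change z.1 ≤ z.1 + -ε at h1
    linarith
  obtain ⟨γ, a, b, hab, ha, hb, hgeo, hnull⟩ := Causal.exists_null_geodesic hzJ hxz hn
  have haI := left_mem_Icc.2 hab.le
  have hbI := right_mem_Icc.2 hab.le
  have htime : StrictMonoOn (fun s => (γ s).1) (Icc a b) := hnull.strictMonoOn_fst fun _ _ h => h.2
  have hJ : ∀ s ∈ Icc a b, g.Causal x (γ s) := fun s hs => by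
    rcases hs.1.eq_or_lt with rfl | h
    · exact .inl ha.symm
    · rw [← ha]
      exact g.causal_of_isPiece hs.1 (hnull.causal.mono h (Icc_subset_Icc_right hs.2))
  have hT : ∀ s ∈ Icc a b, (γ s).1 ∈ Icc 0 T := fun s hs => by
    have h1 := htime.monotoneOn haI hs hs.1
    have h2 := htime.monotoneOn hs hbI hs.2
    simp only [ha, hb] at h1 h2
    exact ⟨hx.1.1.trans h1, h2.trans hzS.1.2⟩
  -- before `z` the geodesic does not meet the lateral boundary, so it stays in `Ω`
  have hfr : ∀ s ∈ Ico a b, (γ s).2 ∉ frontier Ω := fun s hs hf => by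
    have hs' : s ∈ Icc a b := Ico_subset_Icc_self hs
    have h1 := htime hs' hbI hs.2
    simp only [hb] at h1
    exact absurd (hmin' (γ s) ⟨hT s hs', hf⟩ (hJ s hs')) (not_le.2 h1)
  have hin : ∀ s ∈ Icc a b, (γ s).2 ∈ Ω := fun s hs => by
    rcases hs.2.eq_or_lt with rfl | h
    · rw [hb]; exact hΩ.1.isClosed.frontier_subset hzS.2
    · have hpre : IsPreconnected ((fun s => (γ s).2) '' Ico a b) :=
        isPreconnected_Ico.image _ ((hgeo.1.continuousOn.snd).mono Ico_subset_Icc_self)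
      refine hpre.subset_of_disjoint_frontier hΩ.1.isClosed ?_ ⟨(γ a).2, ⟨a, ⟨le_rfl, hab⟩, rfl⟩,
        by rw [ha]; exact hx.2⟩ ⟨s, ⟨hs.1, h⟩, rfl⟩
      rintro _ ⟨r, hr, rfl⟩
      exact hfr r hr
  have hpf : (γ b).2 ∈ frontier Ω := by rw [hb]; exact hzS.2
  obtain ⟨φ, hφ, hpφ, i, hi⟩ := hΩ.2 _ hpf
  -- at a tangential point of speed `m` in time, some boundary point in the future of `γ s` is
  -- later than `γ s` by `m/2 (b - s)` only; as `z` is later by about `m (b - s)`, that point is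
  -- earlier than `z`
  have htrans : chartDeriv φ (γ b).2 (vel n γ (Icc a b) b).2 i ≠ 0 := fun h0 => by
    set m := (vel n γ (Icc a b) b).1
    have hm : 0 < m := (hnull.2 b hbI).2
    have hd : HasDerivWithinAt (fun s => (γ s).1) m (Icc a b) b :=
      ((hgeo.1.fst.differentiableOn (by simp)) b hbI).hasDerivWithinAt
    have h1 := (hasDerivWithinAt_iff_isLittleO.1 hd).def (by positivity : 0 < m / 4)
    have h2 := g.eventually_chron_of_tangent hφ hi hgeo.1 hbI hpφ hpf h0
      (by positivity : 0 < m / 2)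
    have hne : (𝓝[Ico a b] b).NeBot := by
      rw [nhdsWithin_Ico_eq_nhdsLT hab]; infer_instance
    obtain ⟨s, ⟨h3, h4⟩, hs⟩ := (((h1.and h2).filter_mono
      (nhdsWithin_mono b Ico_subset_Icc_self)).and self_mem_nhdsWithin).exists
    have hs' : s ∈ Icc a b := Ico_subset_Icc_self hs
    obtain ⟨q, hq, -, hq'⟩ := h4 hs.2.ne
    have hsb : s - b < 0 := sub_neg.2 hs.2
    rw [abs_of_neg hsb] at hq'
    rw [Real.norm_eq_abs, Real.norm_eq_abs, abs_of_neg hsb, abs_le, smul_eq_mul, hb] at h3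
    have h5 : (γ s).1 + m / 2 * -(s - b) < z.1 := by
      nlinarith [h3.2, mul_pos_of_neg_of_neg (neg_lt_zero.2 hm) hsb]
    have h6 := hmin' _ ⟨⟨by
      have := (hT s hs').1
      have : 0 ≤ m / 2 * -(s - b) := mul_nonneg (by positivity) (by linarith)
      change 0 ≤ (γ s).1 + m / 2 * -(s - b)
      linarith, h5.le.trans hzS.1.2⟩, hq⟩ ((hJ s hs').trans hq'.causal)
    exact absurd h6 (not_le.2 h5)
  have hκ : 0 < b - a := sub_pos.2 hab
  -- run through the geodesic from `x` to `z` backwards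
  have hm : MapsTo (fun r => (a - b) * r + b) (Icc (0 : ℝ) 1) (Icc a b) := fun r hr =>
    ⟨by nlinarith [hr.2], by nlinarith [hr.1]⟩
  obtain ⟨γ', D, hD, hsub, hγ'⟩ := hgeo.exists_maximal hab hm
  have h0I : (0 : ℝ) ∈ Icc (0 : ℝ) 1 := ⟨le_rfl, zero_le_one⟩
  have e0 : γ' 0 = γ b := by rw [(hγ' 0 h0I).1, mul_zero, zero_add]
  have e1 : γ' 1 = γ a := by rw [(hγ' 1 ⟨zero_le_one, le_rfl⟩).1, mul_one, sub_add_cancel]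
  refine ⟨γ', D, ⟨hD, hsub, fun s hs => ?_, z, ⟨hzJ, hzS⟩, e0.trans hb, e1.trans ha,
    timeSep_eq_zero hn⟩, 0, ⟨⟨h0I, ?_⟩, fun s hs => hs.1.1⟩, ?_⟩
  · obtain ⟨h1, h2⟩ := hγ' s hs
    have h3 := hnull.2 _ (hm hs)
    have h4 : g.bil (γ' s) (vel n γ' univ s) (vel n γ' univ s) = 0 := by
      rw [h1, h2, bil_smul_smul, h3.1, mul_zero]
    have h5 : (vel n γ' univ s).1 < 0 := by
      rw [h2]; exact mul_neg_of_neg_of_pos (sub_neg.2 hab) h3.2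
    exact ⟨by rw [h1]; exact ⟨hT _ (hm hs), hin _ (hm hs)⟩, h4, h5⟩
  · rw [e0, hb]; exact hzS
  · refine span_sup_lateralTangent_eq_top hφ hi (by rw [e0]; exact hpφ) (by rw [e0]; exact hpf) ?_
    change chartDeriv φ (γ' 0).2 (vel n γ' univ 0).2 i ≠ 0
    rw [(hγ' 0 h0I).2, e0, mul_zero, zero_add, Prod.smul_snd, map_smul, PiLp.smul_apply,
      smul_eq_mul]
    exact mul_ne_zero (sub_neg.2 hab).ne htrans

end SplitMetric

theorem lemma4p1 {n : ℕ} (hn : 2 ≤ n) {M : Type*} [TopologicalSpace M] [T2Space M]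
    [SecondCountableTopology M] [ChartedSpace (Model n) M] [IsManifold 𝓘(ℝ, Model n) ∞ M]
    (g : SplitMetric n M) (hg : g.GloballyHyperbolic)
    (Ω : Set M) (hΩ : IsCompactDomain n Ω) (T : ℝ) (hT : 0 < T)
    (x : ℝ × M) (hx : x ∈ Icc (0 : ℝ) T ×ˢ Ω) (hxS : x ∉ lateralBoundary T Ω) :
    (x ∈ g.IPlus (lateralBoundary T Ω) →
      ∃ (γ : ℝ → ℝ × M) (D : Set ℝ),
        g.IsFutureOptimalGeodesic (lateralBoundary T Ω) (Icc (0 : ℝ) T ×ˢ Ω) x γ D ∧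
        FirstIntersectionTransverse n T Ω γ) ∧
    (x ∈ g.IMinus (lateralBoundary T Ω) →
      ∃ (γ : ℝ → ℝ × M) (D : Set ℝ),
        g.IsPastOptimalGeodesic (lateralBoundary T Ω) (Icc (0 : ℝ) T ×ˢ Ω) x γ D ∧
        FirstIntersectionTransverse n T Ω γ) :=
  ⟨SplitMetric.exists_future_optimal_geodesic hg.2 hΩ hx hxS,
    SplitMetric.exists_past_optimal_geodesic hg.2 hΩ hx hxS⟩
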